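/- A dynamical system on $\mathbb R^k$ is a $C^\infty$ flow $\Phi\colon\mathbb R\times\mathbb R^k\to\mathbb R^k$; its equilibria are the points fixed by all $\Phi^t$. A linearizing embedding of $\Phi$ is a smooth embedding $f\colon\mathbb R^k\to\mathbb R^n$ (a $C^\infty$ map that is a homeomorphism onto its image and has injective derivatives) such that $\exp(tA)\circ f=f\circ\Phi^t$ for all $t\in\mathbb R$, for some real $n\times n$ matrix $A$; it is then said to be into the linear flow of $A$. (1) For every $k\ge 2$ and every $\ell\in\{0,1,2,\dots\}\cup\{\infty\}$ ($\infty$ meaning countably infinite) there is a dynamical system on $\mathbb R^k$ that has exactly $\ell$ equilibria, all of them isolated, and that admits a linearizing embedding into a linear flow on some $\mathbb R^n$. (2) Consider the linear flow on $\mathbb R^3$ of $\dot x=y,\ \dot y=x,\ \dot z=0$. Let $Q_{\pm1}=\{(x,y,z):|y|<\pm x\}$ be the sets of points whose $(x,y)$ lies in the open quadrant, bounded by the lines $y=\pm x$, that contains $(\pm1,0)$. Let $2\le\ell\le\infty$ and $I_\ell=[0,\ell-1]$ (so $I_\infty=[0,\infty)$). Call a smooth curve $\gamma=(x,y,z)\colon\mathbb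 R\to\mathbb R^3$ an $\ell$-snake if on $I_\ell$ it has $\dot\gamma\neq0$ and $y=0$; if $\gamma(j)=(0,0,j)$ and $z^{(n)}(j)=0$ for all $n\ge1$ and all integers $0\le j<\ell$; and if $(-1)^{j+1}x>0$ and $\dot z>0$ on $(j,j+1)$ for all integers $j\ge0$ with $j+1<\ell$. For integers $0\le j<\ell$ let $A_j^\ell$ be the plane $z=j$ with $Q_{(-1)^j}$ removed if $j\ge1$, and with $Q_{(-1)^{j+1}}$ removed if $j+1<\ell$. Let $B$ be the union of the orbits of the linear flow that meet $\gamma(I_\ell)$, and let $$\Sigma^\ell=\bigcup_{0\le j<\ell}A_j^\ell\ \cup\ B .$$ In particular $\Sigma^2=A_1\cup B\cup A_0$, where $A_0,A_1$ are the planes $z=0$ and $z=1$ with the quadrant containing $(x,y)=(-1,0)$ removed, and $B$ is the union of the orbits that meet $\gamma([0,1])$. For every $\ell$ with $2\le\ell\le\infty$, $\ell$-snakes exist, and for each of them the surface $\Sigma^\ell$ is invariant under the linear flow and is the image of a linearizing embedding $f\colon\mathbb R^2\to\mathbb R^3$, into this linear flow, of a dynamical system on $\mathbb R^2$ that has exactly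 $\ell$ equilibria, all of them isolated. (3) Let $\Phi$ be a dynamical system on $\mathbb R^2$ with exactly $\ell\in\{0,1,2,\dots\}\cup\{\infty\}$ equilibria, all of them isolated, and let $f\colon\mathbb R^2\to\mathbb R^n$ be a linearizing embedding of $\Phi$ into the linear flow of $A$. Then for every $m\ge0$ the flow $(x,w)\mapsto(\Phi^t(x),e^tw)$ on $\mathbb R^2\times\mathbb R^m$, obtained by adding $\dot w=w$, is a dynamical system with exactly $\ell$ equilibria, all of them isolated, and $(x,w)\mapsto(f(x),w)$ is a linearizing embedding of it into the linear flow of $\begin{pmatrix}A&0\\0&I\end{pmatrix}$. -/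

import Mathlib

open scoped ContDiff Topology

/-- The Euclidean space with coordinates indexed by `ι`; `Eucl (Fin k)` is `ℝ^k`, and
`Eucl (Fin k ⊕ Fin m)` is `ℝ^k × ℝ^m`. -/
abbrev Eucl (ι : Type) : Type := EuclideanSpace ℝ ι

/-- A (globally defined) flow `ℝ × ℝ^ι → ℝ^ι` is smooth if it is jointly `C^∞` in time and space. -/
def IsSmoothFlow {ι : Type} [Fintype ι] (Φ : Flow ℝ (Eucl ι)) : Prop :=
  ContDiff ℝ ∞ (fun p : ℝ × Eucl ι => Φ p.1 p.2)

/-- The equilibria of a flow: the points fixed for all times. -/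
def equilibria {ι : Type} [Fintype ι] (Φ : Flow ℝ (Eucl ι)) : Set (Eucl ι) :=
  {x | ∀ t : ℝ, Φ t x = x}

/-- The flow has exactly `ℓ` equilibria (`ℓ = ⊤`: countably infinitely many), and each of them is
isolated in the set of all equilibria. -/
structure HasIsolatedEquilibria {ι : Type} [Fintype ι] (Φ : Flow ℝ (Eucl ι)) (ℓ : ℕ∞) : Prop where
  countable : (equilibria Φ).Countable
  encard_eq : (equilibria Φ).encard = ℓ
  isolated : ∀ x ∈ equilibria Φ, ∃ U ∈ 𝓝 x, U ∩ equilibria Φ = {x}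

/-- The time-`t` map `v ↦ exp (t A) v` of the linear system `v' = A v`. -/
noncomputable def linearFlow {κ : Type} [Fintype κ] [DecidableEq κ] (A : Matrix κ κ ℝ)
    (t : ℝ) (v : Eucl κ) : Eucl κ :=
  WithLp.toLp 2 ((NormedSpace.exp (t • A)).mulVec v.ofLp)

/-- `f` is a linearizing embedding of the flow `Φ` into the linear flow generated by `A`: a smooth
embedding (homeomorphism onto the image with injective derivatives) that is equivariant. -/
structure IsLinearizingEmbedding {ι κ : Type} [Fintype ι] [Fintype κ] [DecidableEq κ]
    (Φ : Flow ℝ (Eucl ι)) (A : Matrix κ κ ℝ) (f : Eucl ι → Eucl κ) : Prop where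
  smooth : ContDiff ℝ ∞ f
  isEmbedding : Topology.IsEmbedding f
  immersion : ∀ x, Function.Injective (fderiv ℝ f x)
  equivariant : ∀ (t : ℝ) (x : Eucl ι), linearFlow A t (f x) = f (Φ t x)

/-- The flow embeds equivariantly into a linear flow on some `ℝ^n`. -/
def AdmitsLinearizingEmbedding {ι : Type} [Fintype ι] (Φ : Flow ℝ (Eucl ι)) : Prop :=
  ∃ (n : ℕ) (A : Matrix (Fin n) (Fin n) ℝ) (f : Eucl ι → Eucl (Fin n)),
    IsLinearizingEmbedding Φ A f

/-! ### The surfaces in `ℝ³`; the coordinates `x, y, z` are the coordinates `0, 1, 2` -/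

/-- The matrix of the linear system `x' = y, y' = x, z' = 0`. -/
def hyperbolicMatrix : Matrix (Fin 3) (Fin 3) ℝ :=
  !![0, 1, 0; 1, 0, 0; 0, 0, 0]

/-- For `σ = 1` or `σ = -1`: the points whose `(x, y)` lies in the open quadrant, among the four
into which the lines `y = x` and `y = -x` divide the plane, that contains `(σ, 0)`. -/
def quadrant (σ : ℝ) : Set (Eucl (Fin 3)) :=
  {p | |p 1| < σ * p 0}

/-- The plane `z = h` with the quadrants containing `(σ, 0)`, `σ ∈ S`, removed. -/
def cutPlane (h : ℝ) (S : Set ℝ) : Set (Eucl (Fin 3)) :=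
  {p | p 2 = h} \ ⋃ σ ∈ S, quadrant σ

/-- The union of the orbits of the system `x' = y, y' = x, z' = 0` that meet `C`. -/
def orbitsThrough (C : Set (Eucl (Fin 3))) : Set (Eucl (Fin 3)) :=
  {p | ∃ q ∈ C, ∃ t : ℝ, p = linearFlow hyperbolicMatrix t q}

/-- The parameter interval `[0, ℓ - 1]` (which is `[0, ∞)` if `ℓ = ⊤`). -/
def paramSet (ℓ : ℕ∞) : Set ℝ :=
  {s | 0 ≤ s ∧ ∃ j : ℕ, (j : ℕ∞) < ℓ ∧ s ≤ j}

/-- The arc traced out by `γ` over `[0, ℓ - 1]`. -/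
def arc (ℓ : ℕ∞) (γ : ℝ → Eucl (Fin 3)) : Set (Eucl (Fin 3)) :=
  γ '' paramSet ℓ

/-- A smooth regular curve in the plane `y = 0` that snakes upwards through the `ℓ` points
`(0, 0, j)`, `j < ℓ`, reached at the times `j`. Between the times `j` and `j + 1` it rises in `z` and
runs in the half-plane `x < 0` if `j` is even and in `x > 0` if `j` is odd. At the time `j` it is
tangent to infinite order to the line `z = j`, as is needed to continue the plane `z = j` smoothly. -/
structure IsSnake (ℓ : ℕ∞) (γ : ℝ → Eucl (Fin 3)) : Prop where
  smooth : ContDiff ℝ ∞ γ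
  regular : ∀ s ∈ paramSet ℓ, deriv γ s ≠ 0
  planar : ∀ s ∈ paramSet ℓ, γ s 1 = 0
  joint : ∀ j : ℕ, (j : ℕ∞) < ℓ → γ j 0 = 0 ∧ γ j 2 = j
  flat : ∀ j : ℕ, (j : ℕ∞) < ℓ → ∀ n : ℕ, 1 ≤ n → iteratedDeriv n (fun s => γ s 2) j = 0
  side : ∀ j : ℕ, ((j + 1 : ℕ) : ℕ∞) < ℓ → ∀ s ∈ Set.Ioo (j : ℝ) (j + 1),
    0 < (-1 : ℝ) ^ (j + 1) * γ s 0
  rising : ∀ j : ℕ, ((j + 1 : ℕ) : ℕ∞) < ℓ → ∀ s ∈ Set.Ioo (j : ℝ) (j + 1),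
    0 < deriv (fun s => γ s 2) s

/-- The quadrants that are removed from the `j`-th of `ℓ` planes: the one on the side of the arc
arriving from the plane below, and the one on the side of the arc leaving to the plane above. -/
def removedSides (ℓ : ℕ∞) (j : ℕ) : Set ℝ :=
  {σ | (1 ≤ j ∧ σ = (-1) ^ j) ∨ (((j + 1 : ℕ) : ℕ∞) < ℓ ∧ σ = (-1) ^ (j + 1))}

/-- The surface made of `ℓ` cut planes at the heights `0, 1, 2, …` and of the orbits through the
arc that joins their equilibria. -/
def stackedSurface (ℓ : ℕ∞) (γ : ℝ → Eucl (Fin 3)) : Set (Eucl (Fin 3)) :=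
  (⋃ j ∈ {j : ℕ | (j : ℕ∞) < ℓ}, cutPlane j (removedSides ℓ j)) ∪ orbitsThrough (arc ℓ γ)

/-! ### Adding the coordinates `w' = w` -/

/-- The map `(x, w) ↦ (f x, w)`. -/
def expandMap {ι κ : Type} (m : ℕ) (f : Eucl ι → Eucl κ) (p : Eucl (ι ⊕ Fin m)) :
    Eucl (κ ⊕ Fin m) :=
  WithLp.toLp 2 (Sum.elim (f (WithLp.toLp 2 fun i => p (Sum.inl i))) fun i => p (Sum.inr i))

/-- The flow `(x, w) ↦ (Φ^t x, e^t w)` of the system in which `w' = w` is added to `Φ`. -/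
noncomputable def expandFlow {ι : Type} [Fintype ι] (m : ℕ) (Φ : Flow ℝ (Eucl ι)) :
    Flow ℝ (Eucl (ι ⊕ Fin m)) where
  toFun t p := WithLp.toLp 2
    (Sum.elim (Φ t (WithLp.toLp 2 fun i => p (Sum.inl i))) fun i => Real.exp t * p (Sum.inr i))
  cont' := by
    have h : Continuous fun q : ℝ × Eucl (ι ⊕ Fin m) =>
        Φ q.1 (WithLp.toLp 2 fun i => q.2 (Sum.inl i)) :=
      Φ.continuous continuous_fst (by fun_prop)
    refine (PiLp.continuous_toLp 2 _).comp (continuous_pi ?_)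
    rintro (i | i)
    · exact (PiLp.continuous_apply 2 _ i).comp h
    · simp only [Sum.elim_inr]
      fun_prop
  map_add' s t p := by
    ext (i | i)
    · simp [Φ.map_add]
    · simp [Real.exp_add, mul_assoc]
  map_zero' p := by
    ext (i | i) <;> simp

/-! The linear flow preserves `z` and `x² - y²`, so the orbit of a point `(r, 0, z)` of the snake
with `r ≠ 0` is the branch of the hyperbola `x² - y² = r²` at height `z` on the side of `r`. Near
the `j`-th joint the snake is a graph `z = j + h x` over the `x`-axis. The surface is therefore the
graph of `j + h (±√(x² - y²))` over the sectors `|y| < ±x`, and of the constant `j` over the rest of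
the plane. The square root is singular on the lines `y = ±x`, but `h` vanishes to infinite order at
`0`, and this makes the lift smooth on the whole plane (`contDiff_sectorLift`). The first plane and,
for finite `ℓ`, the last one fit the same description once the snake is continued horizontally with
unbounded `x` (`IsLongProfile`): the continuation sweeps out the quadrants that are not removed.

To see the surface as one plane it is parametrized by its slices `y = const`, as `s ↦ (X s y, Z s
y)`. Between joints `s` is the parameter of the orbit: `X = ±√(x(s)² + y²)` and `Z = z(s)`. Near a
joint this is singular, and `X = x(s)` is used as a coordinate of the graph instead. Cutoffs blend
the two choices of `X` (`slicePos`) so that `X` stays strictly monotone in `s`; since `Z` is read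
off from the graph, blending does not change the surface. The resulting `sliceMap` is an immersion
because `X` or `Z` has nonzero `s`-derivative. It is injective because `X` is injective on each
joint zone and the height `z` is monotone and constant only beyond the ends. It is proper because
`x` grows linearly beyond the ends and, for `ℓ = ⊤`, the height tends to infinity. Hence it is a
smooth embedding, with image the stacked surface (`range_sliceMap`).

The surface is invariant, so the linear flow pulls back to the plane, smoothly by
`contDiff_of_comp_embedding`. The fixed points of the linear flow form the `z`-axis, which the
surface meets exactly in the joints; these give the `ℓ` equilibria (`IsSnake.exists_planar_flow`).

For `ℓ = 0` and `ℓ = 1` a translation and a dilation serve. Adding `w' = w` creates no equilibria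
off `w = 0`, which carries the planar examples to every dimension `k ≥ 2`. -/

/-! ### Functions that are flat at the origin -/

/-- A smooth function on `ℝ` all of whose derivatives vanish at `0`. -/
structure IsFlat (φ : ℝ → ℝ) : Prop where
  contDiff : ContDiff ℝ ∞ φ
  flat : ∀ n, iteratedDeriv n φ 0 = 0

theorem IsFlat.zero {φ : ℝ → ℝ} (h : IsFlat φ) : φ 0 = 0 := by
  simpa using h.flat 0

theorem IsFlat.hasDerivAt {φ : ℝ → ℝ} (h : IsFlat φ) (x : ℝ) : HasDerivAt φ (deriv φ x) x :=
  (h.contDiff.differentiable (by simp) x).hasDerivAt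

protected theorem IsFlat.deriv {φ : ℝ → ℝ} (h : IsFlat φ) : IsFlat (deriv φ) where
  contDiff := (contDiff_infty_iff_deriv.1 h.contDiff).2
  flat n := by rw [← iteratedDeriv_succ']; exact h.flat _

/-- The mean value inequality on `[-|x|, |x|]` turns a bound of order `N` for the derivative, which
is again flat, into one of order `N + 1` for `φ`. -/
theorem IsFlat.exists_bound {φ : ℝ → ℝ} (h : IsFlat φ) (N : ℕ) :
    ∃ C r : ℝ, 0 < r ∧ ∀ x, |x| ≤ r → |φ x| ≤ C * |x| ^ N := by
  induction N generalizing φ with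
  | zero =>
    obtain ⟨C, hC⟩ := (isCompact_Icc (a := (-1 : ℝ)) (b := 1)).exists_bound_of_continuousOn
      h.contDiff.continuous.continuousOn
    exact ⟨C, 1, one_pos, fun x hx => by simpa using hC x (abs_le.1 hx)⟩
  | succ N ih =>
    obtain ⟨C, r, hr, hC⟩ := ih h.deriv
    refine ⟨C, r, hr, fun x hx => ?_⟩
    have key := Convex.norm_image_sub_le_of_norm_deriv_le (𝕜 := ℝ) (f := φ) (C := C * |x| ^ N)
      (s := Set.Icc (-|x|) |x|) (x := 0) (y := x)
      (fun y _ => h.contDiff.differentiable (by simp) y) (fun y hy => ?_) (convex_Icc _ _)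
      ⟨by simp, by simp⟩ ⟨neg_abs_le x, le_abs_self x⟩
    · rw [h.zero] at key
      simpa [pow_succ, mul_assoc] using key
    · have hy' : |y| ≤ |x| := abs_le.2 hy
      have h1 := hC y (hy'.trans hx)
      have hC0 : 0 ≤ C := by
        have h2 := (abs_nonneg _).trans (hC r (by rw [abs_of_pos hr]))
        rw [abs_of_pos hr] at h2
        exact nonneg_of_mul_nonneg_left h2 (by positivity)
      refine h1.trans ?_
      gcongr

/-- The exponent `4` becomes `2` under `q = x²`, just enough for a vanishing derivative at `q = 0`.
-/
theorem IsFlat.exists_pow_mul_bound {φ : ℝ → ℝ} (h : IsFlat φ) (N : ℕ) :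
    ∃ C r : ℝ, 0 < r ∧ ∀ x, |x| ≤ r → |x|⁻¹ ^ N * |φ x| ≤ C * |x| ^ 4 := by
  obtain ⟨C, r, hr, hC⟩ := h.exists_bound (N + 4)
  refine ⟨C, r, hr, fun x hx => ?_⟩
  rcases eq_or_ne x 0 with rfl | hx0
  · simp [h.zero]
  · have hx1 : 0 < |x| := abs_pos.2 hx0
    calc |x|⁻¹ ^ N * |φ x| ≤ |x|⁻¹ ^ N * (C * |x| ^ (N + 4)) := by gcongr; exact hC x hx
      _ = C * |x| ^ 4 := by rw [pow_add, inv_pow]; field_simp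

/-! ### Smoothness by bootstrapping, and the square-root substitution. -/

theorem hasFDerivAt_zero_of_sq_bound {E : Type*} [NormedAddCommGroup E] [NormedSpace ℝ E]
    {f : E → ℝ} {x₀ : E} {C r : ℝ} (hr : 0 < r)
    (h : ∀ x, ‖x - x₀‖ ≤ r → |f x| ≤ C * ‖x - x₀‖ ^ 2) :
    HasFDerivAt f (0 : E →L[ℝ] ℝ) x₀ := by
  have hO : (fun x => f x) =O[𝓝 x₀] fun x => ‖x - x₀‖ ^ 2 := by
    refine Asymptotics.IsBigO.of_bound C ?_
    filter_upwards [Metric.closedBall_mem_nhds x₀ hr] with x hx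
    have := h x (by simpa [dist_eq_norm] using hx)
    simpa using this
  exact hO.hasFDerivAt one_lt_two

/-- A family of functions whose derivatives are as smooth as the family itself is smooth. -/
theorem contDiff_of_hasFDerivAt_family {E α : Type*} [NormedAddCommGroup E] [NormedSpace ℝ E]
    {F : α → E → ℝ} {D : α → E → E →L[ℝ] ℝ} (hd : ∀ a x, HasFDerivAt (F a) (D a x) x)
    (hC : ∀ n : ℕ, (∀ a, ContDiff ℝ n (F a)) → ∀ a, ContDiff ℝ n (D a)) (a : α) :
    ContDiff ℝ ∞ (F a) := by
  rw [contDiff_infty]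
  intro n
  -- The induction treats all members at once: the derivative of one member may involve others.
  induction n generalizing a with
  | zero => exact contDiff_zero.2 (continuous_iff_continuousAt.2 fun x => (hd a x).continuousAt)
  | succ n ih => exact contDiff_succ_iff_hasFDerivAt.2 ⟨D a, hC n ih a, hd a⟩

theorem contDiff_of_hasDerivAt_family {α : Type*} {F D : α → ℝ → ℝ}
    (hd : ∀ a x, HasDerivAt (F a) (D a x) x)
    (hC : ∀ n : ℕ, (∀ a, ContDiff ℝ n (F a)) → ∀ a, ContDiff ℝ n (D a)) (a : α) :
    ContDiff ℝ ∞ (F a) :=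
  contDiff_of_hasFDerivAt_family (D := fun a x => ContinuousLinearMap.toSpanSingleton ℝ (D a x))
    (fun a x => (hd a x).hasFDerivAt)
    (fun n h a => by
      have h1 := hC n h a
      exact (ContinuousLinearMap.toSpanSingletonCLE (𝕜 := ℝ) (E := ℝ)).contDiff.comp h1) a

/-- The square-root substitution `q ↦ √q⁻ᵐ φ(√q)`, extended by `0` to `q ≤ 0`. -/
noncomputable def sqrtSubst (m : ℕ) (φ : ℝ → ℝ) (q : ℝ) : ℝ :=
  if 0 < q then (√q)⁻¹ ^ m * φ (√q) else 0

/-- The derivative is a combination of functions of the same shape, with larger `m` and with `φ` or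
`φ'`. So the family over all `m` and all flat `φ` is closed under differentiation up to linear
combinations, which is what the bootstrap needs. -/
theorem hasDerivAt_sqrtSubst (m : ℕ) {φ : ℝ → ℝ} (h : IsFlat φ) (q : ℝ) :
    HasDerivAt (sqrtSubst m φ)
      (-(m / 2 : ℝ) * sqrtSubst (m + 2) φ q + 1 / 2 * sqrtSubst (m + 1) (deriv φ) q) q := by
  rcases lt_trichotomy q 0 with hq | rfl | hq
  · have h1 : sqrtSubst m φ =ᶠ[𝓝 q] fun _ => 0 := by
      filter_upwards [Iio_mem_nhds hq] with y hy
      rw [sqrtSubst, if_neg (not_lt.2 (le_of_lt hy))]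
    have h2 : ∀ k ψ, sqrtSubst k ψ q = 0 := fun k ψ => by
      rw [sqrtSubst, if_neg (not_lt.2 hq.le)]
    simpa [h2] using (hasDerivAt_const q (0 : ℝ)).congr_of_eventuallyEq h1
  · obtain ⟨C, r, hr, hC⟩ := h.exists_pow_mul_bound m
    -- The radius is `r ^ 2` because `√q ≤ r` is needed; the bound `C * √q ^ 4` then reads `C * q ^
    -- 2`.
    have := hasFDerivAt_zero_of_sq_bound (f := sqrtSubst m φ) (x₀ := 0) (C := C)
      (r := r ^ 2) (by positivity) (fun x hx => ?_)
    · simpa [sqrtSubst] using this.hasDerivAt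
    · rw [sub_zero] at hx ⊢
      rcases le_or_gt x 0 with hx0 | hx0
      · have hC0 : 0 ≤ C := by
          have h2 := (by positivity : (0:ℝ) ≤ |r|⁻¹ ^ m * |φ r|).trans
            (hC r (by rw [abs_of_pos hr]))
          exact nonneg_of_mul_nonneg_left h2 (by positivity)
        rw [sqrtSubst, if_neg (not_lt.2 hx0)]
        simp only [abs_zero]; positivity
      · rw [sqrtSubst, if_pos hx0, abs_mul]
        have h3 := hC (√x) (by
          rw [abs_of_nonneg (Real.sqrt_nonneg _), Real.sqrt_le_left hr.le]
          exact (le_abs_self x).trans hx)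
        rw [abs_of_nonneg (Real.sqrt_nonneg x)] at h3
        rw [abs_of_nonneg (by positivity)]
        refine h3.trans_eq ?_
        rw [show (4 : ℕ) = 2 * 2 from rfl, pow_mul, Real.sq_sqrt hx0.le, Real.norm_eq_abs, sq_abs]
  · have h1 : sqrtSubst m φ =ᶠ[𝓝 q] fun q => (√q)⁻¹ ^ m * φ (√q) := by
      filter_upwards [Ioi_mem_nhds hq] with y hy
      rw [sqrtSubst, if_pos (Set.mem_Ioi.1 hy)]
    refine HasDerivAt.congr_of_eventuallyEq ?_ h1
    have hs : √q ≠ 0 := (Real.sqrt_pos.2 hq).ne'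
    have hd := Real.hasDerivAt_sqrt hq.ne'
    have h2 := ((hd.inv hs).pow m).mul ((h.hasDerivAt (√q)).comp q hd)
    refine h2.congr_deriv ?_
    simp only [sqrtSubst, if_pos hq]
    rcases m with _ | m
    · simp
      ring
    · simp
      field_simp
      ring

theorem contDiff_sqrtSubst (m : ℕ) {φ : ℝ → ℝ} (h : IsFlat φ) :
    ContDiff ℝ ∞ (sqrtSubst m φ) := by
  refine contDiff_of_hasDerivAt_family (α := ℕ × {φ : ℝ → ℝ // IsFlat φ})
    (F := fun a => sqrtSubst a.1 a.2)
    (fun a x => hasDerivAt_sqrtSubst a.1 a.2.2 x) (fun n ih a => ?_) (m, ⟨φ, h⟩)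
  have h1 := ih (a.1 + 2, a.2)
  have h2 := ih (a.1 + 1, ⟨_, a.2.2.deriv⟩)
  exact (contDiff_const.mul h1).add (contDiff_const.mul h2)

/-- The function that is `φ` on `(0, ∞)` and `0` elsewhere. -/
noncomputable def truncLeft (φ : ℝ → ℝ) (s : ℝ) : ℝ := if 0 < s then φ s else 0

theorem hasDerivAt_truncLeft {φ : ℝ → ℝ} (h : IsFlat φ) (s : ℝ) :
    HasDerivAt (truncLeft φ) (truncLeft (deriv φ) s) s := by
  rcases lt_trichotomy s 0 with hs | rfl | hs
  · have h1 : truncLeft φ =ᶠ[𝓝 s] fun _ => 0 := by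
      filter_upwards [Iio_mem_nhds hs] with y hy
      rw [truncLeft, if_neg (not_lt.2 (le_of_lt hy))]
    rw [truncLeft, if_neg (not_lt.2 hs.le)]
    exact (hasDerivAt_const s (0 : ℝ)).congr_of_eventuallyEq h1
  · obtain ⟨C, r, hr, hC⟩ := h.exists_bound 2
    have := hasFDerivAt_zero_of_sq_bound (f := truncLeft φ) (x₀ := 0) (C := |C|) hr (fun x hx => ?_)
    · simpa [truncLeft] using this.hasDerivAt
    · rw [sub_zero] at hx ⊢
      rw [truncLeft]
      split_ifs
      · exact (hC x hx).trans (by gcongr; exacts [le_abs_self C, le_rfl])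
      · simp only [abs_zero]; positivity
  · have h1 : truncLeft φ =ᶠ[𝓝 s] φ := by
      filter_upwards [Ioi_mem_nhds hs] with y hy
      rw [truncLeft, if_pos (Set.mem_Ioi.1 hy)]
    rw [truncLeft, if_pos hs]
    exact (h.hasDerivAt s).congr_of_eventuallyEq h1

theorem contDiff_truncLeft {φ : ℝ → ℝ} (h : IsFlat φ) : ContDiff ℝ ∞ (truncLeft φ) :=
  contDiff_of_hasDerivAt_family (α := {φ : ℝ → ℝ // IsFlat φ}) (F := fun a => truncLeft a)
    (fun a x => hasDerivAt_truncLeft a.2 x) (fun _ ih a => ih ⟨_, a.2.deriv⟩) ⟨φ, h⟩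

theorem isFlat_truncLeft {φ : ℝ → ℝ} (h : IsFlat φ) : IsFlat (truncLeft φ) where
  contDiff := contDiff_truncLeft h
  flat n := by
    induction n generalizing φ with
    | zero => simp [truncLeft]
    | succ n ih =>
      rw [iteratedDeriv_succ', show deriv (truncLeft φ) = truncLeft (deriv φ) from
        funext fun s => (hasDerivAt_truncLeft h s).deriv]
      exact ih h.deriv

/-- The factor `m` makes the induction close: the derivative of `m · φ ∘ S` is a sum of two products
of the same form, with `φ` and with `φ'`. -/
theorem IsFlat.mul_comp {φ S m : ℝ → ℝ} (h : IsFlat φ) (hS : ContDiff ℝ ∞ S) (hS0 : S 0 = 0)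
    (hm : ContDiff ℝ ∞ m) : IsFlat fun x => m x * φ (S x) where
  contDiff := hm.mul (h.contDiff.comp hS)
  flat n := by
    induction n generalizing φ m with
    | zero => simp [hS0, h.zero]
    | succ n ih =>
      have hSd : ContDiff ℝ ∞ (deriv S) := (contDiff_infty_iff_deriv.1 hS).2
      have hmd : ContDiff ℝ ∞ (deriv m) := (contDiff_infty_iff_deriv.1 hm).2
      have h1 : deriv (fun x => m x * φ (S x)) =
          (fun x => deriv m x * φ (S x)) + fun x => (m x * deriv S x) * deriv φ (S x) := by
        ext x
        have h2 := (hm.differentiable (by simp) x).hasDerivAt.mul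
          ((h.hasDerivAt (S x)).comp x (hS.differentiable (by simp) x).hasDerivAt)
        refine h2.deriv.trans ?_
        simp only [Pi.add_apply, Function.comp_apply]
        ring
      have h3 : ContDiff ℝ ∞ fun x => deriv m x * φ (S x) := hmd.mul (h.contDiff.comp hS)
      have h4 : ContDiff ℝ ∞ fun x => (m x * deriv S x) * deriv φ (S x) :=
        (hm.mul hSd).mul (h.deriv.contDiff.comp hS)
      rw [iteratedDeriv_succ', h1, iteratedDeriv_add (h3.contDiffAt.of_le (by exact_mod_cast le_top))
        (h4.contDiffAt.of_le (by exact_mod_cast le_top)), ih h hmd, ih h.deriv (hm.mul hSd), add_zero]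

theorem IsFlat.comp {φ S : ℝ → ℝ} (h : IsFlat φ) (hS : ContDiff ℝ ∞ S) (hS0 : S 0 = 0) :
    IsFlat fun x => φ (S x) := by
  simpa using h.mul_comp hS hS0 (contDiff_const (c := (1 : ℝ)))

/-! ### Lifting functions of one variable to the plane along hyperbolas. -/

/-- `G (x² - y²)` for `x > 0`, and `0` for `x ≤ 0`. -/
noncomputable def coneLift (G : ℝ → ℝ) (p : ℝ × ℝ) : ℝ :=
  if 0 < p.1 then G (p.1 ^ 2 - p.2 ^ 2) else 0

/-- A smooth function on `ℝ` that vanishes on `(-∞, 0]`. -/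
structure IsSmoothPos (G : ℝ → ℝ) : Prop where
  contDiff : ContDiff ℝ ∞ G
  zero : ∀ q ≤ 0, G q = 0

protected theorem IsSmoothPos.deriv {G : ℝ → ℝ} (h : IsSmoothPos G) : IsSmoothPos (deriv G) where
  contDiff := (contDiff_infty_iff_deriv.1 h.contDiff).2
  zero q hq := by
    have h1 : ∀ q < 0, deriv G q = 0 := fun q hq => by
      have : G =ᶠ[𝓝 q] fun _ => 0 := by
        filter_upwards [Iio_mem_nhds hq] with y hy using h.zero y (le_of_lt hy)
      rw [this.deriv_eq]; simp
    have hc : Continuous (deriv G) := (contDiff_infty_iff_deriv.1 h.contDiff).2.continuous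
    have h2 : Set.Iic (0 : ℝ) ⊆ {q | deriv G q = 0} := by
      rw [← closure_Iio]
      exact closure_minimal h1 (isClosed_eq hc continuous_const)
    exact h2 hq

/-- The derivative is a cone lift of `G'` times a functional linear in `p`, so the bootstrap
applies. Only the line `x = 0` needs care: away from the origin `x² - y² < 0` nearby and the lift
vanishes, and at the origin `|G q| ≤ C |q|` gives a quadratic bound. -/
theorem hasFDerivAt_coneLift {G : ℝ → ℝ} (h : IsSmoothPos G) (p : ℝ × ℝ) :
    HasFDerivAt (coneLift G)
      (coneLift (deriv G) p • ((2 * p.1) • ContinuousLinearMap.fst ℝ ℝ ℝ -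
        (2 * p.2) • ContinuousLinearMap.snd ℝ ℝ ℝ)) p := by
  have hG : ∀ q, HasDerivAt G (deriv G q) q := fun q =>
    (h.contDiff.differentiable (by simp) q).hasDerivAt
  have hzero : (∀ᶠ q in 𝓝 p, coneLift G q = 0) → coneLift (deriv G) p = 0 →
      HasFDerivAt (coneLift G) (coneLift (deriv G) p • ((2 * p.1) • ContinuousLinearMap.fst ℝ ℝ ℝ -
        (2 * p.2) • ContinuousLinearMap.snd ℝ ℝ ℝ)) p := fun h1 h2 => by
    rw [h2, zero_smul]
    exact (hasFDerivAt_const (0 : ℝ) p).congr_of_eventuallyEq h1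
  rcases lt_trichotomy p.1 0 with hp | hp | hp
  · refine hzero ?_ (by rw [coneLift, if_neg (not_lt.2 hp.le)])
    filter_upwards [continuous_fst.continuousAt (Iio_mem_nhds hp)] with q hq
    rw [coneLift, if_neg (not_lt.2 (le_of_lt hq))]
  · have h0 : coneLift (deriv G) p = 0 := by rw [coneLift, if_neg (by simp [hp])]
    by_cases hp2 : p.2 = 0
    · obtain ⟨C, hC⟩ := (isCompact_Icc (a := (0 : ℝ)) (b := 1)).exists_bound_of_continuousOn
        h.deriv.contDiff.continuous.continuousOn
      have hGb : ∀ q ≤ 1, |G q| ≤ |C| * |q| := fun q hq => by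
        rcases le_or_gt q 0 with hq0 | hq0
        · rw [h.zero q hq0]; simp only [abs_zero]; positivity
        · have := Convex.norm_image_sub_le_of_norm_deriv_le (𝕜 := ℝ) (f := G) (C := |C|)
            (s := Set.Icc 0 1) (x := 0) (y := q)
            (fun y _ => h.contDiff.differentiable (by simp) y)
            (fun y hy => (hC y hy).trans (le_abs_self C)) (convex_Icc _ _)
            ⟨le_rfl, zero_le_one⟩ ⟨hq0.le, hq⟩
          simpa [h.zero 0 le_rfl] using this
      rw [h0, zero_smul]
      have hp' : p = 0 := Prod.ext hp hp2
      subst hp'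
      refine hasFDerivAt_zero_of_sq_bound (C := |C|) one_pos fun q hq => ?_
      rw [sub_zero] at hq ⊢
      have hq1 : |q.1| ≤ ‖q‖ := norm_fst_le q
      have hq1' : q.1 ^ 2 ≤ ‖q‖ ^ 2 := by rw [← sq_abs]; gcongr
      have hq2' : q.1 ^ 2 ≤ 1 := hq1'.trans (by nlinarith [norm_nonneg q])
      rw [coneLift]
      split_ifs with hq0
      · rcases le_or_gt (q.1 ^ 2 - q.2 ^ 2) 0 with hle | hgt
        · rw [h.zero _ hle]; simp only [abs_zero]; positivity
        · refine (hGb _ (by nlinarith [sq_nonneg q.2])).trans ?_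
          rw [abs_of_pos hgt]
          gcongr
          nlinarith [sq_nonneg q.2]
      · simp only [abs_zero]; positivity
    · refine hzero ?_ h0
      have h1 : p ∈ {q : ℝ × ℝ | q.1 ^ 2 - q.2 ^ 2 < 0} := by
        have : 0 < p.2 ^ 2 := by positivity
        simp only [Set.mem_ofPred_eq, hp]; linarith
      filter_upwards [(isOpen_lt (by fun_prop) continuous_const).mem_nhds h1] with q hq
      rw [coneLift]
      split_ifs
      · exact h.zero _ (le_of_lt hq)
      · rfl
  · have h1 : coneLift G =ᶠ[𝓝 p] fun q => G (q.1 ^ 2 - q.2 ^ 2) := by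
      filter_upwards [continuous_fst.continuousAt (Ioi_mem_nhds hp)] with q hq
      rw [coneLift, if_pos (Set.mem_Ioi.1 hq)]
    refine HasFDerivAt.congr_of_eventuallyEq ?_ h1
    rw [coneLift, if_pos hp]
    have hf : HasFDerivAt (fun q : ℝ × ℝ => q.1 ^ 2 - q.2 ^ 2)
        ((2 * p.1) • ContinuousLinearMap.fst ℝ ℝ ℝ -
        (2 * p.2) • ContinuousLinearMap.snd ℝ ℝ ℝ) p := by
      have := (hasFDerivAt_fst (𝕜 := ℝ) (p := p)).pow 2 |>.sub ((hasFDerivAt_snd (𝕜 := ℝ) (p := p)).pow 2)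
      refine this.congr_fderiv ?_
      simp
    exact (hG _).comp_hasFDerivAt p hf

theorem contDiff_coneLift {G : ℝ → ℝ} (h : IsSmoothPos G) : ContDiff ℝ ∞ (coneLift G) := by
  refine contDiff_of_hasFDerivAt_family (α := {G : ℝ → ℝ // IsSmoothPos G})
    (F := fun a => coneLift a) (fun a p => hasFDerivAt_coneLift a.2 p) (fun n ih a => ?_) ⟨G, h⟩
  have h1 := ih ⟨_, a.2.deriv⟩
  exact h1.smul (by fun_prop)

/-- `φ (± √(x² - y²))` on the sectors `|y| < ± x`, and `0` elsewhere. -/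
noncomputable def sectorLift (φ : ℝ → ℝ) (p : ℝ × ℝ) : ℝ :=
  coneLift (sqrtSubst 0 φ) p + coneLift (sqrtSubst 0 fun x => φ (-x)) (-p.1, p.2)

theorem contDiff_sectorLift {φ : ℝ → ℝ} (h : IsFlat φ) : ContDiff ℝ ∞ (sectorLift φ) := by
  have key : ∀ {ψ : ℝ → ℝ}, IsFlat ψ → ContDiff ℝ ∞ (coneLift (sqrtSubst 0 ψ)) := fun hψ =>
    contDiff_coneLift ⟨contDiff_sqrtSubst 0 hψ, fun q hq => by
      rw [sqrtSubst, if_neg (not_lt.2 hq)]⟩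
  have h2 := key (h.comp contDiff_neg neg_zero)
  exact (key h).add (h2.comp (by fun_prop : ContDiff ℝ ∞ fun p : ℝ × ℝ => (-p.1, p.2)))

theorem sectorLift_of_abs_le (φ : ℝ → ℝ) {x y : ℝ} (h : |x| ≤ |y|) : sectorLift φ (x, y) = 0 := by
  have : ¬ 0 < x ^ 2 - y ^ 2 := by linarith [sq_le_sq.2 h]
  simp [sectorLift, coneLift, sqrtSubst, this]

/-- The lift is constant along the branch through `(r, 0)`; `0 ≤ x * r` selects the branch. For `r =
0` the point lies on the boundary lines, where the lift is `0 = φ 0`. -/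
theorem sectorLift_of_sq {φ : ℝ → ℝ} (h0 : φ 0 = 0) {x y r : ℝ} (h : x ^ 2 = y ^ 2 + r ^ 2)
    (hr : 0 ≤ x * r) : sectorLift φ (x, y) = φ r := by
  rcases eq_or_ne r 0 with rfl | hr0
  · rw [sectorLift_of_abs_le _ (sq_le_sq.1 (by linarith)), h0]
  have hx : x ≠ 0 := by
    rintro rfl
    have : 0 < r ^ 2 := by positivity
    nlinarith [sq_nonneg y]
  have hq : x ^ 2 - y ^ 2 = r ^ 2 := by linarith
  have hr2 : 0 < r ^ 2 := by positivity
  rcases lt_or_gt_of_ne hx with hx | hx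
  · have hr' : r < 0 := lt_of_le_of_ne (by nlinarith) hr0
    have : ¬ 0 < x := by linarith
    simp [sectorLift, coneLift, sqrtSubst, this, hx, hq, hr2, Real.sqrt_sq_eq_abs, abs_of_neg hr']
  · have hr' : 0 < r := lt_of_le_of_ne (by nlinarith) hr0.symm
    have : ¬ x < 0 := by linarith
    simp [sectorLift, coneLift, sqrtSubst, this, hx, hq, hr2, Real.sqrt_sq_eq_abs, abs_of_pos hr']

/-! ### Linear flows -/

section LinearFlow

attribute [local instance] Matrix.linftyOpNormedRing Matrix.linftyOpNormedAlgebra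

/-- The exponential commutes with continuous ring homomorphisms, and the block-diagonal inclusion is
one. -/
theorem Matrix.exp_fromBlocks_diagonal {κ μ : Type} [Fintype κ] [DecidableEq κ] [Fintype μ]
    [DecidableEq μ] (A : Matrix κ κ ℝ) (B : Matrix μ μ ℝ) :
    NormedSpace.exp (Matrix.fromBlocks A 0 0 B) =
      Matrix.fromBlocks (NormedSpace.exp A) 0 0 (NormedSpace.exp B) := by
  let F : Matrix κ κ ℝ × Matrix μ μ ℝ →+* Matrix (κ ⊕ μ) (κ ⊕ μ) ℝ :=
    { toFun := fun p => Matrix.fromBlocks p.1 0 0 p.2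
      map_one' := Matrix.fromBlocks_one
      map_mul' := fun p q => by simp [Matrix.fromBlocks_multiply]
      map_zero' := Matrix.fromBlocks_zero
      map_add' := fun p q => by simp [Matrix.fromBlocks_add] }
  have hF : Continuous F := by
    refine Continuous.matrix_fromBlocks continuous_fst continuous_const continuous_const
      continuous_snd
  have := NormedSpace.map_exp F hF (A, B)
  rw [show F (A, B) = Matrix.fromBlocks A 0 0 B from rfl] at this
  refine this.symm.trans ?_
  change Matrix.fromBlocks _ _ _ _ = _
  congr 1
  · exact Prod.fst_exp (A, B)
  · exact Prod.snd_exp (A, B)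

theorem Matrix.exp_reindex {κ μ : Type} [Fintype κ] [DecidableEq κ] [Fintype μ]
    [DecidableEq μ] (e : κ ≃ μ) (A : Matrix κ κ ℝ) :
    NormedSpace.exp (Matrix.reindex e e A) = Matrix.reindex e e (NormedSpace.exp A) :=
  (NormedSpace.map_exp (Matrix.reindexAlgEquiv ℝ ℝ e)
    (by exact Continuous.matrix_reindex continuous_id e e) A).symm

end LinearFlow

theorem linearFlow_hyperbolicMatrix (t : ℝ) (v : Eucl (Fin 3)) :
    linearFlow hyperbolicMatrix t v =
      !₂[Real.cosh t * v 0 + Real.sinh t * v 1, Real.sinh t * v 0 + Real.cosh t * v 1, v 2] := by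
  -- The columns of `P` are eigenvectors for the eigenvalues `1`, `-1`, `0`, and `Q` is the inverse
  -- of `P`.
  let P : Matrix (Fin 3) (Fin 3) ℝ := !![1, 1, 0; 1, -1, 0; 0, 0, 1]
  let Q : Matrix (Fin 3) (Fin 3) ℝ := !![1 / 2, 1 / 2, 0; 1 / 2, -1 / 2, 0; 0, 0, 1]
  let U : (Matrix (Fin 3) (Fin 3) ℝ)ˣ :=
    ⟨P, Q, by ext i j; fin_cases i <;> fin_cases j <;> simp [P, Q, Matrix.mul_apply, Fin.sum_univ_three] <;> norm_num,
      by ext i j; fin_cases i <;> fin_cases j <;> simp [P, Q, Matrix.mul_apply, Fin.sum_univ_three] <;> norm_num⟩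
  have hA : t • hyperbolicMatrix = U * Matrix.diagonal ![t, -t, 0] * (U⁻¹ : (Matrix (Fin 3) (Fin 3) ℝ)ˣ) := by
    change _ = P * _ * Q
    ext i j
    fin_cases i <;> fin_cases j <;>
      simp [P, Q, hyperbolicMatrix, Matrix.mul_apply, Matrix.vecMul_diagonal, Fin.sum_univ_three] <;> ring
  have hE : NormedSpace.exp (t • hyperbolicMatrix) =
      P * Matrix.diagonal ![Real.exp t, Real.exp (-t), 1] * Q := by
    rw [hA, Matrix.exp_units_conj, Matrix.exp_diagonal]
    change P * _ * Q = _
    congr 3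
    ext i
    rw [Pi.coe_exp]
    fin_cases i <;> simp [← Real.exp_eq_exp_ℝ]
  rw [linearFlow, hE]
  ext i
  fin_cases i <;>
    simp [P, Q, Matrix.mulVec, dotProduct, Matrix.mul_apply, Matrix.vecMul_diagonal,
      Fin.sum_univ_three, Real.cosh_eq,
      Real.sinh_eq] <;> ring

theorem linearFlow_add {κ : Type} [Fintype κ] [DecidableEq κ] (A : Matrix κ κ ℝ) (s t : ℝ)
    (v : Eucl κ) : linearFlow A (s + t) v = linearFlow A s (linearFlow A t v) := by
  simp only [linearFlow]
  rw [add_smul, Matrix.exp_add_of_commute _ _ ((Commute.refl A).smul_left s |>.smul_right t),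
    Matrix.mulVec_mulVec]

theorem linearFlow_zero {κ : Type} [Fintype κ] [DecidableEq κ] (A : Matrix κ κ ℝ)
    (v : Eucl κ) : linearFlow A 0 v = v := by
  simp [linearFlow]

theorem contDiff_linearFlow_hyperbolicMatrix :
    ContDiff ℝ ∞ fun p : ℝ × Eucl (Fin 3) => linearFlow hyperbolicMatrix p.1 p.2 := by
  simp only [linearFlow_hyperbolicMatrix]
  have hc : ContDiff ℝ ∞ fun p : ℝ × Eucl (Fin 3) => Real.cosh p.1 :=
    Real.contDiff_cosh.comp contDiff_fst
  have hs : ContDiff ℝ ∞ fun p : ℝ × Eucl (Fin 3) => Real.sinh p.1 :=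
    Real.contDiff_sinh.comp contDiff_fst
  have hv : ∀ i, ContDiff ℝ ∞ fun p : ℝ × Eucl (Fin 3) => p.2 i := fun i =>
    contDiff_euclidean.1 contDiff_snd i
  rw [contDiff_euclidean]
  intro i
  fin_cases i
  · simpa using (hc.mul (hv 0)).add (hs.mul (hv 1))
  · simpa using (hs.mul (hv 0)).add (hc.mul (hv 1))
  · simpa using hv 2

/-! ### Invariance of the surfaces -/

/-- The flow multiplies `x + y` by `e^t` and `x - y` by `e^(-t)`, and the quadrant is given by the
signs of these two quantities. -/
theorem linearFlow_mem_quadrant {σ : ℝ} (hσ : σ = 1 ∨ σ = -1) (t : ℝ) {p : Eucl (Fin 3)}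
    (hp : p ∈ quadrant σ) : linearFlow hyperbolicMatrix t p ∈ quadrant σ := by
  rw [linearFlow_hyperbolicMatrix]
  simp only [quadrant, Set.mem_ofPred_eq, abs_lt, Real.cosh_eq, Real.sinh_eq] at hp ⊢
  have h1 := Real.exp_pos t
  have h2 := Real.exp_pos (-t)
  obtain ⟨ha, hb⟩ := hp
  rcases hσ with rfl | rfl
  · have h3 := mul_pos h1 (show 0 < p 0 + p 1 by linarith)
    have h4 := mul_pos h2 (show 0 < p 0 - p 1 by linarith)
    constructor <;> simp <;> nlinarith
  · have h3 := mul_pos h1 (show 0 < -(p 0 + p 1) by linarith)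
    have h4 := mul_pos h2 (show 0 < -(p 0 - p 1) by linarith)
    constructor <;> simp <;> nlinarith

theorem eq_or_of_mem_removedSides {ℓ : ℕ∞} {j : ℕ} {σ : ℝ} (h : σ ∈ removedSides ℓ j) :
    σ = 1 ∨ σ = -1 := by
  rcases h with ⟨_, rfl⟩ | ⟨_, rfl⟩ <;> exact neg_one_pow_eq_or ℝ _

theorem linearFlow_mem_cutPlane {h : ℝ} {S : Set ℝ} (hS : ∀ σ ∈ S, σ = 1 ∨ σ = -1) (t : ℝ)
    {p : Eucl (Fin 3)} (hp : p ∈ cutPlane h S) :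
    linearFlow hyperbolicMatrix t p ∈ cutPlane h S := by
  refine ⟨?_, fun hq => hp.2 ?_⟩
  · have := hp.1
    rw [linearFlow_hyperbolicMatrix]
    simpa using this
  · simp only [Set.mem_iUnion] at hq ⊢
    obtain ⟨σ, hσ, hq⟩ := hq
    refine ⟨σ, hσ, ?_⟩
    -- Invariance of the quadrants under time `-t` gives invariance of their complement under time
    -- `t`.
    have := linearFlow_mem_quadrant (hS σ hσ) (-t) hq
    rwa [← linearFlow_add, neg_add_cancel, linearFlow_zero] at this

theorem linearFlow_mem_stackedSurface (ℓ : ℕ∞) (γ : ℝ → Eucl (Fin 3)) (t : ℝ)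
    {p : Eucl (Fin 3)} (hp : p ∈ stackedSurface ℓ γ) :
    linearFlow hyperbolicMatrix t p ∈ stackedSurface ℓ γ := by
  rcases hp with hp | ⟨q, hq, s, rfl⟩
  · left
    simp only [Set.mem_iUnion] at hp ⊢
    obtain ⟨j, hj, hp⟩ := hp
    exact ⟨j, hj, linearFlow_mem_cutPlane (fun σ => eq_or_of_mem_removedSides) t hp⟩
  · right
    exact ⟨q, hq, t + s, (linearFlow_add _ _ _ _).symm⟩

theorem linearFlow_image_stackedSurface (ℓ : ℕ∞) (γ : ℝ → Eucl (Fin 3)) (t : ℝ) :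
    linearFlow hyperbolicMatrix t '' stackedSurface ℓ γ = stackedSurface ℓ γ := by
  refine Set.Subset.antisymm ?_ fun p hp => ?_
  · rintro _ ⟨p, hp, rfl⟩
    exact linearFlow_mem_stackedSurface ℓ γ t hp
  · refine ⟨_, linearFlow_mem_stackedSurface ℓ γ (-t) hp, ?_⟩
    rw [← linearFlow_add, add_neg_cancel, linearFlow_zero]

theorem stackedSurface_two (γ : ℝ → Eucl (Fin 3)) :
    stackedSurface 2 γ =
      cutPlane 1 {-1} ∪ orbitsThrough (γ '' Set.Icc 0 1) ∪ cutPlane 0 {-1} := by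
  have h0 : removedSides 2 0 = {-1} := by
    ext σ
    have : ((0 + 1 : ℕ) : ℕ∞) < 2 := by norm_num
    simp [removedSides]
  have h1 : removedSides 2 1 = {-1} := by
    ext σ
    have : ¬ (((1 + 1 : ℕ) : ℕ∞) < 2) := by norm_num
    simp [removedSides]
  have h2 : ∀ j : ℕ, (j : ℕ∞) < 2 ↔ j = 0 ∨ j = 1 := fun j => by
    rw [show (2 : ℕ∞) = ((2 : ℕ) : ℕ∞) from rfl, Nat.cast_lt]; omega
  have h3 : arc 2 γ = γ '' Set.Icc 0 1 := by
    rw [arc]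
    congr 1
    ext s
    simp only [paramSet, Set.mem_ofPred_eq, h2, Set.mem_Icc]
    refine and_congr_right fun hs => ⟨?_, fun h => ⟨1, Or.inr rfl, by simpa using h⟩⟩
    rintro ⟨j, rfl | rfl, h⟩
    · simp at h; linarith
    · simpa using h
  rw [stackedSurface, h3]
  ext p
  simp only [h2, Set.mem_union, Set.mem_iUnion, Set.mem_ofPred_eq, exists_prop]
  constructor
  · rintro (⟨j, rfl | rfl, h⟩ | h)
    · right; simpa [h0] using h
    · left; left; simpa [h1] using h
    · left; right; exact h
  · rintro ((h | h) | h)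
    · exact Or.inl ⟨1, Or.inr rfl, by simpa [h1] using h⟩
    · exact Or.inr h
    · exact Or.inl ⟨0, Or.inl rfl, by simpa [h0] using h⟩

/-! ### Adding expanding coordinates -/

/-- The splitting of the coordinates of `Eucl (ι ⊕ μ)`. -/
noncomputable def euclSum (ι μ : Type) [Fintype ι] [Fintype μ] :
    Eucl (ι ⊕ μ) ≃L[ℝ] Eucl ι × Eucl μ :=
  LinearEquiv.toContinuousLinearEquiv
    { toFun := fun p => (WithLp.toLp 2 fun i => p (Sum.inl i), WithLp.toLp 2 fun i => p (Sum.inr i))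
      invFun := fun q => WithLp.toLp 2 (Sum.elim q.1 q.2)
      map_add' := fun p q => rfl
      map_smul' := fun c p => rfl
      left_inv := fun p => by ext (i | i) <;> rfl
      right_inv := fun q => rfl }

theorem euclSum_symm_inl {ι μ : Type} [Fintype ι] [Fintype μ] (q : Eucl ι × Eucl μ) (i : ι) :
    (euclSum ι μ).symm q (Sum.inl i) = q.1 i := rfl

theorem euclSum_symm_inr {ι μ : Type} [Fintype ι] [Fintype μ] (q : Eucl ι × Eucl μ) (i : μ) :
    (euclSum ι μ).symm q (Sum.inr i) = q.2 i := rfl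

theorem expandMap_eq {ι κ : Type} [Fintype ι] [Fintype κ] (m : ℕ) (f : Eucl ι → Eucl κ) :
    expandMap m f = (euclSum κ (Fin m)).symm ∘ Prod.map f id ∘ euclSum ι (Fin m) := rfl

theorem isSmoothFlow_expandFlow {ι : Type} [Fintype ι] (m : ℕ) {Φ : Flow ℝ (Eucl ι)}
    (h : IsSmoothFlow Φ) : IsSmoothFlow (expandFlow m Φ) := by
  have h1 : ContDiff ℝ ∞ fun q : ℝ × Eucl (ι ⊕ Fin m) =>
      (euclSum ι (Fin m)).symm (Φ q.1 (euclSum ι (Fin m) q.2).1,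
        Real.exp q.1 • (euclSum ι (Fin m) q.2).2) := by
    refine (euclSum ι (Fin m)).symm.contDiff.comp (ContDiff.prodMk ?_ ?_)
    · exact h.comp (contDiff_fst.prodMk
        (contDiff_fst.comp ((euclSum ι (Fin m)).contDiff.comp contDiff_snd)))
    · exact (Real.contDiff_exp.comp contDiff_fst).smul
        (contDiff_snd.comp ((euclSum ι (Fin m)).contDiff.comp contDiff_snd))
  exact h1

theorem equilibria_expandFlow {ι : Type} [Fintype ι] (m : ℕ) (Φ : Flow ℝ (Eucl ι)) :
    equilibria (expandFlow m Φ) = (fun x => (euclSum ι (Fin m)).symm (x, 0)) '' equilibria Φ := by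
  have key : ∀ t p, euclSum ι (Fin m) (expandFlow m Φ t p) =
      (Φ t (euclSum ι (Fin m) p).1, Real.exp t • (euclSum ι (Fin m) p).2) := fun t p => rfl
  ext p
  constructor
  · intro hp
    have h1 : ∀ t, Φ t (euclSum ι (Fin m) p).1 = (euclSum ι (Fin m) p).1 := fun t => by
      have := key t p
      rw [hp t] at this
      exact (congrArg Prod.fst this).symm
    have h2 : (euclSum ι (Fin m) p).2 = 0 := by
      have h3 := congrArg Prod.snd (key 1 p)
      rw [hp 1] at h3
      have h4 : (Real.exp 1 - 1) • (euclSum ι (Fin m) p).2 = 0 := by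
        rw [sub_smul, one_smul]; exact sub_eq_zero.2 h3.symm
      refine (smul_eq_zero.1 h4).resolve_left ?_
      have := Real.add_one_lt_exp (one_ne_zero)
      linarith
    refine ⟨_, h1, ?_⟩
    rw [ContinuousLinearEquiv.symm_apply_eq]
    exact Prod.ext rfl h2.symm
  · rintro ⟨x, hx, rfl⟩ t
    apply (euclSum ι (Fin m)).injective
    rw [key, ContinuousLinearEquiv.apply_symm_apply]
    simp [hx t]

/-- Isolating neighbourhoods are pulled back along the continuous left inverse `r`; continuity of
`i` plays no role. -/
theorem hasIsolatedEquilibria_of_image {ι ι' : Type} [Fintype ι] [Fintype ι']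
    {Φ : Flow ℝ (Eucl ι)} {Ψ : Flow ℝ (Eucl ι')} {ℓ : ℕ∞} (h : HasIsolatedEquilibria Φ ℓ)
    {i : Eucl ι → Eucl ι'} {r : Eucl ι' → Eucl ι} (hr : Continuous r) (hri : ∀ x, r (i x) = x)
    (hi : equilibria Ψ = i '' equilibria Φ) : HasIsolatedEquilibria Ψ ℓ where
  countable := hi ▸ h.countable.image i
  encard_eq := by
    rw [hi, Function.Injective.encard_image (Function.LeftInverse.injective hri), h.encard_eq]
  isolated p hp := by
    rw [hi] at hp ⊢
    obtain ⟨x, hx, rfl⟩ := hp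
    obtain ⟨U, hU, hUx⟩ := h.isolated x hx
    refine ⟨r ⁻¹' U, hr.continuousAt (by rwa [hri]), ?_⟩
    have hxU : x ∈ U := mem_of_mem_nhds hU
    ext q
    constructor
    · rintro ⟨hq, y, hy, rfl⟩
      have : y ∈ U ∩ equilibria Φ := ⟨by simpa [hri] using hq, hy⟩
      rw [hUx] at this
      rw [Set.mem_singleton_iff.1 this]; rfl
    · rintro rfl
      exact ⟨by simpa [hri] using hxU, x, hx, rfl⟩

theorem linearFlow_fromBlocks {κ : Type} [Fintype κ] [DecidableEq κ] (m : ℕ) (A : Matrix κ κ ℝ)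
    (t : ℝ) (v : Eucl κ) (w : Eucl (Fin m)) :
    linearFlow (Matrix.fromBlocks A 0 0 1) t ((euclSum κ (Fin m)).symm (v, w)) =
      (euclSum κ (Fin m)).symm (linearFlow A t v, Real.exp t • w) := by
  have h1 : NormedSpace.exp (t • (1 : Matrix (Fin m) (Fin m) ℝ)) =
      Matrix.diagonal fun _ => Real.exp t := by
    rw [show t • (1 : Matrix (Fin m) (Fin m) ℝ) = Matrix.diagonal fun _ => t by
      rw [Matrix.smul_one_eq_diagonal], Matrix.exp_diagonal]
    congr 1
    ext i
    rw [Pi.coe_exp, Real.exp_eq_exp_ℝ]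
  rw [linearFlow, Matrix.fromBlocks_smul, smul_zero, smul_zero, Matrix.exp_fromBlocks_diagonal, h1]
  change WithLp.toLp 2 (Matrix.mulVec _ (Sum.elim v.ofLp w.ofLp)) = _
  rw [Matrix.fromBlocks_mulVec]
  ext (i | i)
  · rw [euclSum_symm_inl]
    simp [linearFlow]
  · rw [euclSum_symm_inr]
    simp

theorem isLinearizingEmbedding_expandMap {ι κ : Type} [Fintype ι] [Fintype κ] [DecidableEq κ]
    (m : ℕ) {Φ : Flow ℝ (Eucl ι)} {A : Matrix κ κ ℝ} {f : Eucl ι → Eucl κ}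
    (h : IsLinearizingEmbedding Φ A f) :
    IsLinearizingEmbedding (expandFlow m Φ) (Matrix.fromBlocks A 0 0 1) (expandMap m f) where
  smooth := by
    rw [expandMap_eq]
    exact (euclSum κ (Fin m)).symm.contDiff.comp
      ((h.smooth.prodMap contDiff_id).comp (euclSum ι (Fin m)).contDiff)
  isEmbedding := by
    rw [expandMap_eq]
    exact (euclSum κ (Fin m)).symm.toHomeomorph.isEmbedding.comp
      ((h.isEmbedding.prodMap .id).comp (euclSum ι (Fin m)).toHomeomorph.isEmbedding)
  immersion p := by
    have h1 : HasFDerivAt (expandMap m f)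
        (((euclSum κ (Fin m)).symm : _ →L[ℝ] _) ∘L
          ((fderiv ℝ f (euclSum ι (Fin m) p).1).prodMap (.id ℝ _)) ∘L
            (euclSum ι (Fin m) : Eucl (ι ⊕ Fin m) →L[ℝ] Eucl ι × Eucl (Fin m))) p := by
      rw [expandMap_eq]
      have h2 : HasFDerivAt f _ (euclSum ι (Fin m) p).1 :=
        (h.smooth.differentiable (by simp) _).hasFDerivAt
      exact (euclSum κ (Fin m)).symm.hasFDerivAt.comp p
        ((h2.prodMap _ (hasFDerivAt_id _)).comp p (euclSum ι (Fin m)).hasFDerivAt)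
    rw [h1.fderiv]
    intro v w hvw
    simp only [ContinuousLinearMap.coe_comp, Function.comp_apply] at hvw
    have h3 := (euclSum κ (Fin m)).symm.injective hvw
    have h4 : (fderiv ℝ f (euclSum ι (Fin m) p).1) (euclSum ι (Fin m) v).1 =
      (fderiv ℝ f (euclSum ι (Fin m) p).1) (euclSum ι (Fin m) w).1 := congrArg Prod.fst h3
    have h5 : (euclSum ι (Fin m) v).2 = (euclSum ι (Fin m) w).2 := by
      have := congrArg Prod.snd h3
      simpa using this
    exact (euclSum ι (Fin m)).injective (Prod.ext (h.immersion _ h4) h5)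
  equivariant t p := by
    have h1 : expandMap m f p = (euclSum κ (Fin m)).symm
      (f (euclSum ι (Fin m) p).1, (euclSum ι (Fin m) p).2) := rfl
    rw [h1, linearFlow_fromBlocks, h.equivariant]
    rfl

/-! ### Renaming coordinates -/

/-- Renaming the coordinates. -/
noncomputable def euclReindex {ι ι' : Type} [Fintype ι] [Fintype ι'] (e : ι ≃ ι') :
    Eucl ι ≃L[ℝ] Eucl ι' :=
  (LinearIsometryEquiv.piLpCongrLeft 2 ℝ ℝ e).toContinuousLinearEquiv

theorem linearFlow_reindex {κ κ' : Type} [Fintype κ] [DecidableEq κ] [Fintype κ'] [DecidableEq κ']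
    (e : κ ≃ κ') (A : Matrix κ κ ℝ) (t : ℝ) (v : Eucl κ) :
    linearFlow (Matrix.reindex e e A) t (euclReindex e v) = euclReindex e (linearFlow A t v) := by
  have h1 : t • Matrix.reindex e e A = Matrix.reindex e e (t • A) := by
    ext i j; simp
  rw [linearFlow, h1, Matrix.exp_reindex]
  ext i
  change (Matrix.mulVec ((NormedSpace.exp (t • A)).submatrix e.symm e.symm)
    (v.ofLp ∘ e.symm)) i = (Matrix.mulVec _ v.ofLp) (e.symm i)
  rw [Matrix.submatrix_mulVec_equiv]
  simp [Function.comp_assoc]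

theorem exists_flow_reindex {ι ι' : Type} [Fintype ι] [Fintype ι'] (e : ι ≃ ι')
    {κ : Type} [Fintype κ] [DecidableEq κ] {Φ : Flow ℝ (Eucl ι)} {ℓ : ℕ∞} {A : Matrix κ κ ℝ}
    {f : Eucl ι → Eucl κ} (hΦ : IsSmoothFlow Φ) (hℓ : HasIsolatedEquilibria Φ ℓ)
    (hf : IsLinearizingEmbedding Φ A f) :
    ∃ Ψ : Flow ℝ (Eucl ι'),
      IsSmoothFlow Ψ ∧ HasIsolatedEquilibria Ψ ℓ ∧ AdmitsLinearizingEmbedding Ψ := by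
  let L := euclReindex e
  let K := euclReindex (Fintype.equivFin κ)
  let Ψ : Flow ℝ (Eucl ι') :=
    { toFun := fun t x => L (Φ t (L.symm x))
      cont' := L.continuous.comp (Φ.continuous continuous_fst (L.symm.continuous.comp continuous_snd))
      map_add' := fun s t x => by simp [Φ.map_add]
      map_zero' := fun x => by simp }
  have hΨ : ∀ t x, Ψ t x = L (Φ t (L.symm x)) := fun _ _ => rfl
  refine ⟨Ψ, ?_, ?_, Fintype.card κ, Matrix.reindex (Fintype.equivFin κ) (Fintype.equivFin κ) A,
    K ∘ f ∘ L.symm, ?_, ?_, ?_, ?_⟩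
  · exact L.contDiff.comp (hΦ.comp (contDiff_fst.prodMk (L.symm.contDiff.comp contDiff_snd)))
  · refine hasIsolatedEquilibria_of_image hℓ L.symm.continuous L.symm_apply_apply ?_
    ext x
    constructor
    · intro hx
      refine ⟨L.symm x, fun t => ?_, L.apply_symm_apply x⟩
      rw [ContinuousLinearEquiv.eq_symm_apply]
      exact hx t
    · rintro ⟨y, hy, rfl⟩ t
      rw [hΨ, L.symm_apply_apply, hy t]
  · exact K.contDiff.comp (hf.smooth.comp L.symm.contDiff)
  · exact K.toHomeomorph.isEmbedding.comp (hf.isEmbedding.comp L.symm.toHomeomorph.isEmbedding)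
  · intro x
    have h2 : HasFDerivAt f _ (L.symm x) := (hf.smooth.differentiable (by simp) _).hasFDerivAt
    have h1 := K.hasFDerivAt.comp x (h2.comp x L.symm.hasFDerivAt)
    rw [h1.fderiv]
    exact K.injective.comp ((hf.immersion _).comp L.symm.injective)
  · intro t x
    change linearFlow _ t (K (f (L.symm x))) = K (f (L.symm (L (Φ t (L.symm x)))))
    rw [linearFlow_reindex, L.symm_apply_apply, hf.equivariant]

/-! ### Planar systems with at most one equilibrium -/

theorem linearFlow_diagonal {κ : Type} [Fintype κ] [DecidableEq κ] (d : κ → ℝ) (t : ℝ)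
    (v : Eucl κ) : linearFlow (Matrix.diagonal d) t v =
      WithLp.toLp 2 fun i => Real.exp (t * d i) * v i := by
  have h : t • Matrix.diagonal d = Matrix.diagonal (t • d) := (Matrix.diagonal_smul t d).symm
  rw [linearFlow, h, Matrix.exp_diagonal]
  ext i
  simp [Matrix.mulVec_diagonal, Pi.coe_exp, ← Real.exp_eq_exp_ℝ]

theorem fderiv_apply_coord {E κ : Type*} [NormedAddCommGroup E] [NormedSpace ℝ E] [Fintype κ]
    {f : E → EuclideanSpace ℝ κ} {x : E} (h : DifferentiableAt ℝ f x) (v : E) (i : κ) :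
    (fderiv ℝ f x v) i = fderiv ℝ (fun p => f p i) x v := by
  have := ((EuclideanSpace.proj i : EuclideanSpace ℝ κ →L[ℝ] ℝ).hasFDerivAt (x := f x)).comp x
    h.hasFDerivAt
  exact (congrArg (fun L : E →L[ℝ] ℝ => L v) this.fderiv).symm

/-- The exponential turns a translation into linear growth: the image is the half-plane `x > 0`,
which avoids the fixed line `x = 0` of the linear flow. -/
theorem exists_planar_flow_zero : ∃ (Φ : Flow ℝ (Eucl (Fin 2))) (A : Matrix (Fin 2) (Fin 2) ℝ)
    (f : Eucl (Fin 2) → Eucl (Fin 2)), IsSmoothFlow Φ ∧ HasIsolatedEquilibria Φ 0 ∧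
      IsLinearizingEmbedding Φ A f := by
  let e : Eucl (Fin 2) := EuclideanSpace.single 0 1
  let Φ : Flow ℝ (Eucl (Fin 2)) :=
    { toFun := fun t x => x + t • e
      cont' := by fun_prop
      map_add' := fun s t x => by rw [add_smul, add_comm (s • e), add_assoc]
      map_zero' := fun x => by simp }
  have hΦ : ∀ t x, Φ t x = x + t • e := fun _ _ => rfl
  have he : equilibria Φ = ∅ := by
    rw [Set.eq_empty_iff_forall_notMem]
    intro x hx
    have := congrArg (fun v : Eucl (Fin 2) => v 0) (hx 1)
    simp [hΦ, e] at this
  let f : Eucl (Fin 2) → Eucl (Fin 2) := fun x => !₂[Real.exp (x 0), x 1]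
  refine ⟨Φ, Matrix.diagonal ![1, 0], f, ?_, ⟨by simp [he], by simp [he], by simp [he]⟩, ?_⟩
  · change ContDiff ℝ ∞ fun p : ℝ × Eucl (Fin 2) => p.2 + p.1 • e
    fun_prop
  have hv : ∀ i, ContDiff ℝ ∞ fun p : Eucl (Fin 2) => p i := fun i =>
    contDiff_euclidean.1 contDiff_id i
  have hs : ContDiff ℝ ∞ f := by
    rw [contDiff_euclidean]
    intro i
    fin_cases i
    · exact Real.contDiff_exp.comp (hv 0)
    · exact hv 1
  refine ⟨hs, ?_, fun x => ?_, fun t x => ?_⟩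
  · have h1 : ∀ i : Fin 2, Topology.IsEmbedding ((![Real.exp, id] : Fin 2 → ℝ → ℝ) i) := by
      rw [Fin.forall_fin_two]
      constructor
      · refine StrictMono.isEmbedding_of_ordConnected Real.exp_strictMono ?_
        change (Set.range Real.exp).OrdConnected
        rw [Real.range_exp]; exact Set.ordConnected_Ioi
      · exact .id
    have h2 := (PiLp.homeomorph 2 fun _ : Fin 2 => ℝ).symm.isEmbedding.comp
      ((Topology.IsEmbedding.piMap h1).comp (PiLp.homeomorph 2 fun _ : Fin 2 => ℝ).isEmbedding)
    convert h2 using 1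
    ext x i
    fin_cases i <;> rfl
  · have hp : ∀ i : Fin 2, HasFDerivAt (fun p : Eucl (Fin 2) => p i)
        (EuclideanSpace.proj i : Eucl (Fin 2) →L[ℝ] ℝ) x := fun i =>
      (EuclideanSpace.proj i : Eucl (Fin 2) →L[ℝ] ℝ).hasFDerivAt
    refine (injective_iff_map_eq_zero _).2 fun v hv0 => ?_
    have h0 := fderiv_apply_coord (hs.differentiable (by simp) x) v 0
    have h1 := fderiv_apply_coord (hs.differentiable (by simp) x) v 1
    rw [hv0] at h0 h1
    rw [show (fun p => f p 0) = fun p => Real.exp (p 0) from rfl, (hp 0).exp.fderiv] at h0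
    rw [show (fun p => f p 1) = fun p => p 1 from rfl, (hp 1).fderiv] at h1
    ext i
    fin_cases i
    · simpa using h0.symm
    · simpa using h1.symm
  · rw [linearFlow_diagonal]
    ext i
    fin_cases i <;> simp [f, hΦ, e, Real.exp_add, mul_comm]

theorem exists_planar_flow_one : ∃ (Φ : Flow ℝ (Eucl (Fin 2))) (A : Matrix (Fin 2) (Fin 2) ℝ)
    (f : Eucl (Fin 2) → Eucl (Fin 2)), IsSmoothFlow Φ ∧ HasIsolatedEquilibria Φ 1 ∧
      IsLinearizingEmbedding Φ A f := by
  let Φ : Flow ℝ (Eucl (Fin 2)) :=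
    { toFun := fun t x => Real.exp t • x
      cont' := by fun_prop
      map_add' := fun s t x => by rw [Real.exp_add, mul_smul]
      map_zero' := fun x => by simp }
  have hΦ : ∀ t x, Φ t x = Real.exp t • x := fun _ _ => rfl
  have he : equilibria Φ = {0} := by
    ext x
    constructor
    · intro hx
      have h3 := hx 1
      rw [hΦ] at h3
      have h4 : (Real.exp 1 - 1) • x = 0 := by
        rw [sub_smul, one_smul]; exact sub_eq_zero.2 h3
      refine (smul_eq_zero.1 h4).resolve_left ?_
      have := Real.add_one_lt_exp (one_ne_zero)
      linarith
    · rintro rfl t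
      simp [hΦ]
  refine ⟨Φ, Matrix.diagonal fun _ => 1, id, ?_, ⟨by simp [he], by simp [he], ?_⟩,
    contDiff_id, .id, ?_, ?_⟩
  · change ContDiff ℝ ∞ fun p : ℝ × Eucl (Fin 2) => Real.exp p.1 • p.2
    fun_prop
  · rw [he]
    rintro x rfl
    exact ⟨Set.univ, Filter.univ_mem, by simp⟩
  · intro x
    rw [fderiv_id]
    exact Function.injective_id
  · intro t x
    rw [linearFlow_diagonal]
    ext i
    simp [hΦ]

/-! ### Monotone extensions of germs -/

theorem ContDiff.hasDerivAt_deriv {f : ℝ → ℝ} (hf : ContDiff ℝ ∞ f) (s : ℝ) :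
    HasDerivAt f (deriv f s) s :=
  (hf.differentiable (by simp) s).hasDerivAt

theorem ContDiff.contDiff_deriv {f : ℝ → ℝ} (hf : ContDiff ℝ ∞ f) : ContDiff ℝ ∞ (deriv f) :=
  (contDiff_infty_iff_deriv.1 hf).2

/-- Near `c` the derivative exceeds half of its value at `c`. Blending it with that constant by a
bump function and integrating from `c` keeps the lower bound everywhere. -/
theorem exists_strictMono_extension_of_deriv_pos {x : ℝ → ℝ} (hx : ContDiff ℝ ∞ x) {c : ℝ}
    (hc : 0 < deriv x c) : ∃ (δ κ : ℝ) (ξ : ℝ → ℝ), 0 < δ ∧ 0 < κ ∧ ContDiff ℝ ∞ ξ ∧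
      (∀ s, κ ≤ deriv ξ s) ∧ ∀ s, |s - c| ≤ δ → ξ s = x s := by
  have hx' := hx.contDiff_deriv
  obtain ⟨r, hr, hball⟩ := Metric.eventually_nhds_iff.1
    (hx'.continuous.continuousAt.eventually (lt_mem_nhds (half_lt_self hc)))
  let χ : ContDiffBump c := ⟨r / 3, r / 2, by positivity, by linarith⟩
  let g : ℝ → ℝ := fun s => χ s * deriv x s + (1 - χ s) * (deriv x c / 2)
  have hg : ContDiff ℝ ∞ g :=
    (χ.contDiff.mul hx').add ((contDiff_const.sub χ.contDiff).mul contDiff_const)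
  have hgκ : ∀ s, deriv x c / 2 ≤ g s := fun s => by
    by_cases hs : dist s c < r
    · have h1 := hball hs
      have h2 : 0 ≤ χ s := χ.nonneg
      simp only [g]; nlinarith
    · have h2 : χ s = 0 := χ.zero_of_le_dist (by simp only [χ]; linarith)
      simp [g, h2]
  let ξ : ℝ → ℝ := fun s => x c + ∫ u in c..s, g u
  have hξ : ∀ s, HasDerivAt ξ (g s) s := fun s => by
    exact (hg.continuous.integral_hasStrictDerivAt c s).hasDerivAt.const_add (x c)
  have hξ' : deriv ξ = g := funext fun s => (hξ s).deriv
  refine ⟨r / 3, deriv x c / 2, ξ, by positivity, by positivity, ?_, fun s => ?_, fun s hs => ?_⟩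
  · rw [contDiff_infty_iff_deriv, hξ']
    exact ⟨fun s => (hξ s).differentiableAt, hg⟩
  · rw [hξ']; exact hgκ s
  · have h1 : ∫ u in c..s, g u = ∫ u in c..s, deriv x u := by
      refine intervalIntegral.integral_congr fun u hu => ?_
      have h2 : |u - c| ≤ r / 3 := (Set.abs_sub_left_of_mem_uIcc hu).trans hs
      have h3 : χ u = 1 := χ.one_of_mem_closedBall (by simpa [χ, Real.dist_eq] using h2)
      simp [g, h3]
    have h2 : ∫ u in c..s, deriv x u = x s - x c :=
      intervalIntegral.integral_deriv_eq_sub (fun u _ => hx.differentiable (by simp) u)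
        (hx'.continuous.intervalIntegrable _ _)
    simp only [ξ]; rw [h1, h2]; ring

theorem exists_strictMono_extension {x : ℝ → ℝ} (hx : ContDiff ℝ ∞ x) {c e : ℝ}
    (he : e * e = 1) (hc : 0 < e * deriv x c) :
    ∃ (δ κ : ℝ) (ξ : ℝ → ℝ), 0 < δ ∧ 0 < κ ∧ ContDiff ℝ ∞ ξ ∧
      (∀ s, κ ≤ e * deriv ξ s) ∧ ∀ s, |s - c| ≤ δ → ξ s = x s := by
  obtain ⟨δ, κ, ξ, hδ, hκ, hξ, hd, hxξ⟩ := exists_strictMono_extension_of_deriv_pos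
    (x := fun s => e * x s) (contDiff_const.mul hx) (c := c) (by simpa using hc)
  refine ⟨δ, κ, fun s => e * ξ s, hδ, hκ, contDiff_const.mul hξ, fun s => ?_, fun s hs => ?_⟩
  · rw [deriv_const_mul_field, ← mul_assoc, he, one_mul]; exact hd s
  · simp only [hxξ s hs]; rw [← mul_assoc, he, one_mul]

/-- The slope bound makes `e * ξ` grow at least linearly in both directions, hence a homeomorphism
of the line; the nonvanishing derivative makes the inverse smooth. -/
theorem exists_smooth_inverse {ξ : ℝ → ℝ} (hξ : ContDiff ℝ ∞ ξ) {κ e : ℝ} (he : e * e = 1)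
    (hκ : 0 < κ) (hd : ∀ s, κ ≤ e * deriv ξ s) :
    ∃ η : ℝ → ℝ, ContDiff ℝ ∞ η ∧ (∀ s, η (ξ s) = s) ∧ ∀ u, ξ (η u) = u := by
  have hζ : ContDiff ℝ ∞ fun s => e * ξ s := contDiff_const.mul hξ
  have hζd : ∀ s, HasDerivAt (fun s => e * ξ s) (e * deriv ξ s) s := fun s =>
    (hξ.hasDerivAt_deriv s).const_mul e
  have hmono : StrictMono fun s => e * ξ s := strictMono_of_deriv_pos fun s => by
    rw [(hζd s).deriv]; exact hκ.trans_le (hd s)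
  have hgrow : Monotone fun s => e * ξ s - κ * s := by
    have h : ∀ s, HasDerivAt (fun s => e * ξ s - κ * s) (e * deriv ξ s - κ * 1) s := fun s =>
      (hζd s).sub ((hasDerivAt_id s).const_mul κ)
    refine monotone_of_deriv_nonneg (fun s => (h s).differentiableAt) fun s => ?_
    rw [(h s).deriv]
    linarith [hd s]
  have hsurj : Function.Surjective fun s => e * ξ s := by
    refine hζ.continuous.surjective ?_ ?_
    · refine Filter.tendsto_atTop_mono' _ ?_
        (Filter.tendsto_atTop_add_const_right _ (e * ξ 0) (Filter.tendsto_id.const_mul_atTop hκ))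
      filter_upwards [Filter.eventually_ge_atTop 0] with s hs
      have := hgrow hs
      simp only [id] at this ⊢; linarith
    · refine Filter.tendsto_atBot_mono' _ ?_
        (Filter.tendsto_atBot_add_const_right _ (e * ξ 0) (Filter.tendsto_id.const_mul_atBot hκ))
      filter_upwards [Filter.eventually_le_atBot 0] with s hs
      have := hgrow hs
      simp only [id] at this ⊢; linarith
  let H : ℝ ≃ₜ ℝ := (hmono.orderIsoOfSurjective _ hsurj).toHomeomorph
  have hH : ∀ s, H s = e * ξ s := fun _ => rfl
  have hHs : ContDiff ℝ ∞ H.symm :=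
    H.contDiff_symm_deriv (f' := fun s => e * deriv ξ s) (fun s => (hκ.trans_le (hd s)).ne') hζd hζ
  refine ⟨fun u => H.symm (e * u), hHs.comp (contDiff_const.mul contDiff_id), fun s => ?_,
    fun u => ?_⟩
  · exact H.symm_apply_apply s
  · have := H.apply_symm_apply (e * u)
    rw [hH] at this
    have h2 := congrArg (e * ·) this
    simpa [← mul_assoc, he] using h2

/-- To the left of `c`, `x` is replaced by its monotone extension, which agrees with it near `c`,
and `z` by the constant `z c`. Flatness of `z` at `c` keeps the second replacement smooth. -/
theorem exists_left_extension {x z : ℝ → ℝ} (hx : ContDiff ℝ ∞ x) {c e : ℝ}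
    (hz : IsFlat fun s => z (c + s) - z c) (he : e * e = 1) (hc : 0 < e * deriv x c) :
    ∃ x' z' : ℝ → ℝ, ContDiff ℝ ∞ x' ∧ ContDiff ℝ ∞ z' ∧
      (∀ s, c ≤ s → x' s = x s ∧ z' s = z s) ∧
      (∃ κ, 0 < κ ∧ ∀ s ≤ c, κ ≤ e * deriv x' s) ∧ (∀ s ≤ c, z' s = z c) ∧
      IsFlat fun s => z' (c + s) - z c := by
  obtain ⟨δ, κ, ξ, hδ, hκ, hξ, hd, hxξ⟩ := exists_strictMono_extension hx he hc
  have hnear : ∀ s < c + δ, (fun s => if c ≤ s then x s else ξ s) =ᶠ[𝓝 s] ξ := fun s hs => by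
    filter_upwards [Iio_mem_nhds hs] with u hu
    split_ifs with h
    · exact (hxξ u (by rw [abs_of_nonneg (by linarith)]; linarith [Set.mem_Iio.1 hu])).symm
    · rfl
  have htr : ∀ s, (z c + truncLeft (fun s => z (c + s) - z c) s) - z c =
      truncLeft (fun s => z (c + s) - z c) s := fun s => by ring
  refine ⟨fun s => if c ≤ s then x s else ξ s,
    fun s => z c + truncLeft (fun s => z (c + s) - z c) (s - c), ?_, ?_, ?_, ⟨κ, hκ, ?_⟩, ?_, ?_⟩
  · refine contDiff_iff_contDiffAt.2 fun s => ?_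
    rcases lt_or_ge s (c + δ) with hs | hs
    · exact hξ.contDiffAt.congr_of_eventuallyEq (hnear s hs)
    · refine hx.contDiffAt.congr_of_eventuallyEq ?_
      filter_upwards [Ioi_mem_nhds (show c < s by linarith)] with u hu
      rw [if_pos (le_of_lt hu)]
  · exact contDiff_const.add ((contDiff_truncLeft hz).comp (contDiff_id.sub contDiff_const))
  · intro s hs
    refine ⟨if_pos hs, ?_⟩
    simp only [truncLeft]
    split_ifs with h
    · simp
    · rw [show s = c by linarith]; simp
  · intro s hs
    rw [(hnear s (by linarith)).deriv_eq]
    exact hd s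
  · intro s hs
    simp only [truncLeft]
    rw [if_neg (by linarith), add_zero]
  · simpa using isFlat_truncLeft hz

/-- The reflection `s ↦ -s` reduces this to the left extension; it reverses derivatives, so `e`
becomes `-e`. -/
theorem exists_right_extension {x z : ℝ → ℝ} (hx : ContDiff ℝ ∞ x) {c e : ℝ}
    (hz : IsFlat fun s => z (c + s) - z c) (he : e * e = 1) (hc : 0 < e * deriv x c) :
    ∃ x' z' : ℝ → ℝ, ContDiff ℝ ∞ x' ∧ ContDiff ℝ ∞ z' ∧
      (∀ s ≤ c, x' s = x s ∧ z' s = z s) ∧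
      (∃ κ, 0 < κ ∧ ∀ s, c ≤ s → κ ≤ e * deriv x' s) ∧ (∀ s, c ≤ s → z' s = z c) ∧
      IsFlat fun s => z' (c + s) - z c := by
  have hz1 : IsFlat fun s => z (-(-c + s)) - z (- -c) := by
    have := hz.comp contDiff_neg neg_zero
    simpa [neg_add, add_comm] using this
  obtain ⟨x', z', hx', hz', heq, ⟨κ, hκ, hκ'⟩, hzc, hfl⟩ :=
    exists_left_extension (x := fun s => x (-s)) (z := fun s => z (-s)) (c := -c) (e := -e)
      (hx.comp contDiff_neg) hz1 (by simpa using he) (by simpa [deriv_comp_neg] using hc)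
  refine ⟨fun s => x' (-s), fun s => z' (-s), hx'.comp contDiff_neg, hz'.comp contDiff_neg,
    fun s hs => ?_, ⟨κ, hκ, fun s hs => ?_⟩, fun s hs => ?_, ?_⟩
  · simpa using heq (-s) (by linarith)
  · have := hκ' (-s) (by linarith)
    rw [deriv_comp_neg]
    linarith
  · simpa using hzc (-s) (by linarith)
  · have := hfl.comp contDiff_neg neg_zero
    simpa [neg_add, add_comm] using this

/-! ### Existence of snakes -/

theorem IsSmoothPos.isFlat {G : ℝ → ℝ} (h : IsSmoothPos G) : IsFlat G where
  contDiff := h.contDiff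
  flat n := by
    induction n generalizing G with
    | zero => simpa using h.zero 0 le_rfl
    | succ n ih => rw [iteratedDeriv_succ']; exact ih h.deriv

theorem isFlat_smoothTransition : IsFlat Real.smoothTransition :=
  IsSmoothPos.isFlat ⟨Real.smoothTransition.contDiff,
    fun _ hq => Real.smoothTransition.zero_of_nonpos hq⟩

theorem Real.smoothTransition_one_sub (s : ℝ) :
    Real.smoothTransition (1 - s) = 1 - Real.smoothTransition s := by
  have h := (Real.smoothTransition.pos_denom s).ne'
  rw [Real.smoothTransition, Real.smoothTransition, sub_sub_cancel, eq_sub_iff_add_eq,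
    add_comm (expNegInvGlue (1 - s)), ← add_div, add_comm (expNegInvGlue (1 - s)), div_self h]

/-- On `(0, 1)` the transition equals `1 / (1 + exp (1 / s - 1 / (1 - s)))`, whose exponent is
strictly decreasing. -/
theorem Real.smoothTransition_deriv_pos {s : ℝ} (h0 : 0 < s) (h1 : s < 1) :
    0 < deriv Real.smoothTransition s := by
  have heq : Real.smoothTransition =ᶠ[𝓝 s] fun s => (1 + Real.exp (s⁻¹ - (1 - s)⁻¹))⁻¹ := by
    filter_upwards [Ioo_mem_nhds h0 h1] with u hu
    have hu1 : ¬ u ≤ 0 := not_le.2 hu.1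
    have hu2 : ¬ 1 - u ≤ 0 := by linarith [hu.2]
    have e1 := Real.exp_pos (-u⁻¹)
    rw [Real.smoothTransition, expNegInvGlue, expNegInvGlue, if_neg hu1, if_neg hu2,
      show u⁻¹ - (1 - u)⁻¹ = -(1 - u)⁻¹ - -u⁻¹ by ring, Real.exp_sub]
    field_simp
  have hs1 : (1 - s) ≠ 0 := by linarith
  have hd1 := (hasDerivAt_inv h0.ne').sub (((hasDerivAt_id s).const_sub 1).inv hs1)
  have hpos : 0 < 1 + Real.exp (s⁻¹ - (1 - s)⁻¹) := by positivity
  have hd := (hd1.exp.const_add 1).inv hpos.ne'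
  have hd' : HasDerivAt (fun s : ℝ => (1 + Real.exp (s⁻¹ - (1 - s)⁻¹))⁻¹) _ s := hd
  rw [heq.deriv_eq, hd'.deriv]
  refine div_pos ?_ (by positivity)
  rw [← mul_neg]
  refine mul_pos (Real.exp_pos _) ?_
  have h2 : 0 < (s ^ 2)⁻¹ := by positivity
  have h3 : 0 < 1 / (1 - s) ^ 2 := by have := sq_pos_of_pos (sub_pos.2 h1); positivity
  have h4 : -(-1 : ℝ) / (1 - id s) ^ 2 = 1 / (1 - s) ^ 2 := by simp
  rw [h4]; linarith

theorem IsFlat.add {φ ψ : ℝ → ℝ} (hφ : IsFlat φ) (hψ : IsFlat ψ) : IsFlat fun s => φ s + ψ s where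
  contDiff := hφ.contDiff.add hψ.contDiff
  flat n := by
    have := iteratedDeriv_add (n := n) (x := (0 : ℝ))
      (hφ.contDiff.contDiffAt.of_le (by exact_mod_cast le_top))
      (hψ.contDiff.contDiffAt.of_le (by exact_mod_cast le_top))
    rw [hφ.flat, hψ.flat, add_zero] at this
    exact this

/-- The transition from `-1` to `1`, flat at the origin. -/
noncomputable def oddTransition (u : ℝ) : ℝ :=
  Real.smoothTransition u + -1 * Real.smoothTransition (-u)

theorem isFlat_oddTransition : IsFlat oddTransition :=
  isFlat_smoothTransition.add
    (isFlat_smoothTransition.mul_comp contDiff_neg neg_zero contDiff_const)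

/-- A smooth monotone staircase that is flat at the integers. -/
noncomputable def staircase (s : ℝ) : ℝ := ⌊s⌋ + Real.smoothTransition (Int.fract s)

/-- The symmetry of the transition under `s ↦ 1 - s` rewrites the step that ends at `n` as a
reflected step starting there. Thus one smooth formula holds on both sides of `n`, although `⌊s⌋`
jumps. -/
theorem staircase_eq {n : ℤ} {s : ℝ} (h : |s - n| < 1) :
    staircase s = n + oddTransition (s - n) := by
  rw [abs_lt] at h
  rcases le_or_gt (n : ℝ) s with hs | hs
  · have h1 : ⌊s⌋ = n := Int.floor_eq_iff.2 ⟨hs, by linarith⟩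
    rw [staircase, Int.fract, h1, oddTransition,
      Real.smoothTransition.zero_of_nonpos (x := -(s - n)) (by linarith)]
    ring
  · have h1 : ⌊s⌋ = n - 1 := Int.floor_eq_iff.2 ⟨by push_cast; linarith, by push_cast; linarith⟩
    rw [staircase, Int.fract, h1, oddTransition,
      Real.smoothTransition.zero_of_nonpos (x := s - n) (by linarith),
      show s - ((n - 1 : ℤ) : ℝ) = 1 - -(s - n) by push_cast; ring, Real.smoothTransition_one_sub]
    push_cast; ring

theorem staircase_eventuallyEq {n : ℤ} {s : ℝ} (h : |s - n| < 1) :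
    staircase =ᶠ[𝓝 s] fun s => n + oddTransition (s - n) := by
  filter_upwards [(isOpen_lt (by fun_prop) continuous_const :
    IsOpen {s : ℝ | |s - n| < 1}).mem_nhds h] with u hu using staircase_eq hu

theorem contDiff_staircase : ContDiff ℝ ∞ staircase := by
  refine contDiff_iff_contDiffAt.2 fun s => ?_
  have h : |s - ⌊s⌋| < 1 := by
    rw [abs_lt]; constructor <;> linarith [Int.floor_le s, Int.lt_floor_add_one s]
  exact (contDiff_const.add (isFlat_oddTransition.contDiff.comp
    (contDiff_id.sub contDiff_const))).contDiffAt.congr_of_eventuallyEq (staircase_eventuallyEq h)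

theorem iteratedDeriv_staircase (j : ℕ) {n : ℕ} (hn : 1 ≤ n) :
    iteratedDeriv n staircase j = 0 := by
  have h := staircase_eventuallyEq (n := (j : ℤ)) (s := j) (by simp)
  rw [h.iteratedDeriv_eq, iteratedDeriv_const_add (by omega)]
  have := congrFun (iteratedDeriv_comp_sub_const n oddTransition ((j : ℤ) : ℝ)) j
  rw [this]
  simpa using isFlat_oddTransition.flat n

theorem deriv_staircase_pos {j : ℕ} {s : ℝ} (hs : s ∈ Set.Ioo (j : ℝ) (j + 1)) :
    0 < deriv staircase s := by
  have h : staircase =ᶠ[𝓝 s] fun s => j + Real.smoothTransition (s - j) := by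
    filter_upwards [Ioo_mem_nhds hs.1 hs.2] with u hu
    rw [staircase_eq (n := (j : ℤ)) (by
      rw [abs_lt]; push_cast; constructor <;> linarith [hu.1, hu.2]), oddTransition,
      Real.smoothTransition.zero_of_nonpos (x := -(u - ((j : ℤ) : ℝ)))
        (by push_cast; linarith [hu.1])]
    push_cast; ring
  rw [h.deriv_eq, deriv_const_add, deriv_comp_sub_const]
  exact Real.smoothTransition_deriv_pos (by linarith [hs.1]) (by linarith [hs.2])

theorem exists_isSnake (ℓ : ℕ∞) : ∃ γ : ℝ → Eucl (Fin 3), IsSnake ℓ γ := by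
  -- The sine changes sign at each integer with nonzero slope, so it supplies the velocity exactly
  -- where the staircase is stationary.
  let γ : ℝ → Eucl (Fin 3) := fun s => !₂[-Real.sin (Real.pi * s), 0, staircase s]
  have h0 : ∀ s, γ s 0 = -Real.sin (Real.pi * s) := fun _ => rfl
  have h2 : ∀ s, γ s 2 = staircase s := fun _ => rfl
  have hs : ContDiff ℝ ∞ γ := by
    rw [contDiff_euclidean]
    intro i
    fin_cases i
    · exact (Real.contDiff_sin.comp (contDiff_const.mul contDiff_id)).neg
    · exact contDiff_const
    · exact contDiff_staircase
  have hdi : ∀ s i, (deriv γ s) i = deriv (fun s => γ s i) s := fun s i => by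
    rw [← fderiv_apply_one_eq_deriv, ← fderiv_apply_one_eq_deriv,
      fderiv_apply_coord (hs.differentiable (by simp) s)]
  have hd0 : ∀ s, HasDerivAt (fun s => γ s 0) (-(Real.cos (Real.pi * s) * (Real.pi * 1))) s :=
    fun s => (((hasDerivAt_id s).const_mul Real.pi).sin).neg
  have hsin : ∀ (j : ℕ) (s : ℝ),
      (-1 : ℝ) ^ (j + 1) * γ s 0 = Real.sin (Real.pi * (s - j)) := fun j s => by
    rw [h0, mul_sub, mul_comm Real.pi (j : ℝ), Real.sin_sub_nat_mul_pi, pow_succ]; ring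
  refine ⟨γ, hs, fun s hs0 hder => ?_, fun s _ => rfl, fun j _ => ⟨?_, ?_⟩,
    fun j _ n hn => iteratedDeriv_staircase j hn, fun j _ s hs => ?_,
    fun j _ s hs => deriv_staircase_pos hs⟩
  · have e0 := hdi s 0
    have e2 := hdi s 2
    rw [hder] at e0 e2
    obtain ⟨j, hj⟩ : ∃ j : ℕ, j = ⌊s⌋₊ := ⟨_, rfl⟩
    have hj1 : (j : ℝ) ≤ s := hj ▸ Nat.floor_le hs0.1
    have hj2 : s < j + 1 := hj ▸ Nat.lt_floor_add_one s
    rcases hj1.eq_or_lt with heq | hlt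
    · rw [(hd0 s).deriv, ← heq, mul_comm Real.pi (j : ℝ), Real.cos_nat_mul_pi] at e0
      have : (-1 : ℝ) ^ j ≠ 0 := by positivity
      simp [Real.pi_ne_zero] at e0
    · have := deriv_staircase_pos ⟨hlt, hj2⟩
      change 0 = deriv staircase s at e2
      linarith
  · rw [h0, mul_comm, Real.sin_nat_mul_pi, neg_zero]
  · rw [h2, staircase_eq (n := (j : ℤ)) (by simp)]
    simp [isFlat_oddTransition.zero]
  · rw [hsin]
    have := Real.pi_pos
    refine Real.sin_pos_of_pos_of_lt_pi (mul_pos this (by linarith [hs.1])) ?_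
    nlinarith [hs.2]

/-! ### Lifting smooth maps through smooth embeddings -/

/-- A linear left inverse `Q` of the derivative of `f` makes `Q ∘ f` a local diffeomorphism, so
locally `l` is its inverse applied to `Q ∘ f ∘ l`. The embedding hypothesis gives the continuity of
`l` that keeps it inside the chart. -/
theorem contDiff_of_comp_embedding {E G M : Type*} [NormedAddCommGroup E] [NormedSpace ℝ E]
    [FiniteDimensional ℝ E] [NormedAddCommGroup G] [NormedSpace ℝ G] [FiniteDimensional ℝ G]
    [NormedAddCommGroup M] [NormedSpace ℝ M] {f : E → G} (hf : ContDiff ℝ ∞ f)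
    (he : Topology.IsEmbedding f) (hi : ∀ x, Function.Injective (fderiv ℝ f x)) {l : M → E}
    (hl : ContDiff ℝ ∞ fun m => f (l m)) : ContDiff ℝ ∞ l := by
  have hlc : Continuous l := he.continuous_iff.2 hl.continuous
  have : CompleteSpace E := FiniteDimensional.complete ℝ E
  refine contDiff_iff_contDiffAt.2 fun m => ?_
  obtain ⟨P, hP⟩ := (fderiv ℝ f (l m) : E →ₗ[ℝ] G).exists_leftInverse_of_injective
    (LinearMap.ker_eq_bot.2 (hi (l m)))
  let Q : G →L[ℝ] E := LinearMap.toContinuousLinearMap P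
  have hφ : ContDiffAt ℝ ∞ (Q ∘ f) (l m) := (Q.contDiff.comp hf).contDiffAt
  have hφ' : HasFDerivAt (Q ∘ f) ((ContinuousLinearEquiv.refl ℝ E : E ≃L[ℝ] E) : E →L[ℝ] E)
      (l m) := by
    have h1 := (Q.hasFDerivAt (x := f (l m))).comp (l m)
      (hf.differentiable (by simp) (l m)).hasFDerivAt
    refine h1.congr_fderiv ?_
    ext v
    exact congrArg (fun L : E →ₗ[ℝ] E => L v) hP
  let H := hφ.toOpenPartialHomeomorph (Q ∘ f) hφ' (by simp)
  have hH : ContDiffAt ℝ ∞ (hφ.localInverse hφ' (by simp)) ((Q ∘ f) (l m)) :=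
    hφ.to_localInverse hφ' (by simp)
  have hmem : ∀ᶠ m' in 𝓝 m, l m' ∈ H.source :=
    hlc.continuousAt (H.open_source.mem_nhds (hφ.mem_toOpenPartialHomeomorph_source hφ' (by simp)))
  have hcomp : ContDiffAt ℝ ∞ (fun m' => hφ.localInverse hφ' (by simp) (Q (f (l m')))) m :=
    hH.comp m (Q.contDiff.comp hl).contDiffAt
  refine hcomp.congr_of_eventuallyEq ?_
  filter_upwards [hmem] with m' hm'
  exact (H.left_inv hm').symm

/-! ### Profiles of snakes -/

/-- The profile `(x, z)` of a snake. -/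
structure IsProfile (ℓ : ℕ∞) (x z : ℝ → ℝ) : Prop where
  contDiff_fst : ContDiff ℝ ∞ x
  contDiff_snd : ContDiff ℝ ∞ z
  joint : ∀ j : ℕ, (j : ℕ∞) < ℓ → x j = 0 ∧ z j = j
  flat : ∀ j : ℕ, (j : ℕ∞) < ℓ → IsFlat fun s => z (j + s) - z j
  slope : ∀ j : ℕ, (j : ℕ∞) < ℓ → 0 < (-1 : ℝ) ^ (j + 1) * deriv x j
  side : ∀ j : ℕ, ((j + 1 : ℕ) : ℕ∞) < ℓ → ∀ s ∈ Set.Ioo (j : ℝ) (j + 1),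
    0 < (-1 : ℝ) ^ (j + 1) * x s
  rising : ∀ j : ℕ, ((j + 1 : ℕ) : ℕ∞) < ℓ → ∀ s ∈ Set.Ioo (j : ℝ) (j + 1), 0 < deriv z s

/-- A profile that is continued horizontally beyond the end points. -/
structure IsLongProfile (ℓ : ℕ∞) (x z : ℝ → ℝ) : Prop extends IsProfile ℓ x z where
  left_slope : ∃ κ, 0 < κ ∧ ∀ s ≤ 0, κ ≤ (-1 : ℝ) ^ (0 + 1) * deriv x s
  left_height : ∀ s ≤ 0, z s = 0
  right_slope : ∀ j : ℕ, ((j + 1 : ℕ) : ℕ∞) = ℓ →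
    ∃ κ, 0 < κ ∧ ∀ s, (j : ℝ) ≤ s → κ ≤ (-1 : ℝ) ^ (j + 1) * deriv x s
  right_height : ∀ j : ℕ, ((j + 1 : ℕ) : ℕ∞) = ℓ → ∀ s, (j : ℝ) ≤ s → z s = j

theorem natCast_mem_paramSet {ℓ : ℕ∞} {j : ℕ} (hj : (j : ℕ∞) < ℓ) : (j : ℝ) ∈ paramSet ℓ :=
  ⟨j.cast_nonneg, j, hj, le_rfl⟩

theorem Icc_subset_paramSet {ℓ : ℕ∞} {j : ℕ} (hj : ((j + 1 : ℕ) : ℕ∞) < ℓ) :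
    Set.Icc (j : ℝ) (j + 1) ⊆ paramSet ℓ := fun s hs =>
  ⟨j.cast_nonneg.trans hs.1, j + 1, hj, by push_cast; exact hs.2⟩

theorem neg_one_pow_mul_self (n : ℕ) : (-1 : ℝ) ^ n * (-1 : ℝ) ^ n = 1 := by
  rw [← mul_pow]; simp

theorem ENat.succ_lt_or_eq {ℓ : ℕ∞} {j : ℕ} (h : (j : ℕ∞) < ℓ) :
    ((j + 1 : ℕ) : ℕ∞) < ℓ ∨ ((j + 1 : ℕ) : ℕ∞) = ℓ := by
  have : ((j + 1 : ℕ) : ℕ∞) ≤ ℓ := by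
    push_cast
    exact Order.add_one_le_of_lt h
  exact this.lt_or_eq

/-- At an end point of the interval `y` is controlled on one side only; this suffices because
derivatives within a nondegenerate interval are unique. -/
theorem deriv_eq_zero_of_eqOn_Icc {y : ℝ → ℝ} {a b c : ℝ} (hy : DifferentiableAt ℝ y c)
    (hab : a < b) (hc : c ∈ Set.Icc a b) (h : ∀ s ∈ Set.Icc a b, y s = 0) : deriv y c = 0 := by
  have h1 : HasDerivWithinAt y 0 (Set.Icc a b) c :=
    (hasDerivWithinAt_const c _ (0 : ℝ)).congr h (h c hc)
  exact (uniqueDiffOn_Icc hab c hc).eq_deriv _ hy.hasDerivAt.hasDerivWithinAt h1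

/-- The filter `L` is there to allow one-sided difference quotients. -/
theorem deriv_nonneg_of_eventually_slope {f : ℝ → ℝ} {f' c : ℝ} (hf : HasDerivAt f f' c)
    {L : Filter ℝ} [L.NeBot] (hL : L ≤ 𝓝[≠] c) (h : ∀ᶠ s in L, 0 ≤ slope f c s) : 0 ≤ f' :=
  ge_of_tendsto (hf.tendsto_slope.mono_left hL) h

/-- At a joint `z'` vanishes by flatness and `y'` because `y = 0` on an adjacent arc, so regularity
forces `x' ≠ 0`; its sign comes from the side of that arc. Since `2 ≤ ℓ`, every joint has an
adjacent arc: the following one or, at the last joint, the preceding one. -/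
theorem IsSnake.isProfile {ℓ : ℕ∞} (hℓ : 2 ≤ ℓ) {γ : ℝ → Eucl (Fin 3)} (h : IsSnake ℓ γ) :
    IsProfile ℓ (fun s => γ s 0) fun s => γ s 2 := by
  have hc : ∀ i, ContDiff ℝ ∞ fun s => γ s i := contDiff_euclidean.1 h.smooth
  have hdi : ∀ s i, (deriv γ s) i = deriv (fun s => γ s i) s := fun s i => by
    rw [← fderiv_apply_one_eq_deriv, ← fderiv_apply_one_eq_deriv,
      fderiv_apply_coord (h.smooth.differentiable (by simp) s)]
  have hprev : ∀ j : ℕ, ((j + 1 : ℕ) : ℕ∞) = ℓ →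
      ∃ i : ℕ, j = i + 1 ∧ ((i + 1 : ℕ) : ℕ∞) < ℓ := fun j hj => by
    rcases j with _ | i
    · rw [← hj] at hℓ; norm_num at hℓ
    · exact ⟨i, rfl, by rw [← hj]; exact_mod_cast Nat.lt_succ_self _⟩
  refine ⟨hc 0, hc 2, h.joint, fun j hj => ⟨?_, fun n => ?_⟩, fun j hj => ?_, h.side, h.rising⟩
  · exact ((hc 2).comp (contDiff_const.add contDiff_id)).sub contDiff_const
  · rcases n with _ | n
    · simp
    · have h1 := congrFun (iteratedDeriv_comp_const_add (n + 1) (fun s => γ s 2) (j : ℝ)) 0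
      simp only [add_zero] at h1
      rw [h.flat j hj (n + 1) (by omega)] at h1
      have h2 : iteratedDeriv (n + 1) (fun s => γ (j + s) 2 - γ j 2) 0 =
          iteratedDeriv (n + 1) (fun s => γ (j + s) 2) 0 := by
        simp_rw [sub_eq_add_neg, add_comm _ (-(γ j 2))]
        rw [iteratedDeriv_const_add (by omega)]
      rw [h2]; exact h1
  · have hz : deriv (fun s => γ s 2) j = 0 := by simpa using h.flat j hj 1 le_rfl
    have hyd := (hc 1).differentiable (by simp) j
    have hx0 := (h.joint j hj).1
    have hxd := (hc 0).hasDerivAt_deriv (j : ℝ)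
    have hed := hxd.const_mul ((-1 : ℝ) ^ (j + 1))
    have key : deriv (fun s => γ s 1) j = 0 ∧
        0 ≤ (-1 : ℝ) ^ (j + 1) * deriv (fun s => γ s 0) j := by
      rcases ENat.succ_lt_or_eq hj with hj1 | hj1
      · refine ⟨deriv_eq_zero_of_eqOn_Icc hyd (lt_add_one (j : ℝ)) ⟨le_rfl, by linarith⟩
          fun s hs => h.planar s (Icc_subset_paramSet hj1 hs), ?_⟩
        refine deriv_nonneg_of_eventually_slope hed (L := 𝓝[>] (j : ℝ))
          (nhdsWithin_mono _ fun s hs => ne_of_gt hs) ?_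
        filter_upwards [Ioo_mem_nhdsGT (lt_add_one (j : ℝ))] with s hs
        have := h.side j hj1 s hs
        rw [slope_def_field, hx0, mul_zero, sub_zero]
        exact div_nonneg this.le (by linarith [hs.1])
      · obtain ⟨i, rfl, hi⟩ := hprev j hj1
        have hsub : Set.Icc (i : ℝ) (i + 1) ⊆ paramSet ℓ := Icc_subset_paramSet hi
        refine ⟨deriv_eq_zero_of_eqOn_Icc hyd (lt_add_one (i : ℝ))
          ⟨by push_cast; linarith, by push_cast; exact le_rfl⟩
          fun s hs => h.planar s (hsub hs), ?_⟩
        refine deriv_nonneg_of_eventually_slope hed (L := 𝓝[<] ((i + 1 : ℕ) : ℝ))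
          (nhdsWithin_mono _ fun s hs => ne_of_lt hs) ?_
        filter_upwards [Ioo_mem_nhdsLT (show (i : ℝ) < ((i + 1 : ℕ) : ℝ) by
          push_cast; linarith)] with s hs
        have h2 : s ∈ Set.Ioo (i : ℝ) (i + 1) := ⟨hs.1, by have := hs.2; push_cast at this; exact this⟩
        have := h.side i hi s h2
        rw [slope_def_field, hx0, mul_zero, sub_zero]
        -- To the left of the joint `s - (i + 1) < 0`, and the sign of the arriving arc is opposite
        -- to that of the joint.
        refine div_nonneg_of_nonpos ?_ (by linarith [hs.2])
        rw [pow_succ]; linarith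
    refine lt_of_le_of_ne key.2 fun h0 => h.regular j (natCast_mem_paramSet hj) ?_
    have hx : deriv (fun s => γ s 0) j = 0 :=
      (mul_eq_zero.1 h0.symm).resolve_left (pow_ne_zero _ (by norm_num))
    ext i
    fin_cases i
    · exact (hdi j 0).trans hx
    · exact (hdi j 1).trans key.1
    · exact (hdi j 2).trans hz

theorem Filter.EventuallyEq.isFlat_sub {z z' : ℝ → ℝ}
    (hz' : ContDiff ℝ ∞ z') {c : ℝ} (h : z' =ᶠ[𝓝 c] z) (hf : IsFlat fun s => z (c + s) - z c) :
    IsFlat fun s => z' (c + s) - z' c where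
  contDiff := (hz'.comp (contDiff_const.add contDiff_id)).sub contDiff_const
  flat n := by
    have h1 : Filter.Tendsto (fun s : ℝ => c + s) (𝓝 0) (𝓝 c) := by
      have : Continuous fun s : ℝ => c + s := by fun_prop
      simpa using this.tendsto 0
    have h2 : (fun s => z' (c + s) - z' c) =ᶠ[𝓝 0] fun s => z (c + s) - z c := by
      filter_upwards [h1.eventually h] with s hs
      rw [hs, h.self_of_nhds]
    rw [h2.iteratedDeriv_eq]
    exact hf.flat n

/-- Modifications outside the parameter interval only matter for the derivatives at the joints,
which are either unchanged nearby or checked directly. -/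
theorem IsProfile.congr {ℓ : ℕ∞} {x z x' z' : ℝ → ℝ} (h : IsProfile ℓ x z)
    (hx : ContDiff ℝ ∞ x') (hz : ContDiff ℝ ∞ z') (heq : ∀ s ∈ paramSet ℓ, x' s = x s ∧ z' s = z s)
    (hj : ∀ j : ℕ, (j : ℕ∞) < ℓ → (x' =ᶠ[𝓝 (j : ℝ)] x ∧ z' =ᶠ[𝓝 (j : ℝ)] z) ∨
      (0 < (-1 : ℝ) ^ (j + 1) * deriv x' j ∧ IsFlat fun s => z' (j + s) - z' j)) :
    IsProfile ℓ x' z' where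
  contDiff_fst := hx
  contDiff_snd := hz
  joint j hjl := by
    obtain ⟨h1, h2⟩ := heq j (natCast_mem_paramSet hjl)
    rw [h1, h2]; exact h.joint j hjl
  flat j hjl := by
    rcases hj j hjl with ⟨-, h1⟩ | ⟨-, h1⟩
    · exact h1.isFlat_sub hz (h.flat j hjl)
    · exact h1
  slope j hjl := by
    rcases hj j hjl with ⟨h1, -⟩ | ⟨h1, -⟩
    · rw [h1.deriv_eq]; exact h.slope j hjl
    · exact h1
  side j hjl s hs := by
    rw [(heq s (Icc_subset_paramSet hjl (Set.Ioo_subset_Icc_self hs))).1]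
    exact h.side j hjl s hs
  rising j hjl s hs := by
    have : z' =ᶠ[𝓝 s] z := by
      filter_upwards [Ioo_mem_nhds hs.1 hs.2] with u hu
      exact (heq u (Icc_subset_paramSet hjl (Set.Ioo_subset_Icc_self hu))).2
    rw [this.deriv_eq]
    exact h.rising j hjl s hs

/-- A right continuation is needed only for finite `ℓ`. Since `2 ≤ ℓ`, the first and the last joint
differ, so the right continuation leaves the left one intact. -/
theorem IsProfile.exists_isLongProfile {ℓ : ℕ∞} (hℓ : 2 ≤ ℓ) {x z : ℝ → ℝ}
    (h : IsProfile ℓ x z) : ∃ x' z' : ℝ → ℝ, IsLongProfile ℓ x' z' ∧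
      ∀ s ∈ paramSet ℓ, x' s = x s ∧ z' s = z s := by
  have h0 : ((0 : ℕ) : ℕ∞) < ℓ := lt_of_lt_of_le (by norm_num) hℓ
  have hz0 := (h.joint 0 h0).2
  obtain ⟨x₁, z₁, hx₁, hz₁, heq₁, hsl, hht, hfl⟩ := exists_left_extension h.contDiff_fst
    (h.flat 0 h0) (neg_one_pow_mul_self (0 + 1)) (h.slope 0 h0)
  simp only [Nat.cast_zero] at hz0 heq₁ hsl hht hfl
  have hz10 : z₁ 0 = z 0 := (heq₁ 0 le_rfl).2
  have hp₁ : IsProfile ℓ x₁ z₁ := by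
    refine h.congr hx₁ hz₁ (fun s hs => heq₁ s hs.1) fun j _ => ?_
    rcases Nat.eq_zero_or_pos j with rfl | hj0
    · right
      obtain ⟨κ, hκ, hκ'⟩ := hsl
      refine ⟨hκ.trans_le (by simpa using hκ' 0 le_rfl), ?_⟩
      simpa [hz10] using hfl
    · left
      have hj' : (0 : ℝ) < j := by exact_mod_cast hj0
      constructor
      · filter_upwards [Ioi_mem_nhds hj'] with u hu using (heq₁ u (le_of_lt hu)).1
      · filter_upwards [Ioi_mem_nhds hj'] with u hu using (heq₁ u (le_of_lt hu)).2
  rcases eq_or_ne ℓ ⊤ with rfl | hne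
  · refine ⟨x₁, z₁, ⟨hp₁, hsl, fun s hs => (hht s hs).trans hz0, ?_, ?_⟩, fun s hs => heq₁ s hs.1⟩
    · intro j hj; exact absurd hj (ENat.natCast_ne_top _)
    · intro j hj; exact absurd hj (ENat.natCast_ne_top _)
  · obtain ⟨N, rfl⟩ := ENat.ne_top_iff_exists.1 hne
    have hN : 2 ≤ N := by exact_mod_cast hℓ
    obtain ⟨J, rfl⟩ : ∃ J, N = J + 1 := ⟨N - 1, by omega⟩
    have hJ0 : (0 : ℝ) < J := by exact_mod_cast (show 0 < J by omega)
    have hJ : (J : ℕ∞) < ((J + 1 : ℕ) : ℕ∞) := by exact_mod_cast Nat.lt_succ_self J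
    obtain ⟨x₂, z₂, hx₂, hz₂, heq₂, hsl₂, hht₂, hfl₂⟩ := exists_right_extension hp₁.contDiff_fst
      (hp₁.flat J hJ) (neg_one_pow_mul_self (J + 1)) (hp₁.slope J hJ)
    have hle : ∀ s ∈ paramSet ((J + 1 : ℕ) : ℕ∞), s ≤ J := by
      rintro s ⟨-, j, hj, hs⟩
      have : j ≤ J := Nat.lt_succ_iff.1 (by exact_mod_cast hj)
      exact hs.trans (by exact_mod_cast this)
    have hzJ := (hp₁.joint J hJ).2
    have huniq : ∀ j : ℕ, ((j + 1 : ℕ) : ℕ∞) = ((J + 1 : ℕ) : ℕ∞) → j = J := fun j hj => by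
      have : j + 1 = J + 1 := by exact_mod_cast hj
      omega
    have hev : ∀ s < (J : ℝ), x₂ =ᶠ[𝓝 s] x₁ ∧ z₂ =ᶠ[𝓝 s] z₁ := fun s hs => by
      constructor
      · filter_upwards [Iio_mem_nhds hs] with u hu using (heq₂ u (le_of_lt hu)).1
      · filter_upwards [Iio_mem_nhds hs] with u hu using (heq₂ u (le_of_lt hu)).2
    have hp₂ : IsProfile ((J + 1 : ℕ) : ℕ∞) x₂ z₂ := by
      refine hp₁.congr hx₂ hz₂ (fun s hs => heq₂ s (hle s hs)) fun j hj => ?_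
      have hjJ : j ≤ J := Nat.lt_succ_iff.1 (by exact_mod_cast hj)
      rcases hjJ.eq_or_lt with rfl | hlt
      · right
        obtain ⟨κ, hκ, hκ'⟩ := hsl₂
        refine ⟨hκ.trans_le (hκ' _ le_rfl), ?_⟩
        rw [(heq₂ _ le_rfl).2]; exact hfl₂
      · left
        exact hev j (by exact_mod_cast hlt)
    refine ⟨x₂, z₂, ⟨hp₂, ?_, fun s hs => ?_, fun j hj => ?_, fun j hj s hs => ?_⟩, fun s hs => ?_⟩
    · obtain ⟨κ, hκ, hκ'⟩ := hsl
      refine ⟨κ, hκ, fun s hs => ?_⟩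
      rw [(hev s (by linarith)).1.deriv_eq]; exact hκ' s hs
    · rw [(heq₂ s (by linarith)).2, hht s hs, hz0]
    · rw [huniq j hj]; exact hsl₂
    · rw [huniq j hj] at hs ⊢
      rw [hht₂ s hs, hzJ]
    · obtain ⟨a, b⟩ := heq₂ s (hle s hs)
      obtain ⟨a', b'⟩ := heq₁ s hs.1
      exact ⟨a.trans a', b.trans b'⟩

/-! ### The surface near a joint -/

/-- The position on the slice `y = const` of the point with parameter `s`: it moves from the vertical
line `x = x(s)` to the branches of the hyperbola `x² - y² = x(s)²`, according to the cutoffs `a` (to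
the right of the joint) and `b` (to the left of it). -/
noncomputable def slicePos (x a b : ℝ → ℝ) (e : ℝ) (s y : ℝ) : ℝ :=
  x s + a s * (e * √(x s ^ 2 + y ^ 2) - x s) + b s * (-(e * √(x s ^ 2 + y ^ 2)) - x s)

/-- A parameter interval `I` around a joint `c`. -/
structure IsJointZone (x z h a b : ℝ → ℝ) (c e : ℝ) (I : Set ℝ) : Prop where
  sign : e * e = 1
  ordConnected : I.OrdConnected
  mem : c ∈ I
  smooth : ContDiff ℝ ∞ x
  zero : x c = 0
  slope : ∀ s ∈ I, 0 < e * deriv x s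
  flat : IsFlat h
  -- The number `c` is both the parameter and the height of the joint.
  height : ∀ s ∈ I, h (x s) = z s - c
  smooth_right : ContDiff ℝ ∞ a
  smooth_left : ContDiff ℝ ∞ b
  monotone : Monotone a
  antitone : Antitone b
  right_mem : ∀ s, a s ∈ Set.Icc 0 1
  left_mem : ∀ s, b s ∈ Set.Icc 0 1
  cutoff : ∃ η, 0 < η ∧ (∀ s ≤ c + η, a s = 0) ∧ ∀ s, c - η ≤ s → b s = 0
  -- Either the hyperbolas take over inside the zone, at an arc, or `x` is unbounded on it, at an
  -- end plane.
  reach_right : (∃ s ∈ I, c ≤ s ∧ a s = 1) ∨ ∀ B, ∃ s ∈ I, c ≤ s ∧ B ≤ e * x s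
  reach_left : (∃ s ∈ I, s ≤ c ∧ b s = 1) ∨ ∀ B, ∃ s ∈ I, s ≤ c ∧ e * x s ≤ B

namespace IsJointZone

variable {x z h a b : ℝ → ℝ} {c e : ℝ} {I : Set ℝ}

theorem sign_sq (H : IsJointZone x z h a b c e I) (r : ℝ) : (e * r) ^ 2 = r ^ 2 := by
  rw [mul_pow, sq e, H.sign, one_mul]

theorem sign_mul_sign (H : IsJointZone x z h a b c e I) (r : ℝ) : e * (e * r) = r := by
  rw [← mul_assoc, H.sign, one_mul]

theorem convex (H : IsJointZone x z h a b c e I) : Convex ℝ I := H.ordConnected.convex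

theorem strictMonoOn (H : IsJointZone x z h a b c e I) : StrictMonoOn (fun s => e * x s) I := by
  refine strictMonoOn_of_deriv_pos H.convex (by have := H.smooth.continuous; fun_prop) fun s hs => ?_
  rw [((H.smooth.hasDerivAt_deriv s).const_mul e).deriv]
  exact H.slope s (interior_subset hs)

theorem pos_of_lt (H : IsJointZone x z h a b c e I) {s : ℝ} (hs : s ∈ I) (hc : c < s) :
    0 < e * x s := by
  have := H.strictMonoOn H.mem hs hc
  simpa [H.zero] using this

theorem neg_of_lt (H : IsJointZone x z h a b c e I) {s : ℝ} (hs : s ∈ I) (hc : s < c) :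
    e * x s < 0 := by
  have := H.strictMonoOn hs H.mem hc
  simpa [H.zero] using this

theorem height_joint (H : IsJointZone x z h a b c e I) : z c = c := by
  have := H.height c H.mem
  rw [H.zero, H.flat.zero] at this
  linarith

theorem slicePos_of_ge (H : IsJointZone x z h a b c e I) {s : ℝ} (hs : c ≤ s) (y : ℝ) :
    slicePos x a b e s y = x s + a s * (e * √(x s ^ 2 + y ^ 2) - x s) := by
  obtain ⟨η, hη, -, hb⟩ := H.cutoff
  rw [slicePos, hb s (by linarith), zero_mul, add_zero]

theorem slicePos_of_le (H : IsJointZone x z h a b c e I) {s : ℝ} (hs : s ≤ c) (y : ℝ) :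
    slicePos x a b e s y = x s + b s * (-(e * √(x s ^ 2 + y ^ 2)) - x s) := by
  obtain ⟨η, hη, ha, -⟩ := H.cutoff
  rw [slicePos, ha s (by linarith), zero_mul, add_zero]

theorem slicePos_joint (H : IsJointZone x z h a b c e I) (y : ℝ) : slicePos x a b e c y = 0 := by
  obtain ⟨η, hη, ha, -⟩ := H.cutoff
  rw [H.slicePos_of_ge le_rfl, ha c (by linarith), H.zero]; ring

theorem abs_le_sqrt (H : IsJointZone x z h a b c e I) (s y : ℝ) :
    |e * x s| ≤ √(x s ^ 2 + y ^ 2) := by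
  refine Real.le_sqrt_of_sq_le ?_
  rw [sq_abs, H.sign_sq]
  nlinarith [sq_nonneg y]

/-- To the right of the joint `e * slicePos` is a convex combination of `e * x s` and `√(x s ^ 2 + y
^ 2)`. -/
theorem bounds_of_ge (H : IsJointZone x z h a b c e I) {s : ℝ} (hs : s ∈ I) (hc : c ≤ s) (y : ℝ) :
    0 ≤ e * x s ∧ e * x s ≤ e * slicePos x a b e s y ∧
      e * slicePos x a b e s y ≤ √(x s ^ 2 + y ^ 2) := by
  have h1 := H.abs_le_sqrt s y
  have h2 := H.right_mem s
  have h3 : e * slicePos x a b e s y = e * x s + a s * (√(x s ^ 2 + y ^ 2) - e * x s) := by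
    rw [H.slicePos_of_ge hc]
    linear_combination a s * H.sign_mul_sign (√(x s ^ 2 + y ^ 2))
  have h4 : e * x s ≤ √(x s ^ 2 + y ^ 2) := (le_abs_self _).trans h1
  rw [h3]
  refine ⟨?_, by nlinarith [h2.1], by nlinarith [h2.2]⟩
  rcases hc.eq_or_lt with rfl | hlt
  · simp [H.zero]
  · exact (H.pos_of_lt hs hlt).le

theorem bounds_of_le (H : IsJointZone x z h a b c e I) {s : ℝ} (hs : s ∈ I) (hc : s ≤ c) (y : ℝ) :
    e * x s ≤ 0 ∧ e * slicePos x a b e s y ≤ e * x s ∧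
      -√(x s ^ 2 + y ^ 2) ≤ e * slicePos x a b e s y := by
  have h1 := H.abs_le_sqrt s y
  have h2 := H.left_mem s
  have h3 : e * slicePos x a b e s y = e * x s + b s * (-√(x s ^ 2 + y ^ 2) - e * x s) := by
    rw [H.slicePos_of_le hc]
    linear_combination -b s * H.sign_mul_sign (√(x s ^ 2 + y ^ 2))
  have h4 : -√(x s ^ 2 + y ^ 2) ≤ e * x s := (abs_le.1 h1).1
  rw [h3]
  refine ⟨?_, by nlinarith [h2.1], by nlinarith [h2.2]⟩
  rcases hc.eq_or_lt with rfl | hlt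
  · simp [H.zero]
  · exact (H.neg_of_lt hs hlt).le

theorem sq_slicePos_le (H : IsJointZone x z h a b c e I) {s : ℝ} (hs : s ∈ I) (y : ℝ) :
    x s ^ 2 ≤ slicePos x a b e s y ^ 2 ∧ slicePos x a b e s y ^ 2 ≤ x s ^ 2 + y ^ 2 := by
  have h0 : 0 ≤ x s ^ 2 + y ^ 2 := by positivity
  have hsq := Real.sq_sqrt h0
  rw [← H.sign_sq (x s), ← H.sign_sq (slicePos x a b e s y)]
  rcases le_total c s with hc | hc
  · obtain ⟨h1, h2, h3⟩ := H.bounds_of_ge hs hc y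
    rw [H.sign_sq (x s)]
    refine ⟨?_, by nlinarith⟩
    rw [← H.sign_sq (x s)]
    nlinarith
  · obtain ⟨h1, h2, h3⟩ := H.bounds_of_le hs hc y
    rw [H.sign_sq (x s)]
    refine ⟨?_, by nlinarith⟩
    rw [← H.sign_sq (x s)]
    nlinarith

theorem eventually_eq_joint (H : IsJointZone x z h a b c e I) :
    ∀ᶠ s in 𝓝 c, ∀ y, slicePos x a b e s y = x s := by
  obtain ⟨η, hη, ha, hb⟩ := H.cutoff
  filter_upwards [Ioo_mem_nhds (show c - η < c by linarith) (show c < c + η by linarith)]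
    with s hs y
  rw [slicePos, ha s hs.2.le, hb s hs.1.le]; ring

theorem ne_zero (H : IsJointZone x z h a b c e I) {s : ℝ} (hs : s ∈ I) (hc : s ≠ c) : x s ≠ 0 := by
  intro h0
  rcases lt_or_gt_of_ne hc with hlt | hlt
  · simpa [h0] using H.neg_of_lt hs hlt
  · simpa [h0] using H.pos_of_lt hs hlt

/-- The root is singular only where `x = 0` and `y = 0`, that is at the joint, and there both
cutoffs vanish nearby. -/
theorem contDiffAt_slicePos (H : IsJointZone x z h a b c e I) {p : ℝ × ℝ} (hp : p.1 ∈ I) :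
    ContDiffAt ℝ ∞ (fun p : ℝ × ℝ => slicePos x a b e p.1 p.2) p := by
  have hx : ContDiffAt ℝ ∞ (fun p : ℝ × ℝ => x p.1) p := (H.smooth.comp contDiff_fst).contDiffAt
  rcases eq_or_ne p.1 c with hc | hc
  · refine hx.congr_of_eventuallyEq ?_
    have h1 : ∀ᶠ q : ℝ × ℝ in 𝓝 p, ∀ y, slicePos x a b e q.1 y = x q.1 :=
      continuous_fst.continuousAt.eventually (by rw [hc]; exact H.eventually_eq_joint)
    filter_upwards [h1] with q hq using hq q.2
  · have hx0 := H.ne_zero hp hc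
    have hpos : x p.1 ^ 2 + p.2 ^ 2 ≠ 0 := by positivity
    have hr : ContDiffAt ℝ ∞ (fun p : ℝ × ℝ => √(x p.1 ^ 2 + p.2 ^ 2)) p :=
      ((hx.pow 2).add (contDiff_snd.contDiffAt.pow 2)).sqrt hpos
    have ha : ContDiffAt ℝ ∞ (fun p : ℝ × ℝ => a p.1) p :=
      (H.smooth_right.comp contDiff_fst).contDiffAt
    have hb : ContDiffAt ℝ ∞ (fun p : ℝ × ℝ => b p.1) p :=
      (H.smooth_left.comp contDiff_fst).contDiffAt
    exact (hx.add (ha.mul ((contDiffAt_const.mul hr).sub hx))).add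
      (hb.mul ((contDiffAt_const.mul hr).neg.sub hx))

/-- Away from the joint the signed derivative splits into three nonnegative terms: the slope of `x`,
the derivative of the cutoff, and the slope of the hyperbola branch. The first is positive while the
cutoff is below `1`, the last once it equals `1`. -/
theorem exists_hasDerivAt_slicePos (H : IsJointZone x z h a b c e I) {s : ℝ} (hs : s ∈ I) (y : ℝ) :
    ∃ d, HasDerivAt (fun s => slicePos x a b e s y) d s ∧ 0 < e * d := by
  have hx := H.smooth.hasDerivAt_deriv s
  have hsl := H.slope s hs
  rcases eq_or_ne s c with rfl | hc
  · refine ⟨_, hx.congr_of_eventuallyEq ?_, hsl⟩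
    filter_upwards [H.eventually_eq_joint] with u hu using hu y
  have hx0 := H.ne_zero hs hc
  have hpos : 0 < x s ^ 2 + y ^ 2 := by positivity
  have hspos := Real.sqrt_pos.2 hpos
  have hr : HasDerivAt (fun s => √(x s ^ 2 + y ^ 2)) (x s * deriv x s / √(x s ^ 2 + y ^ 2)) s := by
    refine (((hx.pow 2).add_const (y ^ 2)).sqrt hpos.ne').congr_deriv ?_
    simp; field_simp
  have h1 := abs_le.1 (H.abs_le_sqrt s y)
  set r := √(x s ^ 2 + y ^ 2) with hrdef
  have hprod : x s * deriv x s = (e * x s) * (e * deriv x s) := by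
    linear_combination -(x s * deriv x s) * H.sign
  rcases lt_or_gt_of_ne hc with hlt | hlt
  · have hd := hx.add ((H.smooth_left.hasDerivAt_deriv s).mul ((hr.const_mul e).neg.sub hx))
    refine ⟨_, hd.congr_of_eventuallyEq ?_, ?_⟩
    · filter_upwards [Iio_mem_nhds hlt] with u hu using H.slicePos_of_le (le_of_lt hu) y
    · have hneg := H.neg_of_lt hs hlt
      have hq : 0 < -(x s * deriv x s / r) := by
        rw [← neg_div]; refine div_pos ?_ hspos
        rw [hprod]; nlinarith
      have hb' : deriv b s ≤ 0 := H.antitone.deriv_nonpos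
      obtain ⟨hb0, hb1⟩ := H.left_mem s
      have e1 : e * (deriv x s + (deriv b s * (-(e * r) - x s) +
          b s * (-(e * (x s * deriv x s / r)) - deriv x s))) =
          (1 - b s) * (e * deriv x s) + deriv b s * (-r - e * x s) +
            b s * -(x s * deriv x s / r) := by
        linear_combination (-deriv b s) * H.sign_mul_sign r -
          b s * H.sign_mul_sign (x s * deriv x s / r)
      refine lt_of_lt_of_eq ?_ e1.symm
      have e2 : 0 ≤ deriv b s * (-r - e * x s) := mul_nonneg_of_nonpos_of_nonpos hb' (by linarith)
      rcases hb1.eq_or_lt with hb1 | hb1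
      · rw [hb1]; linarith
      · have := mul_pos (sub_pos.2 hb1) hsl
        have := mul_nonneg hb0 hq.le
        linarith
  · have hd := hx.add ((H.smooth_right.hasDerivAt_deriv s).mul ((hr.const_mul e).sub hx))
    refine ⟨_, hd.congr_of_eventuallyEq ?_, ?_⟩
    · filter_upwards [Ioi_mem_nhds hlt] with u hu using H.slicePos_of_ge (le_of_lt hu) y
    · have hpos' := H.pos_of_lt hs hlt
      have hq : 0 < x s * deriv x s / r := by
        refine div_pos ?_ hspos
        rw [hprod]; exact mul_pos hpos' hsl
      have ha' : 0 ≤ deriv a s := H.monotone.deriv_nonneg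
      obtain ⟨ha0, ha1⟩ := H.right_mem s
      have e1 : e * (deriv x s + (deriv a s * (e * r - x s) +
          a s * (e * (x s * deriv x s / r) - deriv x s))) =
          (1 - a s) * (e * deriv x s) + deriv a s * (r - e * x s) +
            a s * (x s * deriv x s / r) := by
        linear_combination (deriv a s) * H.sign_mul_sign r +
          a s * H.sign_mul_sign (x s * deriv x s / r)
      refine lt_of_lt_of_eq ?_ e1.symm
      have e2 : 0 ≤ deriv a s * (r - e * x s) := mul_nonneg ha' (by linarith)
      rcases ha1.eq_or_lt with ha1 | ha1
      · rw [ha1]; linarith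
      · have := mul_pos (sub_pos.2 ha1) hsl
        have := mul_nonneg ha0 hq.le
        linarith

theorem continuousOn_slicePos (H : IsJointZone x z h a b c e I) (y : ℝ) :
    ContinuousOn (fun s => slicePos x a b e s y) I := fun s hs => by
  obtain ⟨d, hd, -⟩ := H.exists_hasDerivAt_slicePos hs y
  exact hd.continuousAt.continuousWithinAt

theorem strictMonoOn_slicePos (H : IsJointZone x z h a b c e I) (y : ℝ) :
    StrictMonoOn (fun s => e * slicePos x a b e s y) I := by
  refine strictMonoOn_of_deriv_pos H.convex (continuousOn_const.mul (H.continuousOn_slicePos y))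
    fun s hs => ?_
  obtain ⟨d, hd, hpos⟩ := H.exists_hasDerivAt_slicePos (interior_subset hs) y
  rw [(hd.const_mul e).deriv]
  exact hpos

theorem injOn_slicePos (H : IsJointZone x z h a b c e I) (y : ℝ) :
    Set.InjOn (fun s => slicePos x a b e s y) I := fun _ hs _ hs' heq =>
  (H.strictMonoOn_slicePos y).injOn hs hs' (congrArg (e * ·) heq)

/-- Every point of the slice lies in the plane through the joint or on the orbit of a point of the
curve between the joint and the parameter. -/
theorem exists_foot (H : IsJointZone x z h a b c e I) {s : ℝ} (hs : s ∈ I) (y : ℝ) :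
    ∃ u ∈ Set.uIcc c s, u ∈ I ∧ c + sectorLift h (slicePos x a b e s y, y) = z u ∧
      ((|slicePos x a b e s y| ≤ |y| ∧ u = c) ∨
        (slicePos x a b e s y ^ 2 = y ^ 2 + x u ^ 2 ∧ 0 ≤ slicePos x a b e s y * x u)) := by
  rcases le_or_gt |slicePos x a b e s y| |y| with hle | hgt
  · exact ⟨c, Set.left_mem_uIcc, H.mem, by rw [sectorLift_of_abs_le _ hle, H.height_joint, add_zero],
      Or.inl ⟨hle, rfl⟩⟩
  set X := slicePos x a b e s y with hX
  have hq : 0 < X ^ 2 - y ^ 2 := by linarith [sq_lt_sq.2 hgt]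
  have hr := Real.sqrt_pos.2 hq
  have hr2 := Real.sq_sqrt hq.le
  set r := √(X ^ 2 - y ^ 2)
  have hle : X ^ 2 ≤ x s ^ 2 + y ^ 2 := (H.sq_slicePos_le hs y).2
  have hsub : Set.uIcc c s ⊆ I := H.ordConnected.uIcc_subset H.mem hs
  have hcont : ContinuousOn (fun s => e * x s) (Set.uIcc c s) := by
    have := H.smooth.continuous; fun_prop
  -- The foot `u` solves `x u = ±√(X² - y²)`. It lies between `c` and `s` because `X² ≤ x(s)² + y²`.
  obtain ⟨u, hu, hxu, hXu⟩ : ∃ u ∈ Set.uIcc c s, x u ^ 2 = r ^ 2 ∧ 0 ≤ X * x u := by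
    have hivt := intermediate_value_uIcc hcont
    rw [H.zero, mul_zero] at hivt
    rcases le_total c s with hc | hc
    · obtain ⟨h1, h2, -⟩ := H.bounds_of_ge hs hc y
      obtain ⟨u, hu, hxu⟩ := hivt (show r ∈ Set.uIcc 0 (e * x s) by
        rw [Set.uIcc_of_le h1]
        refine ⟨hr.le, abs_le_of_sq_le_sq' (by rw [H.sign_sq]; linarith) h1 |>.2⟩)
      refine ⟨u, hu, by rw [← hxu, H.sign_sq], ?_⟩
      have : X * x u = (e * X) * (e * x u) := by linear_combination -(X * x u) * H.sign
      rw [this]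
      exact mul_nonneg (h1.trans h2) (by simp only at hxu; linarith)
    · obtain ⟨h1, h2, -⟩ := H.bounds_of_le hs hc y
      obtain ⟨u, hu, hxu⟩ := hivt (show -r ∈ Set.uIcc 0 (e * x s) by
        rw [Set.uIcc_of_ge h1]
        refine ⟨?_, by linarith⟩
        have := abs_le_of_sq_le_sq' (a := r) (b := -(e * x s))
          (by rw [neg_sq, H.sign_sq]; linarith) (by linarith) |>.2
        linarith)
      refine ⟨u, hu, by rw [← neg_sq r, ← hxu, H.sign_sq], ?_⟩
      have : X * x u = (e * X) * (e * x u) := by linear_combination -(X * x u) * H.sign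
      rw [this]
      exact mul_nonneg_of_nonpos_of_nonpos (h2.trans h1) (by simp only at hxu; linarith)
  have huI := hsub hu
  have hsq : X ^ 2 = y ^ 2 + x u ^ 2 := by rw [hxu, hr2]; ring
  refine ⟨u, hu, huI, ?_, Or.inr ⟨hsq, hXu⟩⟩
  rw [sectorLift_of_sq H.flat.zero hsq hXu, H.height u huI]; ring

/-- Where the cutoff is `1` the slice lies on the hyperbola of its parameter, and beyond `u` that
hyperbola is at least as far out as the one of `u`. At an end plane `e * x`, a lower bound for `e *
slicePos`, is unbounded. -/
theorem exists_reach_right (H : IsJointZone x z h a b c e I) {u : ℝ} (hu : u ∈ I) (hc : c ≤ u)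
    (y : ℝ) : ∃ s ∈ I, √(x u ^ 2 + y ^ 2) ≤ e * slicePos x a b e s y := by
  rcases H.reach_right with ⟨s, hs, hcs, has⟩ | hB
  · have hm : max u s ∈ I := by rcases max_choice u s with h | h <;> rw [h] <;> assumption
    have hcm : c ≤ max u s := hc.trans (le_max_left _ _)
    have ham : a (max u s) = 1 :=
      le_antisymm (H.right_mem _).2 (has ▸ H.monotone (le_max_right u s))
    refine ⟨max u s, hm, ?_⟩
    rw [H.slicePos_of_ge hcm, ham, one_mul, add_sub_cancel, H.sign_mul_sign]
    refine Real.sqrt_le_sqrt ?_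
    have h1 := H.strictMonoOn.monotoneOn hu hm (le_max_left u s)
    have h0 := (H.bounds_of_ge hu hc y).1
    rw [← H.sign_sq (x u), ← H.sign_sq (x (max u s))]
    nlinarith
  · obtain ⟨s, hs, hcs, hBs⟩ := hB (√(x u ^ 2 + y ^ 2))
    exact ⟨s, hs, hBs.trans (H.bounds_of_ge hs hcs y).2.1⟩

theorem exists_reach_left (H : IsJointZone x z h a b c e I) {u : ℝ} (hu : u ∈ I) (hc : u ≤ c)
    (y : ℝ) : ∃ s ∈ I, e * slicePos x a b e s y ≤ -√(x u ^ 2 + y ^ 2) := by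
  rcases H.reach_left with ⟨s, hs, hcs, hbs⟩ | hB
  · have hm : min u s ∈ I := by rcases min_choice u s with h | h <;> rw [h] <;> assumption
    have hcm : min u s ≤ c := (min_le_left _ _).trans hc
    have hbm : b (min u s) = 1 :=
      le_antisymm (H.left_mem _).2 (hbs ▸ H.antitone (min_le_right u s))
    refine ⟨min u s, hm, ?_⟩
    rw [H.slicePos_of_le hcm, hbm, one_mul, add_sub_cancel, mul_neg, H.sign_mul_sign, neg_le_neg_iff]
    refine Real.sqrt_le_sqrt ?_
    have h1 := H.strictMonoOn.monotoneOn hm hu (min_le_left u s)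
    have h0 := (H.bounds_of_le hu hc y).1
    rw [← H.sign_sq (x u), ← H.sign_sq (x (min u s))]
    nlinarith
  · obtain ⟨s, hs, hcs, hBs⟩ := hB (-√(x u ^ 2 + y ^ 2))
    exact ⟨s, hs, (H.bounds_of_le hs hcs y).2.1.trans hBs⟩

theorem exists_slicePos_eq (H : IsJointZone x z h a b c e I) {s s' v y : ℝ} (hs : s ∈ I)
    (hs' : s' ∈ I) (h1 : e * slicePos x a b e s y ≤ e * v)
    (h2 : e * v ≤ e * slicePos x a b e s' y) : ∃ u ∈ I, slicePos x a b e u y = v := by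
  obtain ⟨u, hu, huv⟩ := H.ordConnected.isPreconnected.intermediate_value hs hs'
    (f := fun s => e * slicePos x a b e s y) (continuousOn_const.mul (H.continuousOn_slicePos y))
    ⟨h1, h2⟩
  refine ⟨u, hu, ?_⟩
  rw [← H.sign_mul_sign (slicePos x a b e u y), ← H.sign_mul_sign v]
  exact congrArg (e * ·) huv

/-- Each point on the orbit of a point of the curve is reached. -/
theorem exists_slicePos_eq_of_sq (H : IsJointZone x z h a b c e I) {u v y : ℝ} (hu : u ∈ I)
    (hsq : v ^ 2 = y ^ 2 + x u ^ 2) (hv : 0 ≤ v * x u) :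
    ∃ s ∈ I, slicePos x a b e s y = v ∧ c + sectorLift h (v, y) = z u := by
  have hz : c + sectorLift h (v, y) = z u := by
    rw [sectorLift_of_sq H.flat.zero hsq hv, H.height u hu]; ring
  have habs : |e * v| = √(x u ^ 2 + y ^ 2) := by
    rw [← Real.sqrt_sq_eq_abs, H.sign_sq, hsq, add_comm]
  have hprod : v * x u = (e * v) * (e * x u) := by linear_combination -(v * x u) * H.sign
  have h0 := H.slicePos_joint y
  obtain ⟨s₁, hs₁, hr⟩ := H.exists_reach_right H.mem le_rfl y
  obtain ⟨s₂, hs₂, hl⟩ := H.exists_reach_left H.mem le_rfl y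
  rcases lt_trichotomy c u with hc | rfl | hc
  · obtain ⟨s, hs, hreach⟩ := H.exists_reach_right hu hc.le y
    have hpos := H.pos_of_lt hu hc
    have hev : 0 ≤ e * v := nonneg_of_mul_nonneg_left (hprod ▸ hv) hpos
    obtain ⟨w, hw, hwv⟩ := H.exists_slicePos_eq H.mem hs (v := v) (y := y) (by rw [h0, mul_zero]; exact hev)
      ((le_abs_self _).trans (habs.trans_le hreach))
    exact ⟨w, hw, hwv, hz⟩
  · obtain ⟨w, hw, hwv⟩ := H.exists_slicePos_eq hs₂ hs₁ (v := v) (y := y)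
      (hl.trans (abs_le.1 habs.le).1) ((abs_le.1 habs.le).2.trans hr)
    exact ⟨w, hw, hwv, hz⟩
  · obtain ⟨s, hs, hreach⟩ := H.exists_reach_left hu hc.le y
    have hneg := H.neg_of_lt hu hc
    have hev : e * v ≤ 0 := by
      by_contra hcon
      have := mul_neg_of_pos_of_neg (not_le.1 hcon) hneg
      rw [← hprod] at this; linarith
    obtain ⟨w, hw, hwv⟩ := H.exists_slicePos_eq hs H.mem (v := v) (y := y)
      (hreach.trans (abs_le.1 habs.le).1) (by rw [h0, mul_zero]; exact hev)
    exact ⟨w, hw, hwv, hz⟩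

/-- Each point of the plane in the two sectors around the `y`-axis is reached. -/
theorem exists_slicePos_eq_of_abs_le (H : IsJointZone x z h a b c e I) {v y : ℝ} (hv : |v| ≤ |y|) :
    ∃ s ∈ I, slicePos x a b e s y = v ∧ c + sectorLift h (v, y) = c := by
  have habs : |e * v| ≤ √(x c ^ 2 + y ^ 2) := by
    rw [H.zero, ← Real.sqrt_sq_eq_abs, H.sign_sq]
    exact Real.sqrt_le_sqrt (by nlinarith [sq_le_sq.2 hv])
  obtain ⟨s₁, hs₁, hr⟩ := H.exists_reach_right H.mem le_rfl y
  obtain ⟨s₂, hs₂, hl⟩ := H.exists_reach_left H.mem le_rfl y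
  obtain ⟨w, hw, hwv⟩ := H.exists_slicePos_eq hs₂ hs₁ (v := v) (y := y)
    (by linarith [(abs_le.1 habs).1]) ((abs_le.1 habs).2.trans hr)
  exact ⟨w, hw, hwv, by rw [sectorLift_of_abs_le _ hv, add_zero]⟩

end IsJointZone

/-! ### The joint zones of a profile -/

/-- The parameters around the `j`-th joint. -/
def jointZone (ℓ : ℕ∞) (j : ℕ) (δ : ℝ) : Set ℝ :=
  {s | |s - j| < δ ∨ (j = 0 ∧ s < 0) ∨ (((j + 1 : ℕ) : ℕ∞) = ℓ ∧ (j : ℝ) < s)}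

open Classical in
/-- The cutoff to the right of the `j`-th joint. -/
noncomputable def rightCutoff (ℓ : ℕ∞) (j : ℕ) (δ s : ℝ) : ℝ :=
  -- The last joint has no departing arc, and `X = x s` is kept. Otherwise the cutoff rises while `s
  -- - j` goes from `δ / 3` to `2 * δ / 3`.
  if ((j + 1 : ℕ) : ℕ∞) = ℓ then 0 else Real.smoothTransition (3 * (s - j) / δ - 1)

/-- The cutoff to the left of the `j`-th joint. -/
noncomputable def leftCutoff (j : ℕ) (δ s : ℝ) : ℝ :=
  if j = 0 then 0 else Real.smoothTransition (3 * (j - s) / δ - 1)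

theorem rightCutoff_eq_one {ℓ : ℕ∞} {j : ℕ} {δ s : ℝ} (hδ : 0 < δ) (hj : ((j + 1 : ℕ) : ℕ∞) ≠ ℓ)
    (hs : j + 2 * δ / 3 ≤ s) : rightCutoff ℓ j δ s = 1 := by
  rw [rightCutoff, if_neg hj]
  refine Real.smoothTransition.one_of_one_le ?_
  rw [le_sub_iff_add_le, le_div_iff₀ hδ]; linarith

theorem leftCutoff_eq_one {j : ℕ} {δ s : ℝ} (hδ : 0 < δ) (hj : j ≠ 0)
    (hs : s ≤ j - 2 * δ / 3) : leftCutoff j δ s = 1 := by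
  rw [leftCutoff, if_neg hj]
  refine Real.smoothTransition.one_of_one_le ?_
  rw [le_sub_iff_add_le, le_div_iff₀ hδ]; linarith

theorem rightCutoff_eq_zero {ℓ : ℕ∞} {j : ℕ} {δ s : ℝ} (hδ : 0 < δ)
    (hs : s ≤ j + δ / 3) : rightCutoff ℓ j δ s = 0 := by
  rw [rightCutoff]
  split_ifs
  · rfl
  · refine Real.smoothTransition.zero_of_nonpos ?_
    rw [sub_nonpos, div_le_one₀ hδ]; linarith

theorem leftCutoff_eq_zero {j : ℕ} {δ s : ℝ} (hδ : 0 < δ)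
    (hs : j - δ / 3 ≤ s) : leftCutoff j δ s = 0 := by
  rw [leftCutoff]
  split_ifs
  · rfl
  · refine Real.smoothTransition.zero_of_nonpos ?_
    rw [sub_nonpos, div_le_one₀ hδ]; linarith

theorem contDiff_rightCutoff (ℓ : ℕ∞) (j : ℕ) (δ : ℝ) : ContDiff ℝ ∞ (rightCutoff ℓ j δ) := by
  unfold rightCutoff
  split_ifs
  · exact contDiff_const
  · exact Real.smoothTransition.contDiff.comp (by fun_prop)

theorem contDiff_leftCutoff (j : ℕ) (δ : ℝ) : ContDiff ℝ ∞ (leftCutoff j δ) := by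
  unfold leftCutoff
  split_ifs
  · exact contDiff_const
  · exact Real.smoothTransition.contDiff.comp (by fun_prop)

theorem monotone_rightCutoff (ℓ : ℕ∞) (j : ℕ) {δ : ℝ} (hδ : 0 < δ) :
    Monotone (rightCutoff ℓ j δ) := fun s t hst => by
  unfold rightCutoff
  split_ifs
  · exact le_rfl
  · refine Real.smoothTransition.monotone ?_
    gcongr

theorem antitone_leftCutoff (j : ℕ) {δ : ℝ} (hδ : 0 < δ) :
    Antitone (leftCutoff j δ) := fun s t hst => by
  unfold leftCutoff
  split_ifs
  · exact le_rfl
  · refine Real.smoothTransition.monotone ?_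
    gcongr

theorem rightCutoff_mem (ℓ : ℕ∞) (j : ℕ) (δ s : ℝ) : rightCutoff ℓ j δ s ∈ Set.Icc 0 1 := by
  unfold rightCutoff
  split_ifs
  · exact ⟨le_rfl, zero_le_one⟩
  · exact ⟨Real.smoothTransition.nonneg _, Real.smoothTransition.le_one _⟩

theorem leftCutoff_mem (j : ℕ) (δ s : ℝ) : leftCutoff j δ s ∈ Set.Icc 0 1 := by
  unfold leftCutoff
  split_ifs
  · exact ⟨le_rfl, zero_le_one⟩
  · exact ⟨Real.smoothTransition.nonneg _, Real.smoothTransition.le_one _⟩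

theorem isOpen_jointZone (ℓ : ℕ∞) (j : ℕ) (δ : ℝ) : IsOpen (jointZone ℓ j δ) := by
  have h : jointZone ℓ j δ = {s : ℝ | |s - j| < δ} ∪ ({s : ℝ | j = 0 ∧ s < 0} ∪
    {s : ℝ | ((j + 1 : ℕ) : ℕ∞) = ℓ ∧ (j : ℝ) < s}) := rfl
  rw [h]
  refine (isOpen_lt (by fun_prop) continuous_const).union (IsOpen.union ?_ ?_)
  · exact isOpen_const.inter (isOpen_lt continuous_id continuous_const)
  · exact isOpen_const.inter (isOpen_lt continuous_const continuous_id)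

theorem ordConnected_jointZone (ℓ : ℕ∞) (j : ℕ) {δ : ℝ} (hδ : 0 < δ) :
    (jointZone ℓ j δ).OrdConnected := by
  refine ⟨fun a ha b hb u hu => ?_⟩
  by_cases h : |u - j| < δ
  · exact Or.inl h
  rcases le_or_gt u j with huj | huj
  · have h1 : u ≤ j - δ := by
      rw [abs_of_nonpos (by linarith)] at h; linarith
    rcases ha with ha | ⟨hj, ha⟩ | ⟨hj, ha⟩
    · rw [abs_lt] at ha; linarith [hu.1]
    · refine Or.inr (Or.inl ⟨hj, ?_⟩)
      rw [hj, Nat.cast_zero] at h1; linarith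
    · linarith [hu.1]
  · have h1 : j + δ ≤ u := by
      rw [abs_of_pos (by linarith)] at h; linarith
    rcases hb with hb | ⟨hj, hb⟩ | ⟨hj, hb⟩
    · rw [abs_lt] at hb; linarith [hu.2]
    · rw [hj, Nat.cast_zero] at huj; linarith [hu.2]
    · exact Or.inr (Or.inr ⟨hj, huj⟩)

namespace IsLongProfile

variable {ℓ : ℕ∞} {x z : ℝ → ℝ}

theorem right_growth (H : IsLongProfile ℓ x z) {j : ℕ} (hj : ((j + 1 : ℕ) : ℕ∞) = ℓ) :
    ∃ κ, 0 < κ ∧ ∀ s, (j : ℝ) ≤ s → κ * (s - j) ≤ (-1 : ℝ) ^ (j + 1) * x s := by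
  obtain ⟨κ, hκ, hκ'⟩ := H.right_slope j hj
  have hd : ∀ s, HasDerivAt (fun s => (-1 : ℝ) ^ (j + 1) * x s) ((-1 : ℝ) ^ (j + 1) * deriv x s) s :=
    fun s => (H.contDiff_fst.hasDerivAt_deriv s).const_mul _
  have hjl : (j : ℕ∞) < ℓ := by rw [← hj]; exact_mod_cast Nat.lt_succ_self j
  refine ⟨κ, hκ, fun s hs => ?_⟩
  have := (convex_Ici (j : ℝ)).mul_sub_le_image_sub_of_le_deriv
    (f := fun s => (-1 : ℝ) ^ (j + 1) * x s) (C := κ)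
    (fun s _ => (hd s).continuousAt.continuousWithinAt)
    (fun s _ => (hd s).differentiableAt.differentiableWithinAt)
    (fun s hs => by rw [(hd s).deriv]; exact hκ' s (interior_subset hs)) j (Set.mem_Ici.2 le_rfl) s hs hs
  simpa [(H.joint j hjl).1] using this

theorem left_growth (H : IsLongProfile ℓ x z) (hℓ : 0 < ℓ) :
    ∃ κ, 0 < κ ∧ ∀ s ≤ 0, (-1 : ℝ) ^ (0 + 1) * x s ≤ κ * s := by
  obtain ⟨κ, hκ, hκ'⟩ := H.left_slope
  have hd : ∀ s, HasDerivAt (fun s => (-1 : ℝ) ^ (0 + 1) * x s) ((-1 : ℝ) ^ (0 + 1) * deriv x s) s :=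
    fun s => (H.contDiff_fst.hasDerivAt_deriv s).const_mul _
  have h0 : x 0 = 0 := by simpa using (H.joint 0 (by simpa using hℓ)).1
  refine ⟨κ, hκ, fun s hs => ?_⟩
  have := (convex_Iic (0 : ℝ)).mul_sub_le_image_sub_of_le_deriv
    (f := fun s => (-1 : ℝ) ^ (0 + 1) * x s) (C := κ)
    (fun s _ => (hd s).continuousAt.continuousWithinAt)
    (fun s _ => (hd s).differentiableAt.differentiableWithinAt)
    (fun s hs => by rw [(hd s).deriv]; exact hκ' s (Set.mem_Iic.1 (interior_subset hs))) s hs 0 (Set.mem_Iic.2 le_rfl) hs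
  rw [h0] at this
  linarith

/-- Near the joint `x` is inverted through its globally monotone extension `ξ`, with inverse `η`,
and `h` is `z ∘ η` minus the height of the joint. Beyond the ends `ξ` may differ from `x`, but `h (x
s) = z s - j` persists since both sides vanish. -/
theorem exists_isJointZone (H : IsLongProfile ℓ x z) {j : ℕ} (hj : (j : ℕ∞) < ℓ) :
    ∃ (δ : ℝ) (h : ℝ → ℝ), 0 < δ ∧ δ < 1 / 2 ∧
      IsJointZone x z h (rightCutoff ℓ j δ) (leftCutoff j δ) j ((-1) ^ (j + 1))
        (jointZone ℓ j δ) := by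
  have he := neg_one_pow_mul_self (j + 1)
  obtain ⟨hxj, hzj⟩ := H.joint j hj
  obtain ⟨δ₀, κ, ξ, hδ₀, hκ, hξ, hd, hξx⟩ :=
    exists_strictMono_extension H.contDiff_fst he (H.slope j hj)
  obtain ⟨η, hη, hηξ, hξη⟩ := exists_smooth_inverse hξ he hκ hd
  set e : ℝ := (-1) ^ (j + 1) with hedef
  have hξj : ξ j = 0 := by rw [hξx j (by simpa using hδ₀.le), hxj]
  have hηj : η 0 = j := by rw [← hξj, hηξ]
  have hmono : StrictMono fun s => e * ξ s := strictMono_of_deriv_pos fun s => by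
    rw [((hξ.hasDerivAt_deriv s).const_mul e).deriv]; exact hκ.trans_le (hd s)
  have hηpos : ∀ u, 0 ≤ e * u → (j : ℝ) ≤ η u := fun u hu => by
    refine hmono.le_iff_le.1 ?_
    simpa [hξj, hξη] using hu
  have hηneg : ∀ u, e * u ≤ 0 → η u ≤ j := fun u hu => by
    refine hmono.le_iff_le.1 ?_
    simpa [hξj, hξη] using hu
  let h : ℝ → ℝ := fun u => z (j + (η u - j)) - z j
  have hh : ∀ u, h u = z (η u) - j := fun u => by simp [h, hzj]
  have hflat : IsFlat h := (H.flat j hj).comp (hη.sub contDiff_const) (by simp [hηj])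
  -- The bound `1 / 3` ensures `δ < 1 / 2`, which keeps the zones of different joints apart.
  set δ := min δ₀ (1 / 3) with hδdef
  have hδ : 0 < δ := by positivity
  have hδδ₀ : δ ≤ δ₀ := min_le_left _ _
  have hδ3 : δ ≤ 1 / 3 := min_le_right _ _
  refine ⟨δ, h, hδ, by linarith, ⟨he, ordConnected_jointZone _ _ hδ,
    Or.inl (by simpa using hδ), H.contDiff_fst, hxj, ?_, hflat, ?_, contDiff_rightCutoff _ _ _,
    contDiff_leftCutoff _ _, monotone_rightCutoff _ _ hδ, antitone_leftCutoff _ hδ,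
    rightCutoff_mem _ _ _, leftCutoff_mem _ _, ⟨δ / 3, by positivity,
      fun s hs => rightCutoff_eq_zero hδ hs, fun s hs => leftCutoff_eq_zero hδ hs⟩, ?_, ?_⟩⟩
  · rintro s (hs | ⟨rfl, hs⟩ | ⟨hjℓ, hs⟩)
    · have : x =ᶠ[𝓝 s] ξ := by
        filter_upwards [(isOpen_lt (by fun_prop) continuous_const :
          IsOpen {s : ℝ | |s - j| < δ}).mem_nhds hs] with u hu
        exact (hξx u ((le_of_lt hu).trans hδδ₀)).symm
      rw [this.deriv_eq]
      exact hκ.trans_le (hd s)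
    · obtain ⟨κ', hκ', hd'⟩ := H.left_slope
      exact hκ'.trans_le (hd' s hs.le)
    · obtain ⟨κ', hκ', hd'⟩ := H.right_slope j hjℓ
      exact hκ'.trans_le (hd' s hs.le)
  · rintro s (hs | ⟨rfl, hs⟩ | ⟨hjℓ, hs⟩)
    · rw [hh, ← hξx s (hs.le.trans hδδ₀), hηξ]
    · obtain ⟨κ', hκ', hg⟩ := H.left_growth (lt_of_le_of_lt (by simp) hj)
      have h1 := hηneg (x s) ((hg s hs.le).trans (by nlinarith))
      rw [hh, H.left_height s hs.le, H.left_height _ (by simpa using h1)]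
    · obtain ⟨κ', hκ', hg⟩ := H.right_growth hjℓ
      have h1 := hηpos (x s) (le_trans (by nlinarith) (hg s hs.le))
      rw [hh, H.right_height j hjℓ s hs.le, H.right_height j hjℓ _ h1]
  · rcases ENat.succ_lt_or_eq hj with hjℓ | hjℓ
    · refine Or.inl ⟨j + 2 * δ / 3, Or.inl ?_, by linarith, rightCutoff_eq_one hδ hjℓ.ne le_rfl⟩
      rw [abs_lt]; constructor <;> linarith
    · refine Or.inr fun B => ?_
      obtain ⟨κ', hκ', hg⟩ := H.right_growth hjℓ
      have hpos : 0 < |B| / κ' + 1 := by positivity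
      refine ⟨j + (|B| / κ' + 1), Or.inr (Or.inr ⟨hjℓ, by linarith⟩), by linarith, ?_⟩
      refine le_trans ?_ (hg _ (by linarith))
      have : κ' * (j + (|B| / κ' + 1) - j) = |B| + κ' := by field_simp; ring
      rw [this]; linarith [le_abs_self B]
  · rcases Nat.eq_zero_or_pos j with rfl | hj0
    · refine Or.inr fun B => ?_
      obtain ⟨κ', hκ', hg⟩ := H.left_growth (lt_of_le_of_lt (by simp) hj)
      have hpos : 0 < |B| / κ' + 1 := by positivity
      refine ⟨-(|B| / κ' + 1), Or.inr (Or.inl ⟨rfl, by linarith⟩), by push_cast; linarith, ?_⟩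
      refine le_trans (hg _ (by linarith)) ?_
      have : κ' * -(|B| / κ' + 1) = -|B| - κ' := by field_simp; ring
      rw [this]; linarith [neg_abs_le B]
    · refine Or.inl ⟨j - 2 * δ / 3, Or.inl ?_, by linarith, leftCutoff_eq_one hδ hj0.ne' le_rfl⟩
      rw [abs_lt]; constructor <;> linarith

end IsLongProfile

/-! ### Slicing the surface -/

/-- A choice of joint zones for a profile. -/
structure IsAtlas (ℓ : ℕ∞) (x z : ℝ → ℝ) (δ : ℕ → ℝ) (h : ℕ → ℝ → ℝ) : Prop where
  profile : IsLongProfile ℓ x z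
  two_le : 2 ≤ ℓ
  pos : ∀ j, 0 < δ j
  lt_half : ∀ j, δ j < 1 / 2
  zone : ∀ j : ℕ, (j : ℕ∞) < ℓ → IsJointZone x z (h j) (rightCutoff ℓ j (δ j)) (leftCutoff j (δ j)) j
    ((-1) ^ (j + 1)) (jointZone ℓ j (δ j))

theorem IsLongProfile.exists_isAtlas {ℓ : ℕ∞} {x z : ℝ → ℝ} (hℓ : 2 ≤ ℓ)
    (H : IsLongProfile ℓ x z) : ∃ δ h, IsAtlas ℓ x z δ h := by
  have key : ∀ j : ℕ, ∃ (δ : ℝ) (h : ℝ → ℝ), 0 < δ ∧ δ < 1 / 2 ∧ ((j : ℕ∞) < ℓ →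
      IsJointZone x z h (rightCutoff ℓ j δ) (leftCutoff j δ) j ((-1) ^ (j + 1))
        (jointZone ℓ j δ)) := fun j => by
    by_cases hj : (j : ℕ∞) < ℓ
    · obtain ⟨δ, h, h1, h2, h3⟩ := H.exists_isJointZone hj
      exact ⟨δ, h, h1, h2, fun _ => h3⟩
    · exact ⟨1 / 3, 0, by norm_num, by norm_num, fun h => absurd h hj⟩
  choose δ h h1 h2 h3 using key
  exact ⟨δ, h, H, hℓ, h1, h2, h3⟩

/-- The parameters between the `j`-th and the `(j + 1)`-st joint. -/
def middle (δ : ℕ → ℝ) (j : ℕ) : Set ℝ :=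
  Set.Ioo (j + 2 * δ j / 3) (j + 1 - 2 * δ (j + 1) / 3)

/-- The slices `y = const` of the surface, parametrized by `s ↦ (X s y, Z s y)`. -/
structure IsSlicing (ℓ : ℕ∞) (x z : ℝ → ℝ) (δ : ℕ → ℝ) (h : ℕ → ℝ → ℝ) (X Z : ℝ → ℝ → ℝ) : Prop
    extends IsAtlas ℓ x z δ h where
  on_zone : ∀ j : ℕ, (j : ℕ∞) < ℓ → ∀ s ∈ jointZone ℓ j (δ j), ∀ y,
    X s y = slicePos x (rightCutoff ℓ j (δ j)) (leftCutoff j (δ j)) ((-1) ^ (j + 1)) s y ∧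
      Z s y = j + sectorLift (h j) (X s y, y)
  on_middle : ∀ j : ℕ, ((j + 1 : ℕ) : ℕ∞) < ℓ → ∀ s ∈ middle δ j, ∀ y,
    X s y = (-1) ^ (j + 1) * √(x s ^ 2 + y ^ 2) ∧ Z s y = z s

namespace IsAtlas

variable {ℓ : ℕ∞} {x z : ℝ → ℝ} {δ : ℕ → ℝ} {h : ℕ → ℝ → ℝ}

theorem middle_subset (H : IsAtlas ℓ x z δ h) (j : ℕ) :
    middle δ j ⊆ Set.Ioo (j : ℝ) (j + 1) := fun s hs =>
  ⟨by linarith [hs.1, H.pos j], by linarith [hs.2, H.pos (j + 1)]⟩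

theorem lt_of_mem_zone (H : IsAtlas ℓ x z δ h) {j k : ℕ} (hjk : j < k)
    (hk : (k : ℕ∞) < ℓ) {s t : ℝ} (hs : s ∈ jointZone ℓ j (δ j)) (ht : t ∈ jointZone ℓ k (δ k)) :
    s < t := by
  have hjk' : (j : ℝ) + 1 ≤ k := by exact_mod_cast hjk
  have h1 : s < j + 1 / 2 := by
    rcases hs with hs | ⟨rfl, hs⟩ | ⟨hj, hs⟩
    · linarith [(abs_lt.1 hs).2, H.lt_half j]
    · push_cast; linarith
    · have : k < j + 1 := by exact_mod_cast (hj ▸ hk)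
      omega
  have h2 : k - 1 / 2 < t := by
    rcases ht with ht | ⟨rfl, ht⟩ | ⟨hj, ht⟩
    · linarith [(abs_lt.1 ht).1, H.lt_half k]
    · omega
    · linarith
  linarith

theorem zone_unique (H : IsAtlas ℓ x z δ h) {j k : ℕ} (hj : (j : ℕ∞) < ℓ) (hk : (k : ℕ∞) < ℓ)
    {s : ℝ} (hs : s ∈ jointZone ℓ j (δ j)) (ht : s ∈ jointZone ℓ k (δ k)) : j = k := by
  rcases lt_trichotomy j k with hlt | rfl | hlt
  · exact absurd (H.lt_of_mem_zone hlt hk hs ht) (lt_irrefl _)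
  · rfl
  · exact absurd (H.lt_of_mem_zone hlt hj ht hs) (lt_irrefl _)

theorem lt_top_of_gt (H : IsAtlas ℓ x z δ h) {s : ℝ} (hs : 0 ≤ s) (hn : ¬ ((⌊s⌋₊ : ℕ) : ℕ∞) < ℓ) :
    ∃ j : ℕ, ((j + 1 : ℕ) : ℕ∞) = ℓ ∧ (j : ℝ) + 1 ≤ s := by
  obtain ⟨N, rfl⟩ := ENat.ne_top_iff_exists.1 (ne_top_of_le_ne_top (ENat.natCast_ne_top _) (not_lt.1 hn))
  have hN : 2 ≤ N := by exact_mod_cast H.two_le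
  refine ⟨N - 1, by congr 1; omega, ?_⟩
  have h1 : N ≤ ⌊s⌋₊ := by exact_mod_cast not_lt.1 hn
  have h2 : (N : ℝ) ≤ s := le_trans (by exact_mod_cast h1) (Nat.floor_le hs)
  rw [Nat.cast_sub (by omega)]; push_cast; linarith

/-- A parameter outside all zones keeps the distance `δ` from the joints around it, more than the
margin `2 * δ / 3` of the middle. Zones and middles overlap, so both are open and smoothness can be
checked locally. -/
theorem mem_zone_or_middle (H : IsAtlas ℓ x z δ h) (s : ℝ) :
    (∃ j : ℕ, (j : ℕ∞) < ℓ ∧ s ∈ jointZone ℓ j (δ j)) ∨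
      ((∀ j : ℕ, (j : ℕ∞) < ℓ → s ∉ jointZone ℓ j (δ j)) ∧
        ∃ j : ℕ, ((j + 1 : ℕ) : ℕ∞) < ℓ ∧ s ∈ middle δ j) := by
  by_cases hz : ∃ j : ℕ, (j : ℕ∞) < ℓ ∧ s ∈ jointZone ℓ j (δ j)
  · exact Or.inl hz
  push Not at hz
  refine Or.inr ⟨hz, ⌊s⌋₊, ?_⟩
  have h0 : 0 ≤ s := by
    by_contra hs
    exact hz 0 (lt_of_lt_of_le (by norm_num) H.two_le) (Or.inr (Or.inl ⟨rfl, not_le.1 hs⟩))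
  have hle := Nat.floor_le h0
  have hlt := Nat.lt_floor_add_one s
  have hn : ((⌊s⌋₊ : ℕ) : ℕ∞) < ℓ := by
    by_contra hn
    obtain ⟨j, hj, hjs⟩ := H.lt_top_of_gt h0 hn
    exact hz j (by rw [← hj]; exact_mod_cast Nat.lt_succ_self j)
      (Or.inr (Or.inr ⟨hj, by linarith⟩))
  have h1 : (⌊s⌋₊ : ℝ) + δ ⌊s⌋₊ ≤ s := by
    by_contra hcon
    refine hz _ hn (Or.inl ?_)
    rw [abs_lt]; constructor <;> linarith [H.pos ⌊s⌋₊]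
  have hn1 : ((⌊s⌋₊ + 1 : ℕ) : ℕ∞) < ℓ := by
    refine (ENat.succ_lt_or_eq hn).resolve_right fun heq => ?_
    exact hz _ hn (Or.inr (Or.inr ⟨heq, by linarith [H.pos ⌊s⌋₊]⟩))
  have h2 : s ≤ ⌊s⌋₊ + 1 - δ (⌊s⌋₊ + 1) := by
    by_contra hcon
    refine hz _ hn1 (Or.inl ?_)
    rw [abs_lt]; push_cast; constructor <;> linarith [H.pos (⌊s⌋₊ + 1)]
  exact ⟨hn1, by linarith [H.pos ⌊s⌋₊], by linarith [H.pos (⌊s⌋₊ + 1)]⟩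

/-- A zone meets only the two adjacent middles. A middle starts at distance `2 * δ / 3` from the
joint, where the cutoff has reached `1`; there `X` lies on the hyperbola of `x s`, on which the lift
equals `h (x s) = z s - j`. -/
theorem slice_middle (H : IsAtlas ℓ x z δ h) {j k : ℕ} (hj : (j : ℕ∞) < ℓ)
    (hk : ((k + 1 : ℕ) : ℕ∞) < ℓ) {s : ℝ} (hs : s ∈ jointZone ℓ j (δ j)) (hs' : s ∈ middle δ k)
    (y : ℝ) : slicePos x (rightCutoff ℓ j (δ j)) (leftCutoff j (δ j)) ((-1) ^ (j + 1)) s y =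
        (-1) ^ (k + 1) * √(x s ^ 2 + y ^ 2) ∧
      j + sectorLift (h j) ((-1) ^ (k + 1) * √(x s ^ 2 + y ^ 2), y) = z s := by
  have hZ := H.zone j hj
  have hk0 := H.middle_subset k hs'
  constructor
  · have hjk : j = k ∨ j = k + 1 := by
      rcases hs with hs | ⟨rfl, hs⟩ | ⟨hjl, hs⟩
      · have h1 := abs_lt.1 hs
        have h2 := H.lt_half j
        have h3 : (k : ℝ) < j + 1 := by linarith [hk0.1]
        have h4 : (j : ℝ) < k + 2 := by linarith [hk0.2]
        have h3' : k < j + 1 := by exact_mod_cast h3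
        have h4' : j < k + 2 := by exact_mod_cast h4
        omega
      · have := k.cast_nonneg (α := ℝ)
        linarith [hk0.1]
      · have h1 : k + 1 < j + 1 := by exact_mod_cast (hjl ▸ hk)
        have h2 : (j : ℝ) < k + 1 := by linarith [hk0.2]
        have h3 : j < k + 1 := by exact_mod_cast h2
        omega
    rcases hjk with rfl | rfl
    · rw [hZ.slicePos_of_ge hk0.1.le, rightCutoff_eq_one (H.pos j) hk.ne hs'.1.le]; ring
    · have h1 : s ≤ ((k + 1 : ℕ) : ℝ) - 2 * δ (k + 1) / 3 := by push_cast; exact hs'.2.le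
      rw [hZ.slicePos_of_le (by push_cast; exact hk0.2.le),
        leftCutoff_eq_one (H.pos (k + 1)) (by omega) h1]
      ring
  · have hpos := H.profile.side k hk s hk0
    have h0 : 0 ≤ x s ^ 2 + y ^ 2 := by positivity
    rw [sectorLift_of_sq (hZ.flat.zero) (r := x s), hZ.height s hs]
    · ring
    · rw [mul_pow, Real.sq_sqrt h0, ← pow_mul, mul_comm (k + 1) 2, pow_mul]; norm_num; ring
    · rw [mul_right_comm]; positivity

theorem exists_isSlicing (H : IsAtlas ℓ x z δ h) : ∃ X Z, IsSlicing ℓ x z δ h X Z := by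
  have key : ∀ s : ℝ, ∃ X Z : ℝ → ℝ,
      (∀ j : ℕ, (j : ℕ∞) < ℓ → s ∈ jointZone ℓ j (δ j) → ∀ y,
        X y = slicePos x (rightCutoff ℓ j (δ j)) (leftCutoff j (δ j)) ((-1) ^ (j + 1)) s y ∧
        Z y = j + sectorLift (h j) (X y, y)) ∧
      (∀ j : ℕ, ((j + 1 : ℕ) : ℕ∞) < ℓ → s ∈ middle δ j → ∀ y,
        X y = (-1) ^ (j + 1) * √(x s ^ 2 + y ^ 2) ∧ Z y = z s) := fun s => by
    by_cases hz : ∃ j : ℕ, (j : ℕ∞) < ℓ ∧ s ∈ jointZone ℓ j (δ j)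
    · obtain ⟨j, hj, hs⟩ := hz
      refine ⟨fun y => slicePos x (rightCutoff ℓ j (δ j)) (leftCutoff j (δ j)) ((-1) ^ (j + 1)) s y,
        fun y => j + sectorLift (h j) (slicePos x (rightCutoff ℓ j (δ j)) (leftCutoff j (δ j))
          ((-1) ^ (j + 1)) s y, y), fun k hk hs' y => ?_, fun k hk hs' y => ?_⟩
      · obtain rfl := H.zone_unique hj hk hs hs'
        exact ⟨rfl, rfl⟩
      · obtain ⟨h1, h2⟩ := H.slice_middle hj hk hs hs' y
        refine ⟨h1, ?_⟩
        simp only [h1]; exact h2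
    · push Not at hz
      refine ⟨fun y => (-1) ^ (⌊s⌋₊ + 1) * √(x s ^ 2 + y ^ 2), fun _ => z s,
        fun k hk hs' => absurd hs' (hz k hk), fun k hk hs' y => ?_⟩
      have hk0 := H.middle_subset k hs'
      have : ⌊s⌋₊ = k := (Nat.floor_eq_iff (k.cast_nonneg.trans hk0.1.le)).2 ⟨hk0.1.le, hk0.2⟩
      rw [this]
      exact ⟨rfl, rfl⟩
  choose X Z h1 h2 using key
  exact ⟨X, Z, H, fun j hj s hs y => h1 s j hj hs y, fun j hj s hs y => h2 s j hj hs y⟩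

/-- Away from the joints a nonnegative parameter lies between two joints, or beyond the last. -/
theorem trichotomy (H : IsAtlas ℓ x z δ h) (s : ℝ) :
    s < 0 ∨ (∃ j : ℕ, (j : ℕ∞) < ℓ ∧ s = j) ∨
      (∃ j : ℕ, ((j + 1 : ℕ) : ℕ∞) < ℓ ∧ s ∈ Set.Ioo (j : ℝ) (j + 1)) ∨
      ∃ j : ℕ, ((j + 1 : ℕ) : ℕ∞) = ℓ ∧ (j : ℝ) < s := by
  rcases lt_or_ge s 0 with h0 | h0
  · exact Or.inl h0
  right
  have hle := Nat.floor_le h0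
  have hlt := Nat.lt_floor_add_one s
  by_cases hn : ((⌊s⌋₊ : ℕ) : ℕ∞) < ℓ
  · rcases hle.eq_or_lt with heq | hlt'
    · exact Or.inl ⟨_, hn, heq.symm⟩
    · rcases ENat.succ_lt_or_eq hn with h1 | h1
      · exact Or.inr (Or.inl ⟨_, h1, hlt', hlt⟩)
      · exact Or.inr (Or.inr ⟨_, h1, hlt'⟩)
  · obtain ⟨j, hj, hjs⟩ := H.lt_top_of_gt h0 hn
    exact Or.inr (Or.inr ⟨j, hj, by linarith⟩)

theorem deriv_eq_zero_at_joint (H : IsAtlas ℓ x z δ h) {j : ℕ} (hj : (j : ℕ∞) < ℓ) :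
    deriv z j = 0 := by
  have h1 := (H.profile.flat j hj).flat 1
  rw [iteratedDeriv_one, deriv_sub_const] at h1
  simpa [deriv_comp_const_add] using h1

theorem monotone_height (H : IsAtlas ℓ x z δ h) : Monotone z := by
  refine monotone_of_deriv_nonneg (H.profile.contDiff_snd.differentiable (by simp)) fun s => ?_
  rcases H.trichotomy s with hs | ⟨j, hj, rfl⟩ | ⟨j, hj, hs⟩ | ⟨j, hj, hs⟩
  · have : z =ᶠ[𝓝 s] fun _ => 0 := by
      filter_upwards [Iio_mem_nhds hs] with u hu using H.profile.left_height u (le_of_lt hu)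
    rw [this.deriv_eq]; simp
  · exact (H.deriv_eq_zero_at_joint hj).ge
  · exact (H.profile.rising j hj s hs).le
  · have : z =ᶠ[𝓝 s] fun _ => (j : ℝ) := by
      filter_upwards [Ioi_mem_nhds hs] with u hu using H.profile.right_height j hj u (le_of_lt hu)
    rw [this.deriv_eq]; simp

/-- The height is constant only beyond the end points. -/
theorem eq_end_of_height_eq (H : IsAtlas ℓ x z δ h) {s t : ℝ} (hst : s < t) (heq : z s = z t) :
    t ≤ 0 ∨ ∃ j : ℕ, ((j + 1 : ℕ) : ℕ∞) = ℓ ∧ (j : ℝ) ≤ s := by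
  by_contra! hcon
  obtain ⟨ht, hs⟩ := hcon
  -- Just after `a` there is a parameter `u` before `t` and before the next joint; there `z' > 0`,
  -- although `z` is constant between `s` and `t`.
  set a := max s 0 with hadef
  have ha0 : 0 ≤ a := le_max_right _ _
  have hat : a < t := max_lt hst ht
  have hle := Nat.floor_le ha0
  have hlt := Nat.lt_floor_add_one a
  have hend : ∀ j : ℕ, ((j + 1 : ℕ) : ℕ∞) = ℓ → a < j := fun j hj => by
    refine max_lt (hs j hj) ?_
    have h1 := H.two_le
    rw [← hj] at h1
    have h2 : 2 ≤ j + 1 := by exact_mod_cast h1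
    exact_mod_cast (show 0 < j by omega)
  have hn : ((⌊a⌋₊ : ℕ) : ℕ∞) < ℓ := by
    by_contra hn
    obtain ⟨j, hj, hja⟩ := H.lt_top_of_gt ha0 hn
    linarith [hend j hj]
  have hn1 : ((⌊a⌋₊ + 1 : ℕ) : ℕ∞) < ℓ := (ENat.succ_lt_or_eq hn).resolve_right fun hj => by
    linarith [hend _ hj]
  obtain ⟨u, hu1, hu2⟩ := exists_between (lt_min hat hlt)
  have hpos := H.profile.rising _ hn1 u ⟨hle.trans_lt hu1, hu2.trans_le (min_le_right _ _)⟩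
  have hconst : z =ᶠ[𝓝 u] fun _ => z s := by
    filter_upwards [Ioo_mem_nhds ((le_max_left s 0).trans_lt hu1) (hu2.trans_le (min_le_left _ _))]
      with v hv
    exact le_antisymm ((H.monotone_height hv.2.le).trans heq.ge) (H.monotone_height hv.1.le)
  rw [hconst.deriv_eq] at hpos
  simp at hpos

end IsAtlas

theorem neg_one_pow_mul_neg_one_pow (n : ℕ) (r : ℝ) : ((-1 : ℝ) ^ n * r) ^ 2 = r ^ 2 := by
  rw [mul_pow, ← pow_mul, mul_comm n 2, pow_mul]; norm_num

/-- If the order were reversed, one interval would contain a point of the other by betweenness. -/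
theorem Set.OrdConnected.lt_of_disjoint {A A' : Set ℝ} (hA : A.OrdConnected)
    (hA' : A'.OrdConnected) (hd : Disjoint A A') {s s' u u' : ℝ} (hs : s ∈ A) (hu : u ∈ A)
    (hs' : s' ∈ A') (hu' : u' ∈ A') (hlt : s < s') : u < u' := by
  by_contra hcon
  rw [not_lt] at hcon
  rcases le_or_gt s u' with h | h
  · exact Set.disjoint_left.1 hd (hA.out hs hu ⟨h, hcon⟩) hu'
  · exact Set.disjoint_left.1 hd hs (hA'.out hu' hs' ⟨h.le, hlt.le⟩)

namespace IsSlicing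

variable {ℓ : ℕ∞} {x z : ℝ → ℝ} {δ : ℕ → ℝ} {h : ℕ → ℝ → ℝ} {X Z : ℝ → ℝ → ℝ}

theorem zero_lt (H : IsSlicing ℓ x z δ h X Z) : ((0 : ℕ) : ℕ∞) < ℓ :=
  lt_of_lt_of_le (by norm_num) H.two_le

theorem middle_pos (H : IsSlicing ℓ x z δ h X Z) {j : ℕ} (hj : ((j + 1 : ℕ) : ℕ∞) < ℓ) {s : ℝ}
    (hs : s ∈ middle δ j) : 0 < (-1 : ℝ) ^ (j + 1) * x s :=
  H.profile.side j hj s (H.middle_subset j hs)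

theorem middle_ne_zero (H : IsSlicing ℓ x z δ h X Z) {j : ℕ} (hj : ((j + 1 : ℕ) : ℕ∞) < ℓ) {s : ℝ}
    (hs : s ∈ middle δ j) : x s ≠ 0 := fun h0 => by
  have := H.middle_pos hj hs
  rw [h0, mul_zero] at this
  exact lt_irrefl _ this

theorem contDiff_fst_snd (H : IsSlicing ℓ x z δ h X Z) :
    ContDiff ℝ ∞ (fun p : ℝ × ℝ => X p.1 p.2) ∧ ContDiff ℝ ∞ (fun p : ℝ × ℝ => Z p.1 p.2) := by
  have key : ∀ p : ℝ × ℝ, ContDiffAt ℝ ∞ (fun p : ℝ × ℝ => X p.1 p.2) p ∧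
      ContDiffAt ℝ ∞ (fun p : ℝ × ℝ => Z p.1 p.2) p := fun p => by
    rcases H.mem_zone_or_middle p.1 with ⟨j, hj, hp⟩ | ⟨-, j, hj, hp⟩
    · have hev : ∀ᶠ q : ℝ × ℝ in 𝓝 p, q.1 ∈ jointZone ℓ j (δ j) :=
        continuous_fst.continuousAt.eventually ((isOpen_jointZone _ _ _).mem_nhds hp)
      have hX : ContDiffAt ℝ ∞ (fun p : ℝ × ℝ => X p.1 p.2) p := by
        refine ((H.zone j hj).contDiffAt_slicePos hp).congr_of_eventuallyEq ?_
        filter_upwards [hev] with q hq using (H.on_zone j hj q.1 hq q.2).1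
      refine ⟨hX, ?_⟩
      have h1 : ContDiffAt ℝ ∞ (fun q : ℝ × ℝ => j + sectorLift (h j) (X q.1 q.2, q.2)) p :=
        contDiffAt_const.add ((contDiff_sectorLift (H.zone j hj).flat).contDiffAt.comp p
          (hX.prodMk contDiffAt_snd))
      refine h1.congr_of_eventuallyEq ?_
      filter_upwards [hev] with q hq using (H.on_zone j hj q.1 hq q.2).2
    · have hev : ∀ᶠ q : ℝ × ℝ in 𝓝 p, q.1 ∈ middle δ j :=
        continuous_fst.continuousAt.eventually (isOpen_Ioo.mem_nhds hp)
      have hx0 := H.middle_ne_zero hj hp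
      have hpos : x p.1 ^ 2 + p.2 ^ 2 ≠ 0 := by positivity
      have hx : ContDiffAt ℝ ∞ (fun p : ℝ × ℝ => x p.1) p :=
        (H.profile.contDiff_fst.comp contDiff_fst).contDiffAt
      have hz : ContDiffAt ℝ ∞ (fun p : ℝ × ℝ => z p.1) p :=
        (H.profile.contDiff_snd.comp contDiff_fst).contDiffAt
      have hr : ContDiffAt ℝ ∞ (fun p : ℝ × ℝ => √(x p.1 ^ 2 + p.2 ^ 2)) p :=
        ((hx.pow 2).add (contDiff_snd.contDiffAt.pow 2)).sqrt hpos
      constructor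
      · refine ((contDiffAt_const (c := (-1 : ℝ) ^ (j + 1))).mul hr).congr_of_eventuallyEq ?_
        filter_upwards [hev] with q hq using (H.on_middle j hj q.1 hq q.2).1
      · refine hz.congr_of_eventuallyEq ?_
        filter_upwards [hev] with q hq using (H.on_middle j hj q.1 hq q.2).2
  exact ⟨contDiff_iff_contDiffAt.2 fun p => (key p).1, contDiff_iff_contDiffAt.2 fun p => (key p).2⟩

/-- In a joint zone `X` moves strictly with `s`; in a middle `Z = z` does. -/
theorem exists_hasDerivAt (H : IsSlicing ℓ x z δ h X Z) (s y : ℝ) :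
    ∃ d ≠ 0, HasDerivAt (fun s => X s y) d s ∨ HasDerivAt (fun s => Z s y) d s := by
  rcases H.mem_zone_or_middle s with ⟨j, hj, hs⟩ | ⟨-, j, hj, hs⟩
  · obtain ⟨d, hd, hpos⟩ := (H.zone j hj).exists_hasDerivAt_slicePos hs y
    refine ⟨d, fun h0 => by simp [h0] at hpos, Or.inl (hd.congr_of_eventuallyEq ?_)⟩
    filter_upwards [(isOpen_jointZone _ _ _).mem_nhds hs] with u hu
      using (H.on_zone j hj u hu y).1
  · refine ⟨_, (H.profile.rising j hj s (H.middle_subset j hs)).ne', Or.inr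
      ((H.profile.contDiff_snd.hasDerivAt_deriv s).congr_of_eventuallyEq ?_)⟩
    filter_upwards [isOpen_Ioo.mem_nhds hs] with u hu using (H.on_middle j hj u hu y).2

theorem sq_middle (H : IsSlicing ℓ x z δ h X Z) {j : ℕ} (hj : ((j + 1 : ℕ) : ℕ∞) < ℓ) {s : ℝ}
    (hs : s ∈ middle δ j) (y : ℝ) : X s y ^ 2 = y ^ 2 + x s ^ 2 ∧ 0 ≤ X s y * x s := by
  have hpos := H.middle_pos hj hs
  rw [(H.on_middle j hj s hs y).1]
  constructor
  · rw [neg_one_pow_mul_neg_one_pow, Real.sq_sqrt (by positivity)]; ring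
  · rw [mul_right_comm]; positivity

/-- A point of the surface is at the height of some point of the curve. -/
theorem exists_foot (H : IsSlicing ℓ x z δ h X Z) (s y : ℝ) : ∃ u, Z s y = z u ∧
    ((∃ j : ℕ, (j : ℕ∞) < ℓ ∧ s ∈ jointZone ℓ j (δ j) ∧ u ∈ jointZone ℓ j (δ j) ∧
        u ∈ Set.uIcc (j : ℝ) s ∧ ((|X s y| ≤ |y| ∧ u = j) ∨
          (X s y ^ 2 = y ^ 2 + x u ^ 2 ∧ 0 ≤ X s y * x u))) ∨
      ((∀ j : ℕ, (j : ℕ∞) < ℓ → s ∉ jointZone ℓ j (δ j)) ∧ u = s ∧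
        ∃ j : ℕ, ((j + 1 : ℕ) : ℕ∞) < ℓ ∧ s ∈ middle δ j)) := by
  rcases H.mem_zone_or_middle s with ⟨j, hj, hs⟩ | ⟨hnot, j, hj, hs⟩
  · obtain ⟨h1, h2⟩ := H.on_zone j hj s hs y
    obtain ⟨u, hu, huI, hzu, hfoot⟩ := (H.zone j hj).exists_foot hs y
    rw [← h1] at hzu hfoot
    exact ⟨u, h2.trans hzu, Or.inl ⟨j, hj, hs, huI, hu, hfoot⟩⟩
  · exact ⟨s, (H.on_middle j hj s hs y).2, Or.inr ⟨hnot, rfl, j, hj, hs⟩⟩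

/-- Call cells the joint zones and the single parameters outside all zones; the foot of a point lies
in the cell of its parameter. Within a zone `X` separates parameters. Different cells are disjoint
intervals, so their feet are ordered as the parameters are, and equal heights would place both
parameters in the same end zone by `eq_end_of_height_eq`. -/
theorem eq_of_lt_absurd (H : IsSlicing ℓ x z δ h X Z) {s s' y : ℝ} (hlt : s < s')
    (hX : X s y = X s' y) (hZ : Z s y = Z s' y) : False := by
  have hsame : ∀ j : ℕ, (j : ℕ∞) < ℓ → s ∈ jointZone ℓ j (δ j) → s' ∉ jointZone ℓ j (δ j) :=
    fun j hj hs hs' => by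
      have := (H.zone j hj).injOn_slicePos y hs hs'
        (by simp only; rw [← (H.on_zone j hj s hs y).1, ← (H.on_zone j hj s' hs' y).1, hX])
      exact hlt.ne this
  have hcell : ∀ s, ∃ (A : Set ℝ) (u : ℝ), A.OrdConnected ∧ s ∈ A ∧ u ∈ A ∧ Z s y = z u ∧
      ((∃ j : ℕ, (j : ℕ∞) < ℓ ∧ A = jointZone ℓ j (δ j)) ∨
        (A = {s} ∧ ∀ j : ℕ, (j : ℕ∞) < ℓ → s ∉ jointZone ℓ j (δ j))) := fun s => by
    obtain ⟨u, hu, ⟨j, hj, hs, huI, -⟩ | ⟨hnot, rfl, -⟩⟩ := H.exists_foot s y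
    · exact ⟨_, u, ordConnected_jointZone _ _ (H.pos j), hs, huI, hu, Or.inl ⟨j, hj, rfl⟩⟩
    · exact ⟨{u}, u, Set.ordConnected_singleton, rfl, rfl, hu, Or.inr ⟨rfl, hnot⟩⟩
  have hmem : ∀ {s u : ℝ} {A : Set ℝ} {k : ℕ}, (k : ℕ∞) < ℓ → s ∈ A → u ∈ A →
      u ∈ jointZone ℓ k (δ k) → ((∃ j : ℕ, (j : ℕ∞) < ℓ ∧ A = jointZone ℓ j (δ j)) ∨
        (A = {s} ∧ ∀ j : ℕ, (j : ℕ∞) < ℓ → s ∉ jointZone ℓ j (δ j))) →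
      s ∈ jointZone ℓ k (δ k) := by
    rintro s u A k hk hs hu huk (⟨j, hj, rfl⟩ | ⟨rfl, hnot⟩)
    · rwa [← H.zone_unique hj hk hu huk]
    · rwa [← Set.mem_singleton_iff.1 hu]
  obtain ⟨A, u, hA, hsA, huA, hZu, hAc⟩ := hcell s
  obtain ⟨A', u', hA', hsA', huA', hZu', hAc'⟩ := hcell s'
  have hdisj : Disjoint A A' := by
    rw [Set.disjoint_left]
    intro v hv hv'
    rcases hAc with ⟨j, hj, rfl⟩ | ⟨rfl, hnot⟩
    · exact hsame j hj hsA (hmem hj hsA' hv' hv hAc')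
    · rw [Set.mem_singleton_iff.1 hv] at hv'
      rcases hAc' with ⟨j, hj, rfl⟩ | ⟨rfl, -⟩
      · exact hnot j hj hv'
      · exact hlt.ne hv'
  have huu := hA.lt_of_disjoint hA' hdisj hsA huA hsA' huA' hlt
  rcases H.eq_end_of_height_eq huu (hZu.symm.trans (hZ.trans hZu')) with h0 | ⟨j, hj, hju⟩
  · have hz : ∀ v ≤ 0, v ∈ jointZone ℓ 0 (δ 0) := fun v hv => by
      rcases hv.eq_or_lt with rfl | hv
      · exact Or.inl (by simpa using H.pos 0)
      · exact Or.inr (Or.inl ⟨rfl, hv⟩)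
    exact hsame 0 H.zero_lt (hmem H.zero_lt hsA huA (hz u (huu.le.trans h0)) hAc)
      (hmem H.zero_lt hsA' huA' (hz u' h0) hAc')
  · have hjl : (j : ℕ∞) < ℓ := by rw [← hj]; exact_mod_cast Nat.lt_succ_self j
    have hz : ∀ v, (j : ℝ) ≤ v → v ∈ jointZone ℓ j (δ j) := fun v hv => by
      rcases hv.eq_or_lt with rfl | hv
      · exact Or.inl (by simpa using H.pos j)
      · exact Or.inr (Or.inr ⟨hj, hv⟩)
    exact hsame j hjl (hmem hjl hsA huA (hz u hju) hAc)
      (hmem hjl hsA' huA' (hz u' (hju.trans huu.le)) hAc')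

theorem injective (H : IsSlicing ℓ x z δ h X Z) {s s' y : ℝ}
    (hX : X s y = X s' y) (hZ : Z s y = Z s' y) : s = s' := by
  rcases lt_trichotomy s s' with hlt | heq | hlt
  · exact (H.eq_of_lt_absurd hlt hX hZ).elim
  · exact heq
  · exact (H.eq_of_lt_absurd hlt hX.symm hZ.symm).elim

theorem sq_le_of_mem_zone (H : IsSlicing ℓ x z δ h X Z) {j : ℕ} (hj : (j : ℕ∞) < ℓ) {s : ℝ}
    (hs : s ∈ jointZone ℓ j (δ j)) (y : ℝ) : |x s| ≤ |X s y| := by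
  rw [(H.on_zone j hj s hs y).1]
  exact sq_le_sq.1 ((H.zone j hj).sq_slicePos_le hs y).1

/-- For `s < 0` one has `|x s| ≤ |X s y|`, and `|x s|` grows linearly as `s → -∞`. -/
theorem exists_left_bound (H : IsSlicing ℓ x z δ h X Z) (R : ℝ) :
    ∃ K, ∀ s y, |X s y| ≤ R → -K ≤ s := by
  obtain ⟨κ, hκ, hg⟩ := H.profile.left_growth (lt_of_le_of_lt (by simp) H.zero_lt)
  refine ⟨|R| / κ, fun s y hX => ?_⟩
  rcases le_or_gt 0 s with hs | hs
  · have : 0 ≤ |R| / κ := by positivity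
    linarith
  · have h1 := (H.sq_le_of_mem_zone H.zero_lt (Or.inr (Or.inl ⟨rfl, hs⟩)) y).trans hX
    have h2 := hg s hs.le
    have h3 : κ * -s ≤ |R| := by
      have := (le_abs_self (x s)).trans (h1.trans (le_abs_self R))
      simp only [zero_add, pow_one] at h2
      linarith
    have h4 : -s ≤ |R| / κ := by rw [le_div_iff₀ hκ]; linarith
    linarith

/-- For finite `ℓ` the linear growth of `x` beyond the last joint bounds `s`. For `ℓ = ⊤` the height
does: the foot lags behind `s` by at most `1 / 2`, and `z` takes the value `j` at `j`. -/
theorem exists_right_bound (H : IsSlicing ℓ x z δ h X Z) (R : ℝ) :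
    ∃ K, ∀ s y, |X s y| ≤ R → |Z s y| ≤ R → s ≤ K := by
  rcases eq_or_ne ℓ ⊤ with rfl | hne
  · refine ⟨|R| + 2, fun s y hX hZ => ?_⟩
    by_contra! hs
    have hR := abs_nonneg R
    obtain ⟨u, hu, hfoot⟩ := H.exists_foot s y
    have hus : s - 1 / 2 ≤ u := by
      rcases hfoot with ⟨j, hj, hsI, -, hu, -⟩ | ⟨-, rfl, -⟩
      · have h1 : |s - j| < 1 / 2 := by
          rcases hsI with h1 | ⟨-, h1⟩ | ⟨h1, -⟩
          · exact h1.trans (H.lt_half j)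
          · linarith
          · exact absurd h1 (ENat.natCast_ne_top _)
        have h2 := Set.abs_sub_right_of_mem_uIcc hu
        linarith [(abs_le.1 h2).2, le_abs_self (s - u)]
      · linarith
    have hu0 : 0 ≤ u := by linarith
    have h1 := H.monotone_height (Nat.floor_le hu0)
    rw [(H.profile.joint _ (ENat.natCast_lt_top _)).2] at h1
    have h2 := Nat.lt_floor_add_one u
    have h3 := (le_abs_self (Z s y)).trans (hZ.trans (le_abs_self R))
    rw [hu] at h3
    linarith
  · obtain ⟨N, rfl⟩ := ENat.ne_top_iff_exists.1 hne
    have hN : 2 ≤ N := by exact_mod_cast H.two_le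
    obtain ⟨J, rfl⟩ : ∃ J, N = J + 1 := ⟨N - 1, by omega⟩
    have hJ : (J : ℕ∞) < ((J + 1 : ℕ) : ℕ∞) := by exact_mod_cast Nat.lt_succ_self J
    obtain ⟨κ, hκ, hg⟩ := H.profile.right_growth (j := J) rfl
    refine ⟨J + |R| / κ, fun s y hX _ => ?_⟩
    rcases le_or_gt s J with hs | hs
    · have : 0 ≤ |R| / κ := by positivity
      linarith
    · have h1 := (H.sq_le_of_mem_zone hJ (Or.inr (Or.inr ⟨rfl, hs⟩)) y).trans hX
      have h2 := hg s hs.le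
      have h3 : κ * (s - J) ≤ |R| := by
        refine h2.trans ((le_abs_self _).trans ?_)
        rw [abs_mul, abs_pow, abs_neg, abs_one, one_pow, one_mul]
        exact h1.trans (le_abs_self R)
      have h4 : s - J ≤ |R| / κ := by rw [le_div_iff₀ hκ]; linarith
      linarith

end IsSlicing

/-! ### The embedding of the plane -/

theorem mem_orbitsThrough_arc {ℓ : ℕ∞} {γ : ℝ → Eucl (Fin 3)} {p : Eucl (Fin 3)} {s : ℝ}
    (hs : s ∈ paramSet ℓ) (h1 : γ s 1 = 0) (h2 : p 2 = γ s 2) (h0 : γ s 0 ≠ 0)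
    (hsq : p 0 ^ 2 = p 1 ^ 2 + γ s 0 ^ 2) (hpos : 0 ≤ p 0 * γ s 0) :
    p ∈ orbitsThrough (arc ℓ γ) := by
  -- The time is found from `y = sinh t * γ s 0`; the sign condition then picks the right branch for
  -- `x`.
  refine ⟨γ s, ⟨s, hs, rfl⟩, Real.arsinh (p 1 / γ s 0), ?_⟩
  rw [linearFlow_hyperbolicMatrix, Real.sinh_arsinh, Real.cosh_arsinh, h1]
  have hx : √(1 + (p 1 / γ s 0) ^ 2) * γ s 0 = p 0 := by
    have h3 : 1 + (p 1 / γ s 0) ^ 2 = (p 0 / γ s 0) ^ 2 := by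
      rw [div_pow, div_pow, hsq]; field_simp; ring
    have h4 : 0 ≤ p 0 / γ s 0 := by
      rw [← mul_div_mul_right _ _ h0]
      exact div_nonneg hpos (mul_self_nonneg _)
    rw [h3, Real.sqrt_sq h4]; field_simp
  ext i
  fin_cases i
  · simp [hx]
  · simp; field_simp
  · simp [h2]

theorem of_mem_orbitsThrough_arc {ℓ : ℕ∞} {γ : ℝ → Eucl (Fin 3)} {p : Eucl (Fin 3)}
    (hγ : ∀ s ∈ paramSet ℓ, γ s 1 = 0) (hp : p ∈ orbitsThrough (arc ℓ γ)) :
    ∃ s ∈ paramSet ℓ, p 2 = γ s 2 ∧ p 0 ^ 2 = p 1 ^ 2 + γ s 0 ^ 2 ∧ 0 ≤ p 0 * γ s 0 := by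
  obtain ⟨_, ⟨s, hs, rfl⟩, t, rfl⟩ := hp
  refine ⟨s, hs, ?_⟩
  rw [linearFlow_hyperbolicMatrix, hγ s hs]
  have h1 := Real.cosh_sq t
  have h2 := Real.cosh_pos t
  refine ⟨by simp, ?_, ?_⟩
  · simp; rw [mul_pow, mul_pow, h1]; ring
  · simp; rw [mul_assoc]; exact mul_nonneg h2.le (mul_self_nonneg _)

/-- The parametrization of the surface by its slices `y = const`. -/
noncomputable def sliceMap (X Z : ℝ → ℝ → ℝ) (p : Eucl (Fin 2)) : Eucl (Fin 3) :=
  !₂[X (p 0) (p 1), p 1, Z (p 0) (p 1)]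

namespace IsSlicing

variable {ℓ : ℕ∞} {x z : ℝ → ℝ} {δ : ℕ → ℝ} {h : ℕ → ℝ → ℝ} {X Z : ℝ → ℝ → ℝ}

theorem contDiff_sliceMap (H : IsSlicing ℓ x z δ h X Z) : ContDiff ℝ ∞ (sliceMap X Z) := by
  have hv : ∀ i, ContDiff ℝ ∞ fun p : Eucl (Fin 2) => p i := fun i =>
    contDiff_euclidean.1 contDiff_id i
  have hp : ContDiff ℝ ∞ fun p : Eucl (Fin 2) => (p 0, p 1) := (hv 0).prodMk (hv 1)
  rw [contDiff_euclidean]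
  intro i
  fin_cases i
  · exact H.contDiff_fst_snd.1.comp hp
  · exact hv 1
  · exact H.contDiff_fst_snd.2.comp hp

theorem injective_sliceMap (H : IsSlicing ℓ x z δ h X Z) : Function.Injective (sliceMap X Z) := by
  intro p q hpq
  have h0 : X (p 0) (p 1) = X (q 0) (q 1) := congrArg (fun v : Eucl (Fin 3) => v 0) hpq
  have h1 : p 1 = q 1 := congrArg (fun v : Eucl (Fin 3) => v 1) hpq
  have h2 : Z (p 0) (p 1) = Z (q 0) (q 1) := congrArg (fun v : Eucl (Fin 3) => v 2) hpq
  rw [← h1] at h0 h2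
  ext i
  fin_cases i
  · exact H.injective h0 h2
  · exact h1

/-- A continuous injective proper map is a closed embedding. A bound on the image bounds `y`
directly and `s` by the left and right bounds. -/
theorem isEmbedding_sliceMap (H : IsSlicing ℓ x z δ h X Z) :
    Topology.IsEmbedding (sliceMap X Z) := by
  have hproper : IsProperMap (sliceMap X Z) := by
    rw [isProperMap_iff_tendsto_cocompact]
    refine ⟨H.contDiff_sliceMap.continuous, ?_⟩
    rw [← Metric.cobounded_eq_cocompact, ← Metric.cobounded_eq_cocompact,
      ← tendsto_norm_atTop_iff_cobounded, Filter.tendsto_atTop]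
    intro R
    obtain ⟨K₁, hK₁⟩ := H.exists_left_bound R
    obtain ⟨K₂, hK₂⟩ := H.exists_right_bound R
    filter_upwards [tendsto_norm_cobounded_atTop.eventually_gt_atTop (|K₁| + |K₂| + |R|)] with p hp
    by_contra! hcon
    have hle : ∀ i, |sliceMap X Z p i| ≤ R := fun i =>
      (PiLp.norm_apply_le (sliceMap X Z p) i).trans hcon.le
    have h0 : |X (p 0) (p 1)| ≤ R := hle 0
    have h1 : |p 1| ≤ R := hle 1
    have h2 : |Z (p 0) (p 1)| ≤ R := hle 2
    have h3 := hK₁ _ _ h0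
    have h4 := hK₂ _ _ h0 h2
    have h5 : |p 0| ≤ |K₁| + |K₂| := by
      rw [abs_le]
      constructor <;> linarith [le_abs_self K₁, le_abs_self K₂, abs_nonneg K₁, abs_nonneg K₂]
    have h6 : ‖p‖ ≤ |p 0| + |p 1| := by
      rw [EuclideanSpace.norm_eq, Fin.sum_univ_two]
      refine Real.sqrt_le_iff.2 ⟨by positivity, ?_⟩
      simp only [Real.norm_eq_abs]
      nlinarith [abs_nonneg (p 0), abs_nonneg (p 1)]
    linarith [le_abs_self R]
  exact (Topology.IsClosedEmbedding.of_continuous_injective_isClosedMap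
    H.contDiff_sliceMap.continuous H.injective_sliceMap hproper.isClosedMap).isEmbedding

/-- The coordinate `y` forces a kernel vector into the `s`-direction, along which `X` or `Z` has
nonzero derivative. -/
theorem injective_fderiv_sliceMap (H : IsSlicing ℓ x z δ h X Z) (p : Eucl (Fin 2)) :
    Function.Injective (fderiv ℝ (sliceMap X Z) p) := by
  have hd : DifferentiableAt ℝ (sliceMap X Z) p := H.contDiff_sliceMap.differentiable (by simp) p
  refine (injective_iff_map_eq_zero _).2 fun v hv => ?_
  have h1 : v 1 = 0 := by
    have := fderiv_apply_coord hd v 1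
    rw [hv, show (fun p => sliceMap X Z p 1) =
      (EuclideanSpace.proj 1 : Eucl (Fin 2) →L[ℝ] ℝ) from rfl, ContinuousLinearMap.fderiv] at this
    simpa using this.symm
  let e : Eucl (Fin 2) := EuclideanSpace.single 0 1
  have hve : v = v 0 • e := by
    ext i
    fin_cases i
    · simp [e]
    · simp [e, h1]
  have hline : HasDerivAt (fun s : ℝ => p + (s - p 0) • e) e (p 0) := by
    have := (((hasDerivAt_id (p 0)).sub_const (p 0)).smul_const e).const_add p
    simpa using this
  have hpl : p + (p 0 - p 0) • e = p := by simp
  have hcurve : ∀ i, HasDerivAt (fun s : ℝ => sliceMap X Z (p + (s - p 0) • e) i)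
      ((fderiv ℝ (sliceMap X Z) p e) i) (p 0) := fun i => by
    have h2 : HasFDerivAt (sliceMap X Z) (fderiv ℝ (sliceMap X Z) p) (p + (p 0 - p 0) • e) := by
      rw [hpl]; exact hd.hasFDerivAt
    have h3 := h2.comp_hasDerivAt (p 0) hline
    exact (EuclideanSpace.proj i : Eucl (Fin 3) →L[ℝ] ℝ).hasFDerivAt.comp_hasDerivAt (p 0) h3
  have hcoord : ∀ s : ℝ, (p + (s - p 0) • e) 0 = s ∧ (p + (s - p 0) • e) 1 = p 1 := fun s => by
    constructor <;> simp [e]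
  obtain ⟨d, hd0, hXZ⟩ := H.exists_hasDerivAt (p 0) (p 1)
  have hne : fderiv ℝ (sliceMap X Z) p e ≠ 0 := by
    intro h0
    refine hd0 ?_
    rcases hXZ with hX | hZ
    · have h2 := hcurve 0
      rw [show (fun s : ℝ => sliceMap X Z (p + (s - p 0) • e) 0) = fun s => X s (p 1) from
        funext fun s => by
          change X ((p + (s - p 0) • e) 0) ((p + (s - p 0) • e) 1) = _
          rw [(hcoord s).1, (hcoord s).2]] at h2
      rw [hX.unique h2, h0]; rfl
    · have h2 := hcurve 2
      rw [show (fun s : ℝ => sliceMap X Z (p + (s - p 0) • e) 2) = fun s => Z s (p 1) from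
        funext fun s => by
          change Z ((p + (s - p 0) • e) 0) ((p + (s - p 0) • e) 1) = _
          rw [(hcoord s).1, (hcoord s).2]] at h2
      rw [hZ.unique h2, h0]; rfl
  rw [hve, map_smul] at hv
  rw [hve, (smul_eq_zero.1 hv).resolve_right hne, zero_smul]

theorem mem_cutPlane_iff {c : ℝ} {S : Set ℝ} {p : Eucl (Fin 3)} :
    p ∈ cutPlane c S ↔ p 2 = c ∧ ∀ σ ∈ S, σ * p 0 ≤ |p 1| := by
  simp [cutPlane, quadrant]

theorem mem_stackedSurface_iff {γ : ℝ → Eucl (Fin 3)} {p : Eucl (Fin 3)} :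
    p ∈ stackedSurface ℓ γ ↔ (∃ j : ℕ, (j : ℕ∞) < ℓ ∧ p ∈ cutPlane j (removedSides ℓ j)) ∨
      p ∈ orbitsThrough (arc ℓ γ) := by
  simp [stackedSurface]

theorem sliceMap_mem (H : IsSlicing ℓ x z δ h X Z) {γ : ℝ → Eucl (Fin 3)}
    (hγ : ∀ s ∈ paramSet ℓ, γ s 1 = 0 ∧ x s = γ s 0 ∧ z s = γ s 2) (p : Eucl (Fin 2)) :
    sliceMap X Z p ∈ stackedSurface ℓ γ := by
  rw [mem_stackedSurface_iff]
  obtain ⟨s, hs⟩ : ∃ s, p 0 = s := ⟨_, rfl⟩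
  obtain ⟨y, hy⟩ : ∃ y, p 1 = y := ⟨_, rfl⟩
  have e0 : sliceMap X Z p 0 = X s y := by rw [← hs, ← hy]; rfl
  have e1 : sliceMap X Z p 1 = y := by rw [← hy]; rfl
  have e2 : sliceMap X Z p 2 = Z s y := by rw [← hs, ← hy]; rfl
  have horb : ∀ u ∈ paramSet ℓ, x u ≠ 0 → Z s y = z u → X s y ^ 2 = y ^ 2 + x u ^ 2 →
      0 ≤ X s y * x u → sliceMap X Z p ∈ orbitsThrough (arc ℓ γ) := fun u hu hx hz hsq hpos => by
    obtain ⟨g1, g0, g2⟩ := hγ u hu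
    refine mem_orbitsThrough_arc hu g1 (by rw [e2, hz, g2]) (by rwa [← g0]) ?_ ?_
    · rw [e0, e1, ← g0]; exact hsq
    · rw [e0, ← g0]; exact hpos
  obtain ⟨u, hu, ⟨j, hj, hsI, huI, hus, hfoot⟩ | ⟨-, rfl, j, hj, hmid⟩⟩ := H.exists_foot s y
  · have hside : ∀ σ ∈ removedSides ℓ j, σ = 1 ∨ σ = -1 := fun σ hσ => eq_or_of_mem_removedSides hσ
    have hplane : |X s y| ≤ |y| → u = j → ∃ j : ℕ, (j : ℕ∞) < ℓ ∧
        sliceMap X Z p ∈ cutPlane j (removedSides ℓ j) := fun hle huj => by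
      refine ⟨j, hj, mem_cutPlane_iff.2 ⟨by rw [e2, hu, huj, (H.profile.joint j hj).2],
        fun σ hσ => ?_⟩⟩
      rw [e0, e1]
      refine (le_abs_self _).trans (le_trans ?_ hle)
      rw [abs_mul]
      rcases hside σ hσ with rfl | rfl <;> simp
    rcases hfoot with ⟨hle, huj⟩ | ⟨hsq, hpos⟩
    · exact Or.inl (hplane hle huj)
    by_cases huj : u = j
    · refine Or.inl (hplane (sq_le_sq.1 ?_) huj)
      rw [hsq, huj, (H.profile.joint j hj).1]; simp
    have hxu : x u ≠ 0 := (H.zone j hj).ne_zero huI huj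
    by_cases hup : u ∈ paramSet ℓ
    · exact Or.inr (horb u hup hxu hu hsq hpos)
    -- A foot outside the parameter interval lies on a horizontal continuation, so the point belongs
    -- to an end plane, on the side that is not removed.
    left
    rcases H.trichotomy u with hneg | ⟨k, hk, rfl⟩ | ⟨k, hk, hku⟩ | ⟨k, hk, hku⟩
    · have h0I : u ∈ jointZone ℓ 0 (δ 0) := Or.inr (Or.inl ⟨rfl, hneg⟩)
      obtain rfl := H.zone_unique H.zero_lt hj h0I huI
      have hxpos := (H.zone 0 hj).neg_of_lt huI (by simpa using hneg)
      simp only [zero_add, pow_one] at hxpos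
      refine ⟨0, hj, mem_cutPlane_iff.2
        ⟨by rw [e2, hu, H.profile.left_height u hneg.le]; simp, fun σ hσ => ?_⟩⟩
      rw [e0, e1]
      rcases hσ with ⟨h1, -⟩ | ⟨-, rfl⟩
      · omega
      · have : 0 ≤ X s y := nonneg_of_mul_nonneg_left hpos (by linarith)
        simp only [zero_add, pow_one]
        linarith [abs_nonneg y]
    · exact absurd (natCast_mem_paramSet hk) hup
    · exact absurd (Icc_subset_paramSet hk (Set.Ioo_subset_Icc_self hku)) hup
    · have hkl : (k : ℕ∞) < ℓ := by rw [← hk]; exact_mod_cast Nat.lt_succ_self k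
      have hkI : u ∈ jointZone ℓ k (δ k) := Or.inr (Or.inr ⟨hk, hku⟩)
      obtain rfl := H.zone_unique hkl hj hkI huI
      have hxpos := (H.zone k hj).pos_of_lt huI hku
      refine ⟨k, hj, mem_cutPlane_iff.2
        ⟨by rw [e2, hu, H.profile.right_height k hk u hku.le], fun σ hσ => ?_⟩⟩
      rw [e0, e1]
      rcases hσ with ⟨-, rfl⟩ | ⟨h1, -⟩
      · have h2 : ((-1 : ℝ) ^ k * X s y) * ((-1) ^ (k + 1) * x u) ≤ 0 := by
          have : ((-1 : ℝ) ^ k * X s y) * ((-1) ^ (k + 1) * x u) =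
            -(((-1 : ℝ) ^ k * (-1) ^ k) * (X s y * x u)) := by ring
          rw [this, neg_one_pow_mul_self]; linarith
        have h3 : (-1 : ℝ) ^ k * X s y ≤ 0 := by
          by_contra! hcon
          linarith [mul_pos hcon hxpos]
        linarith [abs_nonneg y]
      · exact absurd hk h1.ne
  · obtain ⟨hsq, hpos⟩ := H.sq_middle hj hmid y
    exact Or.inr (horb u (Icc_subset_paramSet hj (Set.Ioo_subset_Icc_self (H.middle_subset j hmid)))
      (H.middle_ne_zero hj hmid) hu hsq hpos)

theorem exists_sliceMap_eq (H : IsSlicing ℓ x z δ h X Z) {γ : ℝ → Eucl (Fin 3)}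
    (hγ : ∀ s ∈ paramSet ℓ, γ s 1 = 0 ∧ x s = γ s 0 ∧ z s = γ s 2) {p : Eucl (Fin 3)}
    (hp : p ∈ stackedSurface ℓ γ) : ∃ q, sliceMap X Z q = p := by
  suffices hs : ∃ s, X s (p 1) = p 0 ∧ Z s (p 1) = p 2 by
    obtain ⟨s, h0, h2⟩ := hs
    refine ⟨!₂[s, p 1], ?_⟩
    ext i
    fin_cases i
    · exact h0
    · rfl
    · exact h2
  have hzone : ∀ j : ℕ, (j : ℕ∞) < ℓ → (∃ s ∈ jointZone ℓ j (δ j),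
      slicePos x (rightCutoff ℓ j (δ j)) (leftCutoff j (δ j)) ((-1) ^ (j + 1)) s (p 1) = p 0 ∧
        j + sectorLift (h j) (p 0, p 1) = p 2) → ∃ s, X s (p 1) = p 0 ∧ Z s (p 1) = p 2 := by
    rintro j hj ⟨s, hs, h1, h2⟩
    obtain ⟨h3, h4⟩ := H.on_zone j hj s hs (p 1)
    exact ⟨s, h3.trans h1, by rw [h4, h3, h1, h2]⟩
  rcases mem_stackedSurface_iff.1 hp with ⟨j, hj, hp⟩ | hp
  · obtain ⟨hp2, hσ⟩ := mem_cutPlane_iff.1 hp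
    refine hzone j hj ?_
    have hZ := H.zone j hj
    rw [hp2]
    rcases le_or_gt |p 0| |p 1| with hle | hgt
    · exact hZ.exists_slicePos_eq_of_abs_le hle
    have hne : p 0 ≠ 0 := fun h0 => by
      rw [h0, abs_zero] at hgt; linarith [abs_nonneg (p 1)]
    have habs : |(-1 : ℝ) ^ (j + 1) * p 0| = |p 0| := by
      rw [abs_mul, abs_pow, abs_neg, abs_one, one_pow, one_mul]
    have hval : ∀ s ∈ jointZone ℓ j (δ j), (∀ u ∈ Set.uIcc (j : ℝ) s, z u = j) →
        slicePos x (rightCutoff ℓ j (δ j)) (leftCutoff j (δ j)) ((-1) ^ (j + 1)) s (p 1) = p 0 →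
        j + sectorLift (h j) (p 0, p 1) = j := fun s hs hz hsp => by
      obtain ⟨u, hu, -, hu2, -⟩ := hZ.exists_foot hs (p 1)
      rw [hsp] at hu2
      rw [hu2, hz u hu]
    rcases lt_or_ge 0 ((-1 : ℝ) ^ (j + 1) * p 0) with hpos | hneg
    -- The point lies in the open quadrant of sign `(-1) ^ (j + 1)`, which is kept only at the last
    -- joint. There the right cutoff is `0`, so `reach_right` must be its unbounded alternative, and
    -- the height along the continuation is constantly `j`.
    · have hend : ((j + 1 : ℕ) : ℕ∞) = ℓ := (ENat.succ_lt_or_eq hj).resolve_left fun hlt => by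
        have := hσ _ (Or.inr ⟨hlt, rfl⟩)
        rw [abs_of_pos hpos] at habs
        linarith
      obtain ⟨κ, hκ, hg⟩ := H.profile.right_growth hend
      rcases hZ.reach_right with ⟨s, -, -, hs⟩ | hB
      · rw [rightCutoff, if_pos hend] at hs; norm_num at hs
      obtain ⟨s, hs, hjs, hBs⟩ := hB ((-1 : ℝ) ^ (j + 1) * p 0)
      obtain ⟨u, hu, hup⟩ := hZ.exists_slicePos_eq (v := p 0) (y := p 1) hZ.mem hs
        (by rw [hZ.slicePos_joint, mul_zero]; exact hpos.le)
        (hBs.trans (hZ.bounds_of_ge hs hjs _).2.1)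
      have hju : (j : ℝ) ≤ u := by
        by_contra! hlt
        have h1 := hZ.bounds_of_le hu hlt.le (p 1)
        rw [hup] at h1
        linarith [h1.1, h1.2.1]
      refine ⟨u, hu, hup, hval u hu (fun v hv => ?_) hup⟩
      rw [Set.uIcc_of_le hju] at hv
      exact H.profile.right_height j hend v hv.1
    · have hneg' : (-1 : ℝ) ^ (j + 1) * p 0 < 0 := lt_of_le_of_ne hneg (by simp [hne])
      -- Symmetrically, the opposite quadrant is kept only in the first plane.
      obtain rfl : j = 0 := by
        by_contra hj0
        have := hσ _ (Or.inl ⟨by omega, rfl⟩)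
        rw [abs_of_neg hneg', pow_succ] at habs
        linarith
      rcases hZ.reach_left with ⟨s, -, -, hs⟩ | hB
      · rw [leftCutoff, if_pos rfl] at hs; norm_num at hs
      obtain ⟨s, hs, hjs, hBs⟩ := hB ((-1 : ℝ) ^ (0 + 1) * p 0)
      obtain ⟨u, hu, hup⟩ := hZ.exists_slicePos_eq (v := p 0) (y := p 1) hs hZ.mem
        ((hZ.bounds_of_le hs hjs _).2.1.trans hBs)
        (by rw [hZ.slicePos_joint, mul_zero]; exact hneg)
      have hju : u ≤ ((0 : ℕ) : ℝ) := by
        by_contra! hlt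
        have h1 := hZ.bounds_of_ge hu hlt.le (p 1)
        rw [hup] at h1
        linarith [h1.1, h1.2.1]
      refine ⟨u, hu, hup, hval u hu (fun v hv => ?_) hup⟩
      rw [Set.uIcc_of_ge hju] at hv
      have := H.profile.left_height v (by simpa using hv.2)
      simpa using this
  · obtain ⟨s, hs, h2, hsq, hpos⟩ := of_mem_orbitsThrough_arc (fun s hs => (hγ s hs).1) hp
    obtain ⟨-, g0, g2⟩ := hγ s hs
    rw [← g0] at hsq hpos
    rw [← g2] at h2
    rcases H.mem_zone_or_middle s with ⟨j, hj, hsI⟩ | ⟨-, j, hj, hmid⟩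
    · refine hzone j hj ?_
      rw [h2]
      exact (H.zone j hj).exists_slicePos_eq_of_sq hsI hsq hpos
    · obtain ⟨hX, hZ⟩ := H.on_middle j hj s hmid (p 1)
      refine ⟨s, ?_, by rw [hZ, h2]⟩
      have hpos' := H.middle_pos hj hmid
      have h3 : 0 ≤ (-1 : ℝ) ^ (j + 1) * p 0 := by
        refine nonneg_of_mul_nonneg_left (b := (-1 : ℝ) ^ (j + 1) * x s) ?_ hpos'
        have : (-1 : ℝ) ^ (j + 1) * p 0 * ((-1) ^ (j + 1) * x s) =
          ((-1 : ℝ) ^ (j + 1) * (-1) ^ (j + 1)) * (p 0 * x s) := by ring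
        rw [this, neg_one_pow_mul_self, one_mul]; exact hpos
      have h4 : √(x s ^ 2 + p 1 ^ 2) = (-1 : ℝ) ^ (j + 1) * p 0 := by
        rw [add_comm, ← hsq, ← neg_one_pow_mul_neg_one_pow (j + 1), Real.sqrt_sq h3]
      rw [hX, h4, ← mul_assoc, neg_one_pow_mul_self, one_mul]

theorem range_sliceMap (H : IsSlicing ℓ x z δ h X Z) {γ : ℝ → Eucl (Fin 3)}
    (hγ : ∀ s ∈ paramSet ℓ, γ s 1 = 0 ∧ x s = γ s 0 ∧ z s = γ s 2) :
    Set.range (sliceMap X Z) = stackedSurface ℓ γ := by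
  refine Set.Subset.antisymm ?_ fun p hp => H.exists_sliceMap_eq hγ hp
  rintro _ ⟨p, rfl⟩
  exact H.sliceMap_mem hγ p

theorem fst_eq_zero_iff (H : IsSlicing ℓ x z δ h X Z) (s : ℝ) :
    X s 0 = 0 ↔ ∃ j : ℕ, (j : ℕ∞) < ℓ ∧ s = j := by
  constructor
  · intro h0
    rcases H.mem_zone_or_middle s with ⟨j, hj, hs⟩ | ⟨-, j, hj, hs⟩
    · refine ⟨j, hj, (H.zone j hj).injOn_slicePos 0 hs (H.zone j hj).mem ?_⟩
      simp only
      rw [(H.zone j hj).slicePos_joint, ← (H.on_zone j hj s hs 0).1, h0]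
    · have h1 := (H.sq_middle hj hs 0).1
      have h2 := H.middle_ne_zero hj hs
      rw [h0] at h1
      have : 0 < x s ^ 2 := by positivity
      linarith
  · rintro ⟨j, hj, rfl⟩
    rw [(H.on_zone j hj j (H.zone j hj).mem 0).1, (H.zone j hj).slicePos_joint]

end IsSlicing

/-! ### The induced planar flow, its equilibria, and the theorem. -/

theorem ENat.encard_setOf_natCast_lt (ℓ : ℕ∞) : {j : ℕ | (j : ℕ∞) < ℓ}.encard = ℓ := by
  rcases eq_or_ne ℓ ⊤ with rfl | hne
  · have : {j : ℕ | (j : ℕ∞) < ⊤} = Set.univ := Set.eq_univ_of_forall fun j => ENat.natCast_lt_top j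
    rw [this, Set.encard_univ]; simp
  · obtain ⟨N, rfl⟩ := ENat.ne_top_iff_exists.1 hne
    have : {j : ℕ | (j : ℕ∞) < N} = (Finset.range N : Set ℕ) := by
      ext j; simp
    rw [this, Set.encard_coe_eq_coe_finsetCard, Finset.card_range]

/-- The flow that an equivariant smooth embedding induces on its source. -/
theorem exists_flow_of_invariant_range {f : Eucl (Fin 2) → Eucl (Fin 3)}
    (hf : ContDiff ℝ ∞ f) (he : Topology.IsEmbedding f)
    (hi : ∀ x, Function.Injective (fderiv ℝ f x))
    (hinv : ∀ t x, linearFlow hyperbolicMatrix t (f x) ∈ Set.range f) :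
    ∃ Φ : Flow ℝ (Eucl (Fin 2)), IsSmoothFlow Φ ∧ IsLinearizingEmbedding Φ hyperbolicMatrix f := by
  -- Preimages are chosen pointwise; the flow laws follow from injectivity of `f`, and smoothness
  -- from the lifting lemma.
  choose φ hφ using hinv
  have hsmooth : ContDiff ℝ ∞ fun p : ℝ × Eucl (Fin 2) => φ p.1 p.2 := by
    refine contDiff_of_comp_embedding hf he hi ?_
    simp only [hφ]
    exact contDiff_linearFlow_hyperbolicMatrix.comp (contDiff_fst.prodMk (hf.comp contDiff_snd))
  let Φ : Flow ℝ (Eucl (Fin 2)) :=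
    { toFun := φ
      cont' := hsmooth.continuous
      map_add' := fun s t x => he.injective (by rw [hφ, hφ, hφ, linearFlow_add])
      map_zero' := fun x => he.injective (by rw [hφ, linearFlow_zero]) }
  exact ⟨Φ, hsmooth, hf, he, hi, fun t x => (hφ t x).symm⟩

/-- Time `1` already suffices: it scales `x + y` by `e` and `x - y` by `e⁻¹`, so both must vanish.
-/
theorem linearFlow_hyperbolicMatrix_fixed_iff (v : Eucl (Fin 3)) :
    (∀ t, linearFlow hyperbolicMatrix t v = v) ↔ v 0 = 0 ∧ v 1 = 0 := by
  constructor
  · intro hv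
    have h1 := hv 1
    rw [linearFlow_hyperbolicMatrix] at h1
    have e0 := congrArg (fun w : Eucl (Fin 3) => w 0) h1
    have e1 := congrArg (fun w : Eucl (Fin 3) => w 1) h1
    simp at e0 e1
    have hexp := Real.cosh_add_sinh 1
    have hexp' := Real.cosh_sub_sinh 1
    have hadd : (Real.exp 1 - 1) * (v 0 + v 1) = 0 := by
      rw [← hexp]; linear_combination e0 + e1
    have hsub : (Real.exp (-1) - 1) * (v 0 - v 1) = 0 := by
      rw [← hexp']; linear_combination e0 - e1
    have h2 := (mul_eq_zero.1 hadd).resolve_left (by simp [sub_eq_zero])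
    have h3 := (mul_eq_zero.1 hsub).resolve_left (by simp [sub_eq_zero])
    constructor <;> linarith
  · rintro ⟨h0, h1⟩ t
    rw [linearFlow_hyperbolicMatrix]
    ext i
    fin_cases i <;> simp [h0, h1]

theorem IsSnake.exists_isSlicing {ℓ : ℕ∞} (hℓ : 2 ≤ ℓ) {γ : ℝ → Eucl (Fin 3)}
    (h : IsSnake ℓ γ) : ∃ x z δ g X Z, IsSlicing ℓ x z δ g X Z ∧
      ∀ s ∈ paramSet ℓ, γ s 1 = 0 ∧ x s = γ s 0 ∧ z s = γ s 2 := by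
  obtain ⟨x, z, H, heq⟩ := (h.isProfile hℓ).exists_isLongProfile hℓ
  obtain ⟨δ, g, Hat⟩ := H.exists_isAtlas hℓ
  obtain ⟨X, Z, Hsl⟩ := Hat.exists_isSlicing
  exact ⟨x, z, δ, g, X, Z, Hsl, fun s hs => ⟨h.planar s hs, heq s hs⟩⟩

theorem hasIsolatedEquilibria_of_equilibria_eq {Φ : Flow ℝ (Eucl (Fin 2))} {ℓ : ℕ∞}
    (h : equilibria Φ = (fun j : ℕ => (!₂[(j : ℝ), 0] : Eucl (Fin 2))) '' {j | (j : ℕ∞) < ℓ}) :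
    HasIsolatedEquilibria Φ ℓ where
  countable := h ▸ (Set.to_countable _).image _
  encard_eq := by
    rw [h, Function.Injective.encard_image, ENat.encard_setOf_natCast_lt]
    intro i j hij
    have := congrArg (fun v : Eucl (Fin 2) => v 0) hij
    simpa using this
  isolated p hp := by
    rw [h] at hp ⊢
    obtain ⟨j, hj, rfl⟩ := hp
    -- The equilibria sit at the points `(j, 0)`, and a strip of half-width `1 / 2` contains only
    -- one of them.
    refine ⟨{q | |q 0 - j| < 1 / 2}, IsOpen.mem_nhds ?_ (by simp), ?_⟩
    · exact isOpen_lt (by fun_prop) continuous_const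
    · ext q
      constructor
      · rintro ⟨hq, i, -, rfl⟩
        have h1 : |((i : ℤ) - j : ℤ)| < 1 := by
          have h2 : |(i : ℝ) - j| < 1 / 2 := by simpa using hq
          have h3 : |(i : ℝ) - j| < 1 := h2.trans (by norm_num)
          exact_mod_cast h3
        have h4 : i = j := by
          have := Int.abs_lt_one_iff.1 h1
          omega
        rw [h4]; rfl
      · rintro rfl
        exact ⟨by simp, j, hj, rfl⟩

theorem IsSnake.exists_planar_flow {ℓ : ℕ∞} (hℓ : 2 ≤ ℓ) {γ : ℝ → Eucl (Fin 3)}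
    (h : IsSnake ℓ γ) : ∃ (Φ : Flow ℝ (Eucl (Fin 2))) (f : Eucl (Fin 2) → Eucl (Fin 3)),
      IsSmoothFlow Φ ∧ HasIsolatedEquilibria Φ ℓ ∧
      IsLinearizingEmbedding Φ hyperbolicMatrix f ∧ Set.range f = stackedSurface ℓ γ := by
  obtain ⟨x, z, δ, g, X, Z, H, hγ⟩ := h.exists_isSlicing hℓ
  have hrange := H.range_sliceMap hγ
  obtain ⟨Φ, hΦ, hf⟩ := exists_flow_of_invariant_range H.contDiff_sliceMap H.isEmbedding_sliceMap
    H.injective_fderiv_sliceMap fun t p => by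
      rw [hrange]
      exact linearFlow_mem_stackedSurface ℓ γ t (hrange ▸ Set.mem_range_self p)
  refine ⟨Φ, _, hΦ, hasIsolatedEquilibria_of_equilibria_eq ?_, hf, hrange⟩
  ext p
  have h1 : p ∈ equilibria Φ ↔ X (p 0) (p 1) = 0 ∧ p 1 = 0 := by
    refine Iff.trans ?_ (linearFlow_hyperbolicMatrix_fixed_iff (sliceMap X Z p))
    refine forall_congr' fun t => ?_
    rw [hf.equivariant, H.injective_sliceMap.eq_iff]
  rw [h1]
  constructor
  · rintro ⟨h0, hp1⟩
    rw [hp1, H.fst_eq_zero_iff] at h0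
    obtain ⟨j, hj, hp0⟩ := h0
    refine ⟨j, hj, ?_⟩
    ext i
    fin_cases i
    · exact hp0.symm
    · exact hp1.symm
  · rintro ⟨j, hj, rfl⟩
    exact ⟨(H.fst_eq_zero_iff j).2 ⟨j, hj, rfl⟩, rfl⟩

theorem hasIsolatedEquilibria_expandFlow {ι : Type} [Fintype ι] (m : ℕ) {Φ : Flow ℝ (Eucl ι)}
    {ℓ : ℕ∞} (h : HasIsolatedEquilibria Φ ℓ) : HasIsolatedEquilibria (expandFlow m Φ) ℓ :=
  hasIsolatedEquilibria_of_image (r := fun p => (euclSum ι (Fin m) p).1) h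
    (continuous_fst.comp (euclSum ι (Fin m)).continuous) (fun x => by simp)
    (equilibria_expandFlow m Φ)

theorem exists_planar_flow (ℓ : ℕ∞) : ∃ (n : ℕ) (Φ : Flow ℝ (Eucl (Fin 2)))
    (A : Matrix (Fin n) (Fin n) ℝ) (f : Eucl (Fin 2) → Eucl (Fin n)),
      IsSmoothFlow Φ ∧ HasIsolatedEquilibria Φ ℓ ∧ IsLinearizingEmbedding Φ A f := by
  rcases le_or_gt 2 ℓ with hℓ | hℓ
  · obtain ⟨γ, hγ⟩ := exists_isSnake ℓ
    obtain ⟨Φ, f, h1, h2, h3, -⟩ := hγ.exists_planar_flow hℓ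
    exact ⟨3, Φ, _, f, h1, h2, h3⟩
  · obtain ⟨N, rfl⟩ := ENat.ne_top_iff_exists.1 hℓ.ne_top
    have hN : N < 2 := by exact_mod_cast hℓ
    interval_cases N
    · exact ⟨2, by exact_mod_cast exists_planar_flow_zero⟩
    · exact ⟨2, by exact_mod_cast exists_planar_flow_one⟩

theorem mainTheorem3 :
    -- On every `ℝ^k`, `k ≥ 2`, any countable number of isolated equilibria is possible.
    (∀ k : ℕ, 2 ≤ k → ∀ ℓ : ℕ∞, ∃ Φ : Flow ℝ (Eucl (Fin k)),
      IsSmoothFlow Φ ∧ HasIsolatedEquilibria Φ ℓ ∧ AdmitsLinearizingEmbedding Φ) ∧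
    -- For `ℓ = 2` the surface is `A₁ ∪ B ∪ A₀`.
    (∀ γ : ℝ → Eucl (Fin 3),
      stackedSurface 2 γ =
        cutPlane 1 {-1} ∪ orbitsThrough (γ '' Set.Icc 0 1) ∪ cutPlane 0 {-1}) ∧
    -- Suitable curves exist for every countable `ℓ ≥ 2`, and for each of them the surface is
    -- invariant and is the image of a linearizing embedding of a planar system with exactly `ℓ`
    -- isolated equilibria.
    (∀ ℓ : ℕ∞, 2 ≤ ℓ →
      (∃ γ : ℝ → Eucl (Fin 3), IsSnake ℓ γ) ∧
      ∀ γ : ℝ → Eucl (Fin 3), IsSnake ℓ γ →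
        (∀ t : ℝ, linearFlow hyperbolicMatrix t '' stackedSurface ℓ γ = stackedSurface ℓ γ) ∧
        ∃ (Φ : Flow ℝ (Eucl (Fin 2))) (f : Eucl (Fin 2) → Eucl (Fin 3)),
          IsSmoothFlow Φ ∧ HasIsolatedEquilibria Φ ℓ ∧
          IsLinearizingEmbedding Φ hyperbolicMatrix f ∧ Set.range f = stackedSurface ℓ γ) ∧
    -- Adding the coordinates `w' = w` extends any such planar system to higher dimensions.
    (∀ (ℓ : ℕ∞) (Φ : Flow ℝ (Eucl (Fin 2))) (n : ℕ) (A : Matrix (Fin n) (Fin n) ℝ)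
      (f : Eucl (Fin 2) → Eucl (Fin n)),
      IsSmoothFlow Φ → HasIsolatedEquilibria Φ ℓ → IsLinearizingEmbedding Φ A f →
      ∀ m : ℕ,
        IsSmoothFlow (expandFlow m Φ) ∧ HasIsolatedEquilibria (expandFlow m Φ) ℓ ∧
        IsLinearizingEmbedding (expandFlow m Φ) (Matrix.fromBlocks A 0 0 1) (expandMap m f)) := by
  refine ⟨fun k hk ℓ => ?_, stackedSurface_two, fun ℓ hℓ => ⟨exists_isSnake ℓ, fun γ hγ =>
    ⟨linearFlow_image_stackedSurface ℓ γ, hγ.exists_planar_flow hℓ⟩⟩,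
    fun ℓ Φ n A f hΦ hℓ hf m => ⟨isSmoothFlow_expandFlow m hΦ,
      hasIsolatedEquilibria_expandFlow m hℓ, isLinearizingEmbedding_expandMap m hf⟩⟩
  obtain ⟨n, Φ, A, f, hΦ, hℓ, hf⟩ := exists_planar_flow ℓ
  -- With `k = 2 + m`, a planar example is extended by `m` expanding coordinates and its coordinates
  -- are renamed.
  obtain ⟨m, rfl⟩ := Nat.exists_eq_add_of_le hk
  exact exists_flow_reindex finSumFinEquiv (isSmoothFlow_expandFlow m hΦ)
    (hasIsolatedEquilibria_expandFlow m hℓ) (isLinearizingEmbedding_expandMap m hf)
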